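/- **Theorem 5.1.** Let $\kappa>0$, let $B_1\subset\mathbb R^2$ be the open unit disk and $Y=[0,2\pi)\times\mathbb R$, with points $\mathbf y=(\varphi,\zeta)$. *Helmholtz side.* Equip $H^1(B_1)$ (complex-valued) with $(u,v)_{\mathcal B}=(u,v)_{L^2(B_1)}+\kappa^{-2}(\nabla u,\nabla v)_{L^2(B_1)}$. For $p\in\mathbb Z$ let $\tilde b_p(\mathbf x)=J_p(\kappa r)e^{\imath p\theta}$ in polar coordinates, where $J_p$ is the Bessel function of the first kind, $\beta_p=\|\tilde b_p\|_{\mathcal B}^{-1}$, $b_p=\beta_p\tilde b_p$, and let $\mathcal B$ be the closure of $\operatorname{span}\{b_p\}_{p\in\mathbb Z}$ in $H^1(B_1)$. *Density side.* Let $w(\mathbf y)=e^{-\kappa\sinh|\zeta|+|\zeta|/4}$ and $(u,v)_{\mathcal A}=\int_Y u\,\overline v\,w^2\,\mathrm d\mathbf y$ on $L^2(Y;w^2)$. For $p\in\mathbb Z$ let $\tilde a_p(\mathbf y)=e^{p\zeta}e^{\imath p\varphi}$, $\alpha_p=\|\tilde a_p\|_{\mathcal A}^{-1}$, $a_p=\alpha_p\tilde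 a_p$, and let $\mathcal A$ be the closure of $\operatorname{span}\{a_p\}_{p\in\mathbb Z}$ in $L^2(Y;w^2)$. Set $\tau_p=\imath^p(\alpha_p\beta_p)^{-1}$, $\tau_-=\inf_{p}|\tau_p|$, $\tau_+=\sup_p|\tau_p|$, and, for $\mathbf y\in Y$, let $\phi_{\mathbf y}(\mathbf x)=e^{\imath\kappa\,\mathbf d(\mathbf y)\cdot\mathbf x}$ with $\mathbf d(\mathbf y)=(\cos(\varphi+\imath\zeta),\sin(\varphi+\imath\zeta))$ be the evanescent plane wave. The Herglotz transform of $v\in\mathcal A$ is $$(Tv)(\mathbf x)=\int_Y v(\mathbf y)\,\phi_{\mathbf y}(\mathbf x)\,w^2(\mathbf y)\,\mathrm d\mathbf y,\qquad \mathbf x\in B_1 .$$ Then: 1. $(a_p)_{p\in\mathbb Z}$ and $(b_p)_{p\in\mathbb Z}$ are orthonormal in $\mathcal A$ and $\mathcal B$ respectively (hence Hilbert bases, their spans being dense by definition), and $0<\tau_-\le\tau_+<\infty$. 2. For every $v\in\mathcal A$ and $\mathbf x\in B_1$ the integral defining $(Tv)(\mathbf x)$ converges absolutely. The map $T$ is a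 bounded, invertible linear operator from $\mathcal A$ onto $\mathcal B$ with bounded inverse, and for all $v\in\mathcal A$, with convergence in $\mathcal B$, $$Tv=\sum_{p\in\mathbb Z}\tau_p\,(v,a_p)_{\mathcal A}\,b_p,\qquad \tau_-\|v\|_{\mathcal A}\le\|Tv\|_{\mathcal B}\le\tau_+\|v\|_{\mathcal A}.$$ In particular $Ta_p=\tau_pb_p$ for all $p\in\mathbb Z$. 3. For every $v\in\mathcal A$, $Tv$ is a weak $H^1(B_1)$ solution of $-\Delta u-\kappa^2u=0$ in $B_1$; conversely, for every weak solution $u\in H^1(B_1)$ of this equation there is a unique $v\in\mathcal A$ with $u=Tv$ (almost everywhere in $B_1$). -/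

import Mathlib

open MeasureTheory
open scoped ContDiff ENNReal

noncomputable section

namespace Herglotz

/-! ### The unit disk, weak gradients, `H¹` and the Helmholtz equation -/

/-- The Euclidean plane. -/
abbrev Plane := EuclideanSpace ℝ (Fin 2)

/-- The vectors of `ℂ²`, with their Hermitian norm (the values of gradients). -/
abbrev CVec := EuclideanSpace ℂ (Fin 2)

/-- The open unit disk `B₁`. -/
def unitDisk : Set Plane := Metric.ball 0 1

/-- Lebesgue measure on the unit disk. -/
def diskMeasure : Measure Plane := volume.restrict unitDisk

/-- The `j`-th partial derivative of a complex-valued function on the plane. -/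
def partialDeriv (j : Fin 2) (f : Plane → ℂ) (x : Plane) : ℂ :=
  fderiv ℝ f x (EuclideanSpace.single j (1 : ℝ))

/-- Complex-valued test functions, that is, elements of `C_c^∞(B₁)`. -/
def IsTestFunction (ψ : Plane → ℂ) : Prop :=
  ContDiff ℝ ∞ ψ ∧ HasCompactSupport ψ ∧ tsupport ψ ⊆ unitDisk

/-- `g` is the weak (distributional) gradient of `u` on the unit disk. -/
def IsWeakGradient (u : Plane → ℂ) (g : Plane → CVec) : Prop :=
  ∀ ψ : Plane → ℂ, IsTestFunction ψ → ∀ j : Fin 2,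
    ∫ x, u x * partialDeriv j ψ x ∂diskMeasure = - ∫ x, g x j * ψ x ∂diskMeasure

/-- `u ∈ H¹(B₁)` and `-Δu - κ²u = 0` in the weak sense: `∫ ∇u·∇ψ - κ² ∫ u ψ = 0` for all `ψ`
in `C_c^∞(B₁)` (equivalently, by density, for all `ψ` in `H¹₀(B₁)`). -/
def IsHelmholtzSolution (κ : ℝ) (u : Plane → ℂ) : Prop :=
  MemLp u 2 diskMeasure ∧
  ∃ g : Plane → CVec, MemLp g 2 diskMeasure ∧ IsWeakGradient u g ∧
    ∀ ψ : Plane → ℂ, IsTestFunction ψ →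
      ∫ x, ∑ j : Fin 2, g x j * partialDeriv j ψ x ∂diskMeasure
        - (κ : ℂ) ^ 2 * ∫ x, u x * ψ x ∂diskMeasure = 0

/-- The space `L²(B₁) × L²(B₁)²` with its Hilbert norm. -/
abbrev L2Pair := WithLp 2 (Lp ℂ 2 diskMeasure × Lp CVec 2 diskMeasure)

instance : IsFiniteMeasure diskMeasure :=
  isFiniteMeasure_restrict.2 (measure_ball_lt_top).ne

theorem IsTestFunction.continuous {ψ : Plane → ℂ} (h : IsTestFunction ψ) : Continuous ψ :=
  h.1.continuous

theorem continuous_partialDeriv {f : Plane → ℂ} (h : ContDiff ℝ 1 f) (j : Fin 2) :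
    Continuous (partialDeriv j f) :=
  (h.continuous_fderiv (by norm_num)).clm_apply continuous_const

theorem IsTestFunction.continuous_partialDeriv {ψ : Plane → ℂ} (h : IsTestFunction ψ)
    (j : Fin 2) : Continuous (partialDeriv j ψ) :=
  Herglotz.continuous_partialDeriv (h.1.of_le (by exact_mod_cast le_top)) j

theorem hasCompactSupport_partialDeriv {ψ : Plane → ℂ} (h : HasCompactSupport ψ)
    (j : Fin 2) : HasCompactSupport (partialDeriv j ψ) :=
  h.fderiv_apply ℝ _

theorem integrable_mul_test {u χ : Plane → ℂ} (hu : MemLp u 2 diskMeasure) (hχ : Continuous χ)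
    (hc : HasCompactSupport χ) : Integrable (fun x => u x * χ x) diskMeasure := by
  obtain ⟨C, hC⟩ := hχ.bounded_above_of_compact_support hc
  exact (hu.integrable (by norm_num)).mul_bdd (c := C) hχ.aestronglyMeasurable
    (Filter.Eventually.of_forall hC)

theorem memLp_coord {g : Plane → CVec} (hg : MemLp g 2 diskMeasure) (j : Fin 2) :
    MemLp (fun x => g x j) 2 diskMeasure :=
  (EuclideanSpace.proj j : CVec →L[ℂ] ℂ).comp_memLp' hg

/-- The space `H¹(B₁)` with the `κ`-dependent inner product
`(u, v) = (u, v)_{L²} + κ⁻² (∇u, ∇v)_{L²}`. An element is stored as the pair `(u, κ⁻¹ ∇u)`, so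
that this inner product is the one inherited from `L²(B₁) × L²(B₁)²`. -/
def H1 (κ : ℝ) : Submodule ℂ L2Pair where
  carrier := {U | IsWeakGradient U.fst (fun x => (κ : ℂ) • U.snd x)}
  zero_mem' := by
    intro ψ _ j
    have h1 : (fun x => ((0 : L2Pair).fst : Plane → ℂ) x * partialDeriv j ψ x)
        =ᵐ[diskMeasure] fun _ => 0 := by
      filter_upwards [Lp.coeFn_zero ℂ 2 diskMeasure] with x hx
      rw [WithLp.zero_fst, hx]
      simp
    have h2 : (fun x => ((κ : ℂ) • ((0 : L2Pair).snd : Plane → CVec) x) j * ψ x)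
        =ᵐ[diskMeasure] fun _ => 0 := by
      filter_upwards [Lp.coeFn_zero CVec 2 diskMeasure] with x hx
      rw [WithLp.zero_snd, hx]
      simp
    rw [integral_congr_ae h1, integral_congr_ae h2]
    simp
  add_mem' := by
    intro U V hU hV ψ hψ j
    have h1 : (fun x => ((U + V).fst : Plane → ℂ) x * partialDeriv j ψ x)
        =ᵐ[diskMeasure]
        fun x => U.fst x * partialDeriv j ψ x + V.fst x * partialDeriv j ψ x := by
      filter_upwards [Lp.coeFn_add U.fst V.fst] with x hx
      simp only [WithLp.add_fst]
      rw [hx]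
      simp [add_mul]
    have h2 : (fun x => ((κ : ℂ) • ((U + V).snd : Plane → CVec) x) j * ψ x)
        =ᵐ[diskMeasure]
        fun x => ((κ : ℂ) • U.snd x) j * ψ x + ((κ : ℂ) • V.snd x) j * ψ x := by
      filter_upwards [Lp.coeFn_add U.snd V.snd] with x hx
      simp only [WithLp.add_snd]
      rw [hx]
      simp [add_mul]
    have c1 := hψ.continuous_partialDeriv j
    have c2 := hasCompactSupport_partialDeriv hψ.2.1 j
    have i (W : L2Pair) : Integrable (fun x => ((κ : ℂ) • W.snd x) j * ψ x) diskMeasure :=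
      integrable_mul_test (memLp_coord ((Lp.memLp W.snd).const_smul (κ : ℂ)) j)
        hψ.continuous hψ.2.1
    rw [integral_congr_ae h1, integral_congr_ae h2,
      integral_add (integrable_mul_test (Lp.memLp _) c1 c2)
        (integrable_mul_test (Lp.memLp _) c1 c2),
      integral_add (i U) (i V), hU ψ hψ j, hV ψ hψ j]
    ring
  smul_mem' := by
    intro c U hU ψ hψ j
    have h1 : (fun x => ((c • U).fst : Plane → ℂ) x * partialDeriv j ψ x)
        =ᵐ[diskMeasure] fun x => c * (U.fst x * partialDeriv j ψ x) := by
      filter_upwards [Lp.coeFn_smul c U.fst] with x hx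
      simp only [WithLp.smul_fst]
      rw [hx]
      simp [mul_assoc]
    have h2 : (fun x => ((κ : ℂ) • ((c • U).snd : Plane → CVec) x) j * ψ x)
        =ᵐ[diskMeasure] fun x => c * (((κ : ℂ) • U.snd x) j * ψ x) := by
      filter_upwards [Lp.coeFn_smul c U.snd] with x hx
      simp only [WithLp.smul_snd]
      rw [hx]
      simp
      ring
    rw [integral_congr_ae h1, integral_congr_ae h2, integral_const_mul, integral_const_mul,
      hU ψ hψ j]
    ring

/-- The classical gradient of a complex-valued function on the plane. -/
def grad (u : Plane → ℂ) (x : Plane) : CVec := WithLp.toLp 2 fun j => partialDeriv j u x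

theorem memLp_disk {F : Type*} [NormedAddCommGroup F] {f : Plane → F} (hf : Continuous f) :
    MemLp f 2 diskMeasure := by
  obtain ⟨C, hC⟩ := (isCompact_closedBall (0 : Plane) 1).exists_bound_of_continuousOn
    hf.continuousOn
  refine MemLp.of_bound hf.aestronglyMeasurable C ?_
  refine (ae_restrict_iff' (Metric.isOpen_ball.measurableSet)).2
    (Filter.Eventually.of_forall fun x hx => hC x (Metric.ball_subset_closedBall hx))

theorem continuous_grad {u : Plane → ℂ} (hu : ContDiff ℝ 1 u) : Continuous (grad u) :=
  (PiLp.continuous_toLp 2 _).comp (continuous_pi fun j => continuous_partialDeriv hu j)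

theorem isWeakGradient_grad {u : Plane → ℂ} (hu : ContDiff ℝ 1 u) :
    IsWeakGradient u (grad u) := by
  intro ψ hψ j
  have c1 := hψ.continuous_partialDeriv j
  have c2 := hasCompactSupport_partialDeriv hψ.2.1 j
  have c3 : Continuous (partialDeriv j u) := continuous_partialDeriv hu j
  have e1 : ∫ x, u x * partialDeriv j ψ x ∂diskMeasure = ∫ x, u x * partialDeriv j ψ x := by
    refine setIntegral_eq_integral_of_forall_compl_eq_zero fun x hx => ?_
    have : fderiv ℝ ψ x = 0 := by
      by_contra h
      exact hx (hψ.2.2 (support_fderiv_subset ℝ h))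
    simp [partialDeriv, this]
  have e2 : ∫ x, grad u x j * ψ x ∂diskMeasure = ∫ x, partialDeriv j u x * ψ x := by
    refine setIntegral_eq_integral_of_forall_compl_eq_zero fun x hx => ?_
    have : ψ x = 0 := by
      by_contra h
      exact hx (hψ.2.2 (subset_tsupport ψ h))
    simp [this]
  rw [e1, e2]
  refine integral_mul_fderiv_eq_neg_fderiv_mul_of_integrable ?_ ?_ ?_
    (fun x _ => (hu.differentiable (by norm_num)) x)
    (fun x _ => (hψ.1.differentiable (by simp)) x)
  · exact (c3.mul hψ.continuous).integrable_of_hasCompactSupport hψ.2.1.mul_left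
  · exact (hu.continuous.mul c1).integrable_of_hasCompactSupport c2.mul_left
  · exact (hu.continuous.mul hψ.continuous).integrable_of_hasCompactSupport hψ.2.1.mul_left

/-- The element of `H¹(B₁)` given by the restriction to the disk of a `C¹` function. -/
def H1.ofContDiff {κ : ℝ} (hκ : 0 < κ) (u : Plane → ℂ) (hu : ContDiff ℝ 1 u) : H1 κ :=
  ⟨WithLp.toLp 2 ((memLp_disk hu.continuous).toLp u,
    (memLp_disk ((continuous_grad hu).const_smul (κ : ℂ)⁻¹)).toLp
      (fun x => (κ : ℂ)⁻¹ • grad u x)), by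
    intro ψ hψ j
    have hk : (κ : ℂ) ≠ 0 := by exact_mod_cast hκ.ne'
    have h1 := (memLp_disk hu.continuous).coeFn_toLp
    have h2 := (memLp_disk ((continuous_grad hu).const_smul (κ : ℂ)⁻¹)).coeFn_toLp
    have h := isWeakGradient_grad hu ψ hψ j
    refine Eq.trans (integral_congr_ae ?_) (h.trans (congrArg Neg.neg (integral_congr_ae ?_)))
    · filter_upwards [h1] with x hx
      exact congrArg (· * _) hx
    · filter_upwards [h2] with x hx
      refine congrArg (· * ψ x) ?_
      have := congrArg (fun v : CVec => ((κ : ℂ) • v) j) hx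
      refine Eq.trans ?_ this.symm
      simp [hk]⟩

/-- The function on the disk underlying an element of `H¹(B₁)`, defined almost everywhere. -/
def H1.toFun {κ : ℝ} (U : H1 κ) : Plane → ℂ := (U : L2Pair).fst

/-! ### Circular waves -/

/-- The Bessel function `J_n(x)` of the first kind and of order `n ≥ 0`. -/
def besselJNat (n : ℕ) (x : ℝ) : ℝ :=
  ∑' k : ℕ, (-1) ^ k / ((k.factorial : ℝ) * ((n + k).factorial : ℝ)) * (x / 2) ^ (2 * k + n)

/-- The Bessel function `J_p(x)` of the first kind and of integer order, with
`J_{-n} = (-1)^n J_n`. -/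
def besselJ : ℤ → ℝ → ℝ
  | Int.ofNat n, x => besselJNat n x
  | Int.negSucc n, x => (-1) ^ (n + 1) * besselJNat (n + 1) x

/-- The point `x` of the plane as the complex number `x₁ + i x₂`. -/
def toComplex (x : Plane) : ℂ := x 0 + x 1 * Complex.I

/-- The circular wave `b̃_p(x) = J_p(κ r) e^{ipθ}`, where `(r, θ)` are the polar coordinates
of `x`. -/
def circularWave (κ : ℝ) (p : ℤ) (x : Plane) : ℂ :=
  (besselJ p (κ * ‖x‖) : ℂ) * Complex.exp (Complex.I * p * (Complex.arg (toComplex x) : ℂ))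

/-- The entire function `s ↦ ∑ (-1)^k s^k / (k! (n+k)!)`. -/
def besselE (n : ℕ) (s : ℂ) : ℂ :=
  ∑' k : ℕ, (-1) ^ k / ((k.factorial : ℂ) * ((n + k).factorial : ℂ)) * s ^ k

theorem differentiable_besselE (n : ℕ) : Differentiable ℂ (besselE n) := by
  intro s
  have key : DifferentiableOn ℂ (besselE n) (Metric.ball 0 (‖s‖ + 1)) := by
    refine Complex.differentiableOn_tsum_of_summable_norm
      (u := fun k : ℕ => (‖s‖ + 1) ^ k / (k.factorial : ℝ))
      (Real.summable_pow_div_factorial _) (fun k => by fun_prop) Metric.isOpen_ball ?_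
    intro k w hw
    have hw' : ‖w‖ ≤ ‖s‖ + 1 := by simpa using (mem_ball_zero_iff.1 hw).le
    have h1 : (1 : ℝ) ≤ ((n + k).factorial : ℝ) := by exact_mod_cast Nat.factorial_pos _
    have h0 : (0 : ℝ) < (k.factorial : ℝ) := by exact_mod_cast Nat.factorial_pos _
    rw [norm_mul, norm_div, norm_mul, norm_pow, norm_pow, norm_neg, norm_one, one_pow,
      Complex.norm_natCast, Complex.norm_natCast, div_mul_eq_mul_div, one_mul]
    refine div_le_div₀ (by positivity) (by gcongr) h0 ?_
    nlinarith
  exact key.differentiableAt (Metric.isOpen_ball.mem_nhds (by simp))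

theorem besselJNat_eq (n : ℕ) (x : ℝ) :
    (besselJNat n x : ℂ) = ((x / 2 : ℝ) : ℂ) ^ n * besselE n (((x / 2) ^ 2 : ℝ) : ℂ) := by
  rw [besselJNat, besselE, Complex.ofReal_tsum, ← tsum_mul_left]
  refine tsum_congr fun k => ?_
  push_cast
  rw [pow_add, pow_mul]
  ring

theorem norm_toComplex (x : Plane) : ‖toComplex x‖ = ‖x‖ := by
  rw [EuclideanSpace.norm_eq, toComplex, Complex.norm_add_mul_I]
  simp

theorem toComplex_eq (x : Plane) :
    toComplex x = (‖x‖ : ℂ) * Complex.exp ((Complex.arg (toComplex x) : ℂ) * Complex.I) := by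
  conv_lhs => rw [← Complex.norm_mul_exp_arg_mul_I (toComplex x), norm_toComplex]

theorem conj_toComplex_eq (x : Plane) :
    (starRingEnd ℂ) (toComplex x) =
      (‖x‖ : ℂ) * Complex.exp (-((Complex.arg (toComplex x) : ℂ) * Complex.I)) := by
  conv_lhs => rw [toComplex_eq]
  rw [map_mul, Complex.conj_ofReal, ← Complex.exp_conj]
  simp

theorem circularWave_ofNat (κ : ℝ) (n : ℕ) (x : Plane) :
    circularWave κ (Int.ofNat n) x =
      ((κ / 2 : ℝ) : ℂ) ^ n * besselE n (((κ / 2) ^ 2 * ‖x‖ ^ 2 : ℝ) : ℂ) * toComplex x ^ n := by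
  conv_rhs => rw [toComplex_eq x]
  rw [circularWave, besselJ, besselJNat_eq, mul_pow, ← Complex.exp_nat_mul]
  have h1 : (κ * ‖x‖ / 2) ^ 2 = (κ / 2) ^ 2 * ‖x‖ ^ 2 := by ring
  have h2 : Complex.I * ((Int.ofNat n : ℤ) : ℂ) * (Complex.arg (toComplex x) : ℂ)
      = n * ((Complex.arg (toComplex x) : ℂ) * Complex.I) := by
    simp
    ring
  rw [h1, h2]
  push_cast
  ring

theorem circularWave_negSucc (κ : ℝ) (n : ℕ) (x : Plane) :
    circularWave κ (Int.negSucc n) x =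
      (-1) ^ (n + 1) * (((κ / 2 : ℝ) : ℂ) ^ (n + 1) *
        besselE (n + 1) (((κ / 2) ^ 2 * ‖x‖ ^ 2 : ℝ) : ℂ) *
        (starRingEnd ℂ) (toComplex x) ^ (n + 1)) := by
  rw [conj_toComplex_eq x, circularWave, besselJ, Complex.ofReal_mul, besselJNat_eq, mul_pow,
    ← Complex.exp_nat_mul]
  have h1 : (κ * ‖x‖ / 2) ^ 2 = (κ / 2) ^ 2 * ‖x‖ ^ 2 := by ring
  have h2 : Complex.I * ((Int.negSucc n : ℤ) : ℂ) * (Complex.arg (toComplex x) : ℂ)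
      = ((n + 1 : ℕ) : ℂ) * -((Complex.arg (toComplex x) : ℂ) * Complex.I) := by
    rw [Int.cast_negSucc]
    push_cast
    ring
  rw [h1, h2]
  push_cast
  ring

theorem contDiff_toComplex : ContDiff ℝ ∞ toComplex := by
  unfold toComplex
  have h (j : Fin 2) : ContDiff ℝ ∞ fun x : Plane => ((x j : ℝ) : ℂ) :=
    Complex.ofRealCLM.contDiff.comp (EuclideanSpace.proj j : Plane →L[ℝ] ℝ).contDiff
  exact (h 0).add ((h 1).mul contDiff_const)

theorem contDiff_besselE_norm (κ : ℝ) (n : ℕ) :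
    ContDiff ℝ ∞ fun x : Plane => besselE n (((κ / 2) ^ 2 * ‖x‖ ^ 2 : ℝ) : ℂ) := by
  have h1 : ContDiff ℝ ∞ (besselE n) :=
    ((differentiable_besselE n).contDiff (n := ∞)).restrict_scalars ℝ
  have h2 : ContDiff ℝ ∞ fun x : Plane => (((κ / 2) ^ 2 * ‖x‖ ^ 2 : ℝ) : ℂ) :=
    Complex.ofRealCLM.contDiff.comp (contDiff_const.mul (contDiff_norm_sq ℝ))
  exact h1.comp h2

theorem contDiff_circularWave (κ : ℝ) (p : ℤ) : ContDiff ℝ ∞ (circularWave κ p) := by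
  cases p with
  | ofNat n =>
    rw [show circularWave κ (Int.ofNat n) = _ from funext (circularWave_ofNat κ n)]
    exact (contDiff_const.mul (contDiff_besselE_norm κ n)).mul (contDiff_toComplex.pow n)
  | negSucc n =>
    rw [show circularWave κ (Int.negSucc n) = _ from funext (circularWave_negSucc κ n)]
    refine contDiff_const.mul ((contDiff_const.mul (contDiff_besselE_norm κ (n + 1))).mul ?_)
    exact (Complex.conjCLE.contDiff.comp contDiff_toComplex).pow (n + 1)

/-- The circular wave `b̃_p` as an element of `H¹(B₁)`. -/
def bTilde {κ : ℝ} (hκ : 0 < κ) (p : ℤ) : H1 κ :=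
  H1.ofContDiff hκ (circularWave κ p)
    ((contDiff_circularWave κ p).of_le (by exact_mod_cast le_top))

/-- The normalization coefficient `β_p = ‖b̃_p‖⁻¹`. -/
def beta {κ : ℝ} (hκ : 0 < κ) (p : ℤ) : ℝ := ‖bTilde hκ p‖⁻¹

/-- The space `ℬ`: the closure in `H¹(B₁)` of the linear span of the `b_p = β_p b̃_p`. -/
def spaceB {κ : ℝ} (hκ : 0 < κ) : Submodule ℂ (H1 κ) :=
  (Submodule.span ℂ (Set.range fun p : ℤ => (beta hκ p : ℂ) • bTilde hκ p)).topologicalClosure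

/-- The normalized circular wave `b_p = β_p b̃_p`, as an element of `ℬ`. -/
def b {κ : ℝ} (hκ : 0 < κ) (p : ℤ) : spaceB hκ :=
  ⟨(beta hκ p : ℂ) • bTilde hκ p,
    Submodule.le_topologicalClosure _ (Submodule.subset_span ⟨p, rfl⟩)⟩

/-! ### Herglotz densities -/

/-- The cylinder `Y = [0, 2π) × ℝ`; its points are written `y = (φ, ζ)`. -/
def cylinder : Set (ℝ × ℝ) := Set.Ico 0 (2 * Real.pi) ×ˢ Set.univ

/-- The weight `w(φ, ζ) = exp(-κ sinh|ζ| + |ζ|/4)`. -/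
def weight (κ : ℝ) (y : ℝ × ℝ) : ℝ := Real.exp (-κ * Real.sinh |y.2| + |y.2| / 4)

/-- The measure `w²(y) dy` on the cylinder. -/
def weightedMeasure (κ : ℝ) : Measure (ℝ × ℝ) :=
  (volume.restrict cylinder).withDensity fun y => ENNReal.ofReal (weight κ y ^ 2)

/-- The space `L²(Y; w²)`, with inner product `(u, v) = ∫_Y u v̄ w²` (linear in `u`). In
Mathlib's notation this number is `inner ℂ v u`. -/
abbrev L2Cylinder (κ : ℝ) := Lp ℂ 2 (weightedMeasure κ)

/-- The function `ã_p(φ, ζ) = e^{pζ} e^{ipφ}`. -/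
def herglotzMode (p : ℤ) (y : ℝ × ℝ) : ℂ :=
  Complex.exp (p * y.2) * Complex.exp (Complex.I * p * y.1)

theorem continuous_weight (κ : ℝ) : Continuous (weight κ) := by
  unfold weight
  exact Real.continuous_exp.comp ((continuous_const.mul
    (Real.continuous_sinh.comp continuous_snd.abs)).add (continuous_snd.abs.div_const 4))

theorem continuous_herglotzMode (p : ℤ) : Continuous (herglotzMode p) := by
  unfold herglotzMode
  fun_prop

theorem norm_herglotzMode (p : ℤ) (y : ℝ × ℝ) : ‖herglotzMode p y‖ = Real.exp (p * y.2) := by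
  rw [herglotzMode, norm_mul, Complex.norm_exp, Complex.norm_exp]
  simp

theorem sq_div_four_le_sinh {t : ℝ} (ht : 0 ≤ t) : t ^ 2 / 4 ≤ Real.sinh t := by
  have h1 := Real.quadratic_le_exp_of_nonneg ht
  have h2 : Real.exp (-t) ≤ 1 := Real.exp_le_one_iff.2 (by linarith)
  rw [Real.sinh_eq]
  linarith

theorem integrable_mode_weight {κ : ℝ} (hκ : 0 < κ) (p : ℤ) :
    Integrable fun t : ℝ =>
      Real.exp (-κ * Real.sinh |t| + |t| / 4) ^ 2 * Real.exp (p * t) ^ 2 := by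
  have hg : Integrable fun t : ℝ =>
      Real.exp ((1 / 2 + 2 * |(p : ℝ)|) ^ 2 / κ) * Real.exp (-(κ / 4) * t ^ 2) :=
    (integrable_exp_neg_mul_sq (by positivity)).const_mul _
  refine hg.mono' ?_ (Filter.Eventually.of_forall fun t => ?_)
  · refine Continuous.aestronglyMeasurable ?_
    have : Continuous fun t : ℝ => Real.sinh |t| := Real.continuous_sinh.comp continuous_abs
    fun_prop
  · rw [Real.norm_of_nonneg (by positivity), ← Real.exp_nat_mul, ← Real.exp_nat_mul,
      ← Real.exp_add, ← Real.exp_add, Real.exp_le_exp]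
    have h1 := sq_div_four_le_sinh (abs_nonneg t)
    have h2 : (p : ℝ) * t ≤ |(p : ℝ)| * |t| := by
      rw [← abs_mul]
      exact le_abs_self _
    have h3 : κ * (|t| ^ 2 / 4) ≤ κ * Real.sinh |t| := by gcongr
    have h4 : (1 / 2 + 2 * |(p : ℝ)|) * |t| ≤
        (1 / 2 + 2 * |(p : ℝ)|) ^ 2 / κ + κ / 4 * |t| ^ 2 := by
      have : (1 / 2 + 2 * |(p : ℝ)|) ^ 2 / κ + κ / 4 * |t| ^ 2
          - (1 / 2 + 2 * |(p : ℝ)|) * |t|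
          = ((1 / 2 + 2 * |(p : ℝ)|) - κ / 2 * |t|) ^ 2 / κ := by
        field_simp
        ring
      have h5 : 0 ≤ ((1 / 2 + 2 * |(p : ℝ)|) - κ / 2 * |t|) ^ 2 / κ := by positivity
      linarith
    rw [sq_abs] at h3 h4
    push_cast
    nlinarith

theorem memLp_herglotzMode {κ : ℝ} (hκ : 0 < κ) (p : ℤ) :
    MemLp (herglotzMode p) 2 (weightedMeasure κ) := by
  have hm : Measurable fun y : ℝ × ℝ => ENNReal.ofReal (weight κ y ^ 2) :=
    ((continuous_weight κ).pow 2).measurable.ennreal_ofReal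
  rw [memLp_two_iff_integrable_sq_norm (continuous_herglotzMode p).aestronglyMeasurable,
    weightedMeasure, integrable_withDensity_iff_integrable_smul' hm
      (Filter.Eventually.of_forall fun _ => ENNReal.ofReal_lt_top),
    cylinder, Measure.volume_eq_prod, ← Measure.prod_restrict, Measure.restrict_univ]
  have h1 : Integrable (fun _ : ℝ => (1 : ℝ))
      (volume.restrict (Set.Ico 0 (2 * Real.pi))) := by
    exact integrableOn_const measure_Ico_lt_top.ne
  refine (h1.mul_prod (integrable_mode_weight hκ p)).congr
    (Filter.Eventually.of_forall fun y => ?_)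
  simp only [norm_herglotzMode, smul_eq_mul, one_mul]
  rw [ENNReal.toReal_ofReal (by positivity), weight]

/-- The function `ã_p` as an element of `L²(Y; w²)`. -/
def aTilde {κ : ℝ} (hκ : 0 < κ) (p : ℤ) : L2Cylinder κ :=
  (memLp_herglotzMode hκ p).toLp (herglotzMode p)

/-- The normalization coefficient `α_p = ‖ã_p‖⁻¹`. -/
def alpha {κ : ℝ} (hκ : 0 < κ) (p : ℤ) : ℝ := ‖aTilde hκ p‖⁻¹

/-- The space `𝒜` of Herglotz densities: the closure in `L²(Y; w²)` of the linear span of the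
`a_p = α_p ã_p`. -/
def spaceA {κ : ℝ} (hκ : 0 < κ) : Submodule ℂ (L2Cylinder κ) :=
  (Submodule.span ℂ (Set.range fun p : ℤ =>
    (alpha hκ p : ℂ) • aTilde hκ p)).topologicalClosure

/-- The normalized function `a_p = α_p ã_p`, as an element of `𝒜`. -/
def a {κ : ℝ} (hκ : 0 < κ) (p : ℤ) : spaceA hκ :=
  ⟨(alpha hκ p : ℂ) • aTilde hκ p,
    Submodule.le_topologicalClosure _ (Submodule.subset_span ⟨p, rfl⟩)⟩

/-! ### The Herglotz transform -/

/-- The evanescent plane wave `φ_y(x) = exp(iκ d(y)·x)` with complex direction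
`d(φ, ζ) = (cos(φ + iζ), sin(φ + iζ))`. -/
def evanescentWave (κ : ℝ) (y : ℝ × ℝ) (x : Plane) : ℂ :=
  Complex.exp (Complex.I * κ * (Complex.cos (y.1 + Complex.I * y.2) * x 0 +
    Complex.sin (y.1 + Complex.I * y.2) * x 1))

/-- The integrand `y ↦ v(y) φ_y(x) w²(y)` of the Herglotz transform at the point `x`. -/
def herglotzIntegrand (κ : ℝ) (v : ℝ × ℝ → ℂ) (x : Plane) (y : ℝ × ℝ) : ℂ :=
  v y * evanescentWave κ y x * ((weight κ y ^ 2 : ℝ) : ℂ)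

/-- The Herglotz transform `(Tv)(x) = ∫_Y v(y) φ_y(x) w²(y) dy`. -/
def herglotzTransform (κ : ℝ) (v : ℝ × ℝ → ℂ) (x : Plane) : ℂ :=
  ∫ y in cylinder, herglotzIntegrand κ v x y

/-- The numbers `τ_p = i^p (α_p β_p)⁻¹`. -/
def tau {κ : ℝ} (hκ : 0 < κ) (p : ℤ) : ℂ :=
  Complex.I ^ p * ((alpha hκ p * beta hκ p : ℝ) : ℂ)⁻¹

/-- `τ₋ = inf_p |τ_p|`. -/
def tauMinus {κ : ℝ} (hκ : 0 < κ) : ℝ := ⨅ p : ℤ, ‖tau hκ p‖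

/-- `τ₊ = sup_p |τ_p|`. -/
def tauPlus {κ : ℝ} (hκ : 0 < κ) : ℝ := ⨆ p : ℤ, ‖tau hκ p‖

end Herglotz

end

noncomputable section

namespace Herglotz

/-! ### Diagonal operators and Hilbert bases -/

/-! The Herglotz transform is diagonal: it sends `a_p` to `τ_p b_p`. Three facts then have to be
established: both families are orthonormal, the moduli `|τ_p|` stay between two positive constants,
and the circular waves exhaust the weak solutions.

Orthogonality is angular. On the disk, rotation by `π/m` changes the sign of a function of angular
frequency `m ≠ 0`, and on the cylinder `∫ e^{imφ} dφ = 0`. The gradient part of the `H¹` product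
reduces to `L²` products through the ladder relations `(∂₀ + i∂₁) b̃_p = -κ b̃_{p+1}` and `(∂₀ -
i∂₁) b̃_p = κ b̃_{p-1}`. The diagonal action is the Jacobi–Anger expansion
(`integral_mode_mul_evanescentWave`), integrated against `e^{pζ} w²`. For `|x| < 1` the evanescent
wave is square integrable for the weight, so evaluation of the transform at `x` is continuous on
densities and the expansion holds for every `v ∈ 𝒜`, not only for the modes.

For the bounds, `|τ_p| = ‖ã_p‖ ‖b̃_p‖`. With `x = e^ζ`, `‖ã_n‖²` is comparable to `Γ(2n + 1/2)
κ^{-(2n+1/2)}`. For large `n`, the wave of order `n - 1` controls `‖b̃_n‖²`, which is comparable to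
`(κ/2)^{2(n-1)} / ((n-1)!² n)`. All powers of `κ` except `κ^{-5/2}` cancel, and what remains is
`gammaRatio`, whose consecutive quotients are `1 + O(m⁻²)`. The term `|ζ|/4` in the weight is
exactly what removes the `1/m` contribution.

For completeness, let `u` be a weak solution. Each angular mode of `u` annihilates the image of the
radial Helmholtz operator on test functions. By an ODE argument (`exists_radial_solution`), a source
supported away from `0` and `1` lies in this image as soon as it satisfies the single condition of
orthogonality to the Bessel profile. Hence each mode of `u` is a multiple of the circular wave. The
weak derivatives `∂₀u ± i∂₁u` are again solutions, with coefficients tied to those of `u` by the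
ladder relations, so `(u, b̃_p) = c_p ‖b̃_p‖²`. If `u` is orthogonal to all waves, then all its
modes vanish, and `u = 0` by Stone–Weierstrass. Neither interior regularity nor boundary traces are
needed. -/

theorem memℓp_two_mul {ι : Type*} {τ : ι → ℂ} {M : ℝ} (hτ : ∀ i, ‖τ i‖ ≤ M)
    (f : lp (fun _ : ι => ℂ) 2) : Memℓp (fun i => τ i * f i) 2 := by
  have hf := (lp.memℓp f).summable (by norm_num : 0 < (2 : ℝ≥0∞).toReal)
  refine memℓp_gen ((hf.mul_left (M ^ (2 : ℝ≥0∞).toReal)).of_nonneg_of_le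
    (fun i => by positivity) fun i => ?_)
  have hM : 0 ≤ M := (norm_nonneg _).trans (hτ i)
  rw [norm_mul, Real.mul_rpow (norm_nonneg _) (norm_nonneg _)]
  gcongr
  exact hτ i

/-- Multiplication by a bounded family on `ℓ²`. -/
def mulLp {ι : Type*} (τ : ι → ℂ) (M : ℝ) (hM : 0 ≤ M) (hτ : ∀ i, ‖τ i‖ ≤ M) :
    lp (fun _ : ι => ℂ) 2 →L[ℂ] lp (fun _ : ι => ℂ) 2 :=
  LinearMap.mkContinuous
    { toFun := fun f => ⟨fun i => τ i * f i, memℓp_two_mul hτ f⟩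
      map_add' := fun f g => by ext i; exact mul_add _ _ _
      map_smul' := fun c f => by ext i; simp; ring } M (by
    intro f
    have h2 : 0 < (2 : ℝ≥0∞).toReal := by norm_num
    refine lp.norm_le_of_forall_sum_le h2 (by positivity) fun s => ?_
    calc ∑ i ∈ s, ‖τ i * f i‖ ^ (2 : ℝ≥0∞).toReal
        ≤ ∑ i ∈ s, M ^ (2 : ℝ≥0∞).toReal * ‖f i‖ ^ (2 : ℝ≥0∞).toReal := by
          refine Finset.sum_le_sum fun i _ => ?_
          rw [norm_mul, Real.mul_rpow (norm_nonneg _) (norm_nonneg _)]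
          gcongr
          exact hτ i
      _ ≤ (M * ‖f‖) ^ (2 : ℝ≥0∞).toReal := by
          rw [← Finset.mul_sum, Real.mul_rpow hM (norm_nonneg _)]
          gcongr
          exact lp.sum_rpow_le_norm_rpow h2 f s)

theorem mulLp_apply {ι : Type*} (τ : ι → ℂ) (M : ℝ) (hM : 0 ≤ M) (hτ : ∀ i, ‖τ i‖ ≤ M)
    (f : lp (fun _ : ι => ℂ) 2) (i : ι) : mulLp τ M hM hτ f i = τ i * f i := rfl

theorem norm_mulLp_apply_le {ι : Type*} (τ : ι → ℂ) (M : ℝ) (hM : 0 ≤ M)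
    (hτ : ∀ i, ‖τ i‖ ≤ M) (f : lp (fun _ : ι => ℂ) 2) : ‖mulLp τ M hM hτ f‖ ≤ M * ‖f‖ :=
  (mulLp τ M hM hτ).le_of_opNorm_le (LinearMap.mkContinuous_norm_le _ hM _) f

/-- The diagonal isomorphism between two Hilbert spaces with Hilbert bases, given by multipliers
that are bounded above and bounded away from zero. -/
theorem exists_diagonal_equiv {ι A B : Type*} [NormedAddCommGroup A] [InnerProductSpace ℂ A]
    [NormedAddCommGroup B] [InnerProductSpace ℂ B] (e : HilbertBasis ι ℂ A)
    (f : HilbertBasis ι ℂ B) {u : ι → A} {w : ι → B} (hu : ⇑e = u) (hw : ⇑f = w) (τ : ι → ℂ)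
    {m M : ℝ} (hm : 0 < m) (hM0 : 0 ≤ M)
    (hm' : ∀ i, m ≤ ‖τ i‖) (hM : ∀ i, ‖τ i‖ ≤ M) :
    ∃ T : A ≃L[ℂ] B, (∀ v, HasSum (fun i => (τ i * inner ℂ (u i) v) • w i) (T v)) ∧
      (∀ i, T (u i) = τ i • w i) ∧ ∀ v, m * ‖v‖ ≤ ‖T v‖ ∧ ‖T v‖ ≤ M * ‖v‖ := by
  classical
  subst hu hw
  have hi : ∀ i, ‖(τ i)⁻¹‖ ≤ m⁻¹ := fun i => by
    rw [norm_inv]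
    exact inv_anti₀ hm (hm' i)
  have h0 : ∀ i, τ i ≠ 0 := fun i h => by
    have := hm' i
    rw [h, norm_zero] at this
    linarith
  let D : lp (fun _ : ι => ℂ) 2 ≃L[ℂ] lp (fun _ : ι => ℂ) 2 :=
    ContinuousLinearEquiv.equivOfInverse (mulLp τ M hM0 hM) (mulLp _ m⁻¹ (by positivity) hi)
      (fun x => by ext i; simp [mulLp_apply, h0 i])
      (fun x => by ext i; simp [mulLp_apply, h0 i])
  let T : A ≃L[ℂ] B := (e.repr.toContinuousLinearEquiv.trans D).trans
    f.repr.symm.toContinuousLinearEquiv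
  have hT : ∀ v, T v = f.repr.symm (mulLp τ M hM0 hM (e.repr v)) := fun v => rfl
  have hs : ∀ v, HasSum (fun i => (τ i * inner ℂ (e i) v) • f i) (T v) := fun v => by
    rw [hT]
    have := f.hasSum_repr_symm (mulLp τ M hM0 hM (e.repr v))
    simpa only [mulLp_apply, e.repr_apply_apply] using this
  refine ⟨T, hs, fun i => ?_, fun v => ⟨?_, ?_⟩⟩
  · have h := hasSum_single (f := fun j => (τ j * inner ℂ (e j) (e i)) • f j) i
      (fun j hj => by rw [(orthonormal_iff_ite.1 e.orthonormal) j i, if_neg hj]; simp)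
    rw [(orthonormal_iff_ite.1 e.orthonormal) i i, if_pos rfl, mul_one] at h
    exact (hs _).unique h
  · have h1 : e.repr v = mulLp _ m⁻¹ (by positivity) hi (mulLp τ M hM0 hM (e.repr v)) := by
      ext i; simp [mulLp_apply, h0 i]
    have h2 := norm_mulLp_apply_le _ m⁻¹ (by positivity) hi (mulLp τ M hM0 hM (e.repr v))
    rw [← h1, e.repr.norm_map] at h2
    rw [hT, f.repr.symm.norm_map]
    calc m * ‖v‖ ≤ m * (m⁻¹ * _) := by gcongr
      _ = _ := by field_simp
  · rw [hT, f.repr.symm.norm_map, ← e.repr.norm_map v]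
    exact norm_mulLp_apply_le _ _ _ _ _

/-- Orthonormal vectors whose span is dense in a closed subspace form a Hilbert basis of it. -/
theorem exists_hilbertBasis_of_closure_span {ι E : Type*} [NormedAddCommGroup E]
    [InnerProductSpace ℂ E] [CompleteSpace E] (v : ι → E)
    (w : ι → (Submodule.span ℂ (Set.range v)).topologicalClosure) (hw : ∀ i, (w i : E) = v i)
    (ho : Orthonormal ℂ w) :
    ∃ e : HilbertBasis ι ℂ (Submodule.span ℂ (Set.range v)).topologicalClosure, ⇑e = w := by
  have : CompleteSpace (Submodule.span ℂ (Set.range v)).topologicalClosure :=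
    (Submodule.isClosed_topologicalClosure _).completeSpace_coe
  have h : (Submodule.span ℂ (Set.range w))ᗮ = ⊥ := by
    rw [Submodule.eq_bot_iff]
    intro x hx
    -- The orthogonal complement of `x` is closed and contains every `v i`, hence the closure of
    -- their span, hence `x` itself.
    have h1 : Submodule.span ℂ (Set.range v) ≤ (Submodule.span ℂ {(x : E)})ᗮ := by
      rw [Submodule.span_le]
      rintro _ ⟨i, rfl⟩
      rw [SetLike.mem_coe, Submodule.mem_orthogonal_singleton_iff_inner_left, ← hw i]
      exact hx (w i) (Submodule.subset_span ⟨i, rfl⟩)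
    have h2 := Submodule.topologicalClosure_minimal _ h1 (Submodule.isClosed_orthogonal _)
    have h3 := h2 x.2
    rw [Submodule.mem_orthogonal_singleton_iff_inner_left, inner_self_eq_zero] at h3
    exact Subtype.ext h3
  exact ⟨HilbertBasis.mkOfOrthogonalEqBot ho h, HilbertBasis.coe_mkOfOrthogonalEqBot ho h⟩

/-! ### Functionals on `L²` and closedness of `H¹` -/

/-- The continuous linear functional `f ↦ ∫ f χ` on `L²` of the disk. -/
def pairing (χ : Plane → ℂ) (hχ : MemLp χ 2 diskMeasure) : Lp ℂ 2 diskMeasure →L[ℂ] ℂ :=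
  innerSL ℂ (hχ.star.toLp (star χ))

theorem pairing_apply (χ : Plane → ℂ) (hχ : MemLp χ 2 diskMeasure) (f : Lp ℂ 2 diskMeasure) :
    pairing χ hχ f = ∫ x, f x * χ x ∂diskMeasure := by
  rw [pairing, innerSL_apply_apply, L2.inner_def]
  refine integral_congr_ae ?_
  filter_upwards [hχ.star.coeFn_toLp] with x hx
  rw [hx]
  simp

/-- The first component `(u, g) ↦ u`. -/
def fstL : L2Pair →L[ℂ] Lp ℂ 2 diskMeasure := WithLp.fstL 2 ℂ _ _

/-- The coordinates `(u, g) ↦ g_j` of the second component. -/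
def sndL (j : Fin 2) : L2Pair →L[ℂ] Lp ℂ 2 diskMeasure :=
  ((EuclideanSpace.proj j : CVec →L[ℂ] ℂ).compLpL 2 diskMeasure).comp (WithLp.sndL 2 ℂ _ _)

theorem fstL_apply (U : L2Pair) : fstL U = U.fst := rfl

theorem sndL_ae (j : Fin 2) (U : L2Pair) : sndL j U =ᵐ[diskMeasure] fun x => U.snd x j :=
  ContinuousLinearMap.coeFn_compLpL _ _

theorem integral_smul_snd_mul (κ : ℝ) (U : L2Pair) (j : Fin 2) (χ : Plane → ℂ)
    (hχ : MemLp χ 2 diskMeasure) :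
    ∫ x, ((κ : ℂ) • U.snd x) j * χ x ∂diskMeasure = κ * pairing χ hχ (sndL j U) := by
  rw [pairing_apply, ← integral_const_mul]
  refine integral_congr_ae ?_
  filter_upwards [sndL_ae j U] with x hx
  rw [hx]
  simp [mul_assoc]

theorem IsTestFunction.memLp {ψ : Plane → ℂ} (h : IsTestFunction ψ) : MemLp ψ 2 diskMeasure :=
  memLp_disk h.continuous

theorem IsTestFunction.memLp_partialDeriv {ψ : Plane → ℂ} (h : IsTestFunction ψ) (j : Fin 2) :
    MemLp (partialDeriv j ψ) 2 diskMeasure :=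
  memLp_disk (h.continuous_partialDeriv j)

/-- Turns the weak-gradient condition into equalities of continuous functionals of the pair, so that
it can be passed to limits and split by components. -/
theorem mem_H1_iff (κ : ℝ) (U : L2Pair) : U ∈ H1 κ ↔
    ∀ ψ (h : IsTestFunction ψ) (j : Fin 2),
      pairing _ (h.memLp_partialDeriv j) (fstL U) = -(κ * pairing _ h.memLp (sndL j U)) := by
  refine forall_congr' fun ψ => forall_congr' fun h => forall_congr' fun j => ?_
  rw [integral_smul_snd_mul κ U j ψ h.memLp, pairing_apply (partialDeriv j ψ), fstL_apply]

/-- An intersection of equality sets of continuous functionals. Completeness follows, which the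
Hilbert bases and the orthogonal projection onto `ℬ` require. -/
theorem isClosed_H1 (κ : ℝ) : IsClosed (H1 κ : Set L2Pair) := by
  have : (H1 κ : Set L2Pair) = {U | ∀ ψ (h : IsTestFunction ψ) (j : Fin 2),
      pairing _ (h.memLp_partialDeriv j) (fstL U) = -(κ * pairing _ h.memLp (sndL j U))} :=
    Set.ext fun U => mem_H1_iff κ U
  rw [this]
  simp only [Set.ofPred_forall]
  refine isClosed_iInter fun ψ => isClosed_iInter fun h => isClosed_iInter fun j =>
    isClosed_eq ?_ ?_
  · exact (ContinuousLinearMap.continuous _).comp fstL.continuous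
  · exact (continuous_const.mul
      ((ContinuousLinearMap.continuous _).comp (sndL j).continuous)).neg

instance completeSpace_H1 (κ : ℝ) : CompleteSpace (H1 κ) :=
  (isClosed_H1 κ).completeSpace_coe

/-- An `L²` function on the disk that annihilates all test functions vanishes. -/
theorem ae_eq_zero_of_forall_test {u : Plane → ℂ} (hu : MemLp u 2 diskMeasure)
    (h : ∀ ψ, IsTestFunction ψ → ∫ x, u x * ψ x ∂diskMeasure = 0) : u =ᵐ[diskMeasure] 0 := by
  have hi : IntegrableOn u unitDisk volume := hu.integrable (by norm_num)
  have key := Metric.isOpen_ball.ae_eq_zero_of_integral_contDiff_smul_eq_zero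
    (U := unitDisk) hi.locallyIntegrableOn (fun g hg hc hs => ?_)
  · exact (ae_restrict_iff' Metric.isOpen_ball.measurableSet).2 key
  -- The fundamental lemma of the calculus of variations tests with real functions; these are viewed
  -- as complex test functions with the same support.
  · have hs' : tsupport (fun x => (g x : ℂ)) = tsupport g := by
      refine congrArg closure (Set.ext fun x => ?_)
      simp
    have ht : IsTestFunction fun x => (g x : ℂ) :=
      ⟨Complex.ofRealCLM.contDiff.comp hg, by rwa [HasCompactSupport, hs'], by rwa [hs']⟩
    rw [← h _ ht]
    refine Eq.trans (setIntegral_eq_integral_of_forall_compl_eq_zero fun x hx => ?_).symm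
      (integral_congr_ae (Filter.Eventually.of_forall fun x => ?_))
    · have : g x = 0 := by
        by_contra h0
        exact hx (hs (subset_tsupport g h0))
      simp [this]
    · simp [mul_comm]

/-- An element of `H1 κ` stores its gradient as separate data. If the function part of a difference
vanishes, integration by parts shows that `κ` times its gradient part annihilates every test
function, so the gradient part vanishes too. -/
theorem H1.ext_of_toFun {κ : ℝ} (hκ : 0 < κ) {U V : H1 κ}
    (h : H1.toFun U =ᵐ[diskMeasure] H1.toFun V) : U = V := by
  rw [← sub_eq_zero]
  set W := U - V with hW
  have h1 : fstL (W : L2Pair) = 0 := by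
    have : fstL (U : L2Pair) = fstL (V : L2Pair) := Lp.ext h
    rw [hW, AddSubgroupClass.coe_sub, map_sub, this, sub_self]
  have h2 : ∀ j, sndL j (W : L2Pair) = 0 := fun j => by
    refine Lp.ext (Filter.EventuallyEq.trans ?_ (Lp.coeFn_zero ..).symm)
    refine ae_eq_zero_of_forall_test (Lp.memLp _) fun ψ hψ => ?_
    have := (mem_H1_iff κ W).1 W.2 ψ hψ j
    rw [h1, map_zero, eq_comm, neg_eq_zero, mul_eq_zero, pairing_apply] at this
    exact this.resolve_left (by exact_mod_cast hκ.ne')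
  refine Subtype.ext ((WithLp.ofLp_injective 2) (Prod.ext h1 (Lp.ext ?_)))
  have h3 : ∀ j, (fun x => (W : L2Pair).snd x j) =ᵐ[diskMeasure] 0 := fun j => by
    have := (sndL_ae j W).symm
    rw [h2 j] at this
    exact this.trans (Lp.coeFn_zero ..)
  refine Filter.EventuallyEq.trans ?_ (Lp.coeFn_zero ..).symm
  filter_upwards [h3 0, h3 1] with x hx hx'
  ext j
  fin_cases j
  · exact hx
  · exact hx'

/-- If the sum of a series in `L²` is also its pointwise sum almost everywhere, then both
coincide. -/
theorem ae_eq_of_hasSum_Lp {α ι : Type*} [Countable ι] [MeasurableSpace α] {μ : Measure α}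
    {f : ι → Lp ℂ 2 μ} {F : Lp ℂ 2 μ} (hF : HasSum f F) {g : ι → α → ℂ} {G : α → ℂ}
    (hg : ∀ i, f i =ᵐ[μ] g i) (hG : ∀ᵐ x ∂μ, HasSum (fun i => g i x) (G x)) : F =ᵐ[μ] G := by
  classical
  have h1 : TendstoInMeasure μ (fun s : Finset ι => ((∑ i ∈ s, f i : Lp ℂ 2 μ) : α → ℂ))
      Filter.atTop F := tendstoInMeasure_of_tendsto_Lp hF
  -- Convergence in `L²` gives almost everywhere convergence only along a sequence of finite partial
  -- sums. This suffices, because the unconditional pointwise sum has the same limit along that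
  -- sequence.
  obtain ⟨ns, hns, h2⟩ := h1.exists_seq_tendsto_ae'
  -- A countable index set has countably many finite subsets, so one null set serves all partial
  -- sums.
  have h3 : ∀ᵐ x ∂μ, ∀ s : Finset ι, (∑ i ∈ s, f i : Lp ℂ 2 μ) x = ∑ i ∈ s, g i x := by
    rw [ae_all_iff]
    intro s
    induction s using Finset.induction_on with
    | empty =>
      filter_upwards [Lp.coeFn_zero ℂ 2 μ] with x hx
      simpa using hx
    | insert i s hi ih =>
      filter_upwards [Lp.coeFn_add (f i) (∑ i ∈ s, f i), hg i, ih] with x h1 h2 h3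
      rw [Finset.sum_insert hi, Finset.sum_insert hi, h1, Pi.add_apply, h2, h3]
  filter_upwards [h2, h3, hG] with x hx hx' hx''
  simp only [hx'] at hx
  exact tendsto_nhds_unique hx (hx''.comp hns)

/-! ### Recurrence relations of the functions `besselE` -/

theorem summable_besselE_norm (n : ℕ) (s : ℂ) :
    Summable fun k : ℕ => ‖(-1) ^ k / ((k.factorial : ℂ) * ((n + k).factorial : ℂ)) * s ^ k‖ := by
  refine (Real.summable_pow_div_factorial ‖s‖).of_nonneg_of_le (fun _ => norm_nonneg _) fun k => ?_
  have h1 : (1 : ℝ) ≤ ((n + k).factorial : ℝ) := by exact_mod_cast Nat.factorial_pos _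
  have h0 : (0 : ℝ) < (k.factorial : ℝ) := by exact_mod_cast Nat.factorial_pos _
  rw [norm_mul, norm_div, norm_mul, norm_pow, norm_pow, norm_neg, norm_one, one_pow,
    Complex.norm_natCast, Complex.norm_natCast, div_mul_eq_mul_div, one_mul]
  refine div_le_div₀ (by positivity) le_rfl h0 ?_
  nlinarith

theorem hasSum_besselE (n : ℕ) (s : ℂ) :
    HasSum (fun k : ℕ => (-1) ^ k / ((k.factorial : ℂ) * ((n + k).factorial : ℂ)) * s ^ k)
      (besselE n s) :=
  (summable_besselE_norm n s).of_norm.hasSum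

/-- Termwise differentiation: the factor `k` cancels against `k!`, and after the shift `k ↦ k + 1`
the other factorial becomes that of order `n + 1`. -/
theorem hasDerivAt_besselE (n : ℕ) (s : ℂ) :
    HasDerivAt (besselE n) (-besselE (n + 1) s) s := by
  set R := ‖s‖ + 1 with hR
  have hu : Summable fun k : ℕ => (k : ℝ) * R ^ (k - 1) / (k.factorial : ℝ) := by
    rw [← summable_nat_add_iff 1]
    refine (Real.summable_pow_div_factorial R).congr fun k => ?_
    rw [Nat.factorial_succ, Nat.add_sub_cancel]
    push_cast
    field_simp
  have key := hasDerivAt_tsum_of_isPreconnected (t := Metric.ball (0 : ℂ) R) hu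
    (g := fun k s => (-1) ^ k / ((k.factorial : ℂ) * ((n + k).factorial : ℂ)) * s ^ k)
    (g' := fun k s => (-1) ^ k / ((k.factorial : ℂ) * ((n + k).factorial : ℂ)) *
      ((k : ℂ) * s ^ (k - 1)))
    Metric.isOpen_ball (convex_ball _ _).isPreconnected
    (fun k y _ => (hasDerivAt_pow k y).const_mul _) ?_
    (y₀ := s) (by simp [hR]) (summable_besselE_norm n s).of_norm (y := s) (by simp [hR])
  · refine key.congr_deriv ?_
    have h := (hasSum_besselE (n + 1) s).neg
    have e : ∀ k : ℕ, (-1) ^ (k + 1) / (((k + 1).factorial : ℂ) * ((n + (k + 1)).factorial : ℂ)) *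
        (((k + 1 : ℕ) : ℂ) * s ^ (k + 1 - 1)) =
        -((-1) ^ k / ((k.factorial : ℂ) * ((n + 1 + k).factorial : ℂ)) * s ^ k) := fun k => by
      rw [Nat.add_sub_cancel, Nat.factorial_succ, show n + (k + 1) = n + 1 + k by ring]
      have : (k.factorial : ℂ) ≠ 0 := by exact_mod_cast Nat.factorial_ne_zero _
      have : ((n + 1 + k).factorial : ℂ) ≠ 0 := by exact_mod_cast Nat.factorial_ne_zero _
      have : ((k : ℂ) + 1) ≠ 0 := Nat.cast_add_one_ne_zero k
      push_cast
      field_simp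
      ring
    refine (tsum_eq_zero_add' (h.summable.congr fun k => (e k).symm)).trans ?_
    rw [tsum_congr e, h.tsum_eq]
    simp
  · intro k y hy
    have hy' : ‖y‖ ≤ R := by simpa using (mem_ball_zero_iff.1 hy).le
    have h1 : (1 : ℝ) ≤ ((n + k).factorial : ℝ) := by exact_mod_cast Nat.factorial_pos _
    have h0 : (0 : ℝ) < (k.factorial : ℝ) := by exact_mod_cast Nat.factorial_pos _
    rw [norm_mul, norm_div, norm_mul, norm_mul, norm_pow, norm_pow, norm_neg, norm_one, one_pow,
      Complex.norm_natCast, Complex.norm_natCast, Complex.norm_natCast, div_mul_eq_mul_div,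
      one_mul]
    refine div_le_div₀ (by positivity) (by gcongr) h0 ?_
    nlinarith

/-- Multiplying the `k`-th coefficient of order `n + 1` by `(n + 1) + k` reduces `(n + 1 + k)!` to
`(n + k)!`. The part carrying `k` is, after an index shift, `-s` times the series of order `n + 2`.
-/
theorem besselE_recurrence (n : ℕ) (s : ℂ) :
    (n + 1) * besselE (n + 1) s - s * besselE (n + 2) s = besselE n s := by
  have h1 := (hasSum_besselE (n + 1) s).mul_left ((n : ℂ) + 1)
  have h2 : HasSum (fun k : ℕ => (k : ℂ) *
      ((-1) ^ k / ((k.factorial : ℂ) * ((n + 1 + k).factorial : ℂ)) * s ^ k))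
      (-(s * besselE (n + 2) s)) := by
    rw [← hasSum_nat_add_iff' 1]
    have := ((hasSum_besselE (n + 2) s).mul_left s).neg
    simp only [Finset.sum_range_one, Nat.cast_zero, zero_mul, sub_zero]
    convert! this using 1
    funext k
    rw [Nat.factorial_succ, show n + 1 + (k + 1) = n + 2 + k by ring]
    have : (k.factorial : ℂ) ≠ 0 := by exact_mod_cast Nat.factorial_ne_zero _
    have : ((n + 2 + k).factorial : ℂ) ≠ 0 := by exact_mod_cast Nat.factorial_ne_zero _
    have : ((k : ℂ) + 1) ≠ 0 := Nat.cast_add_one_ne_zero k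
    push_cast
    field_simp
    ring
  rw [sub_eq_add_neg]
  refine (h1.add h2).unique ?_
  convert! hasSum_besselE n s using 1
  funext k
  rw [show n + 1 + k = (n + k) + 1 by ring, Nat.factorial_succ]
  have : (k.factorial : ℂ) ≠ 0 := by exact_mod_cast Nat.factorial_ne_zero _
  have : ((n + k).factorial : ℂ) ≠ 0 := by exact_mod_cast Nat.factorial_ne_zero _
  have : ((n : ℂ) + k + 1) ≠ 0 := by exact_mod_cast Nat.succ_ne_zero (n + k)
  push_cast
  field_simp
  ring

/-! ### Wirtinger derivatives -/

/-- The derivative `2 ∂/∂z̄ = ∂₀ + i ∂₁`. -/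
def wirtP (f : Plane → ℂ) (x : Plane) : ℂ := partialDeriv 0 f x + Complex.I * partialDeriv 1 f x

/-- The derivative `2 ∂/∂z = ∂₀ - i ∂₁`. -/
def wirtM (f : Plane → ℂ) (x : Plane) : ℂ := partialDeriv 0 f x - Complex.I * partialDeriv 1 f x

theorem partialDeriv_mul {f g : Plane → ℂ} {x : Plane} (hf : DifferentiableAt ℝ f x)
    (hg : DifferentiableAt ℝ g x) (j : Fin 2) :
    partialDeriv j (fun y => f y * g y) x = partialDeriv j f x * g x + f x * partialDeriv j g x := by
  simp only [partialDeriv]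
  rw [fderiv_fun_mul hf hg]
  simp
  ring

theorem partialDeriv_const_mul {f : Plane → ℂ} {x : Plane} (hf : DifferentiableAt ℝ f x) (c : ℂ)
    (j : Fin 2) : partialDeriv j (fun y => c * f y) x = c * partialDeriv j f x := by
  simp only [partialDeriv]
  rw [fderiv_const_mul hf]
  simp

theorem partialDeriv_add {f g : Plane → ℂ} {x : Plane} (hf : DifferentiableAt ℝ f x)
    (hg : DifferentiableAt ℝ g x) (j : Fin 2) :
    partialDeriv j (fun y => f y + g y) x = partialDeriv j f x + partialDeriv j g x := by
  simp only [partialDeriv]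
  rw [fderiv_fun_add hf hg]
  simp

theorem partialDeriv_conj {f : Plane → ℂ} {x : Plane} (hf : DifferentiableAt ℝ f x) (j : Fin 2) :
    partialDeriv j (fun y => (starRingEnd ℂ) (f y)) x =
      (starRingEnd ℂ) (partialDeriv j f x) := by
  simp only [partialDeriv]
  have : HasFDerivAt (fun y => (starRingEnd ℂ) (f y))
      ((Complex.conjCLE : ℂ →L[ℝ] ℂ).comp (fderiv ℝ f x)) x :=
    (Complex.conjCLE : ℂ →L[ℝ] ℂ).hasFDerivAt.comp x hf.hasFDerivAt
  rw [this.fderiv]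
  rfl

theorem partialDeriv_pow {f : Plane → ℂ} {x : Plane} (hf : DifferentiableAt ℝ f x) (n : ℕ)
    (j : Fin 2) :
    partialDeriv j (fun y => f y ^ n) x = n * f x ^ (n - 1) * partialDeriv j f x := by
  simp only [partialDeriv]
  rw [fderiv_fun_pow n hf]
  simp

theorem partialDeriv_radial {k : ℝ → ℂ} {x : Plane} (hk : DifferentiableAt ℝ k (‖x‖ ^ 2))
    (j : Fin 2) : partialDeriv j (fun y => k (‖y‖ ^ 2)) x = 2 * x j * deriv k (‖x‖ ^ 2) := by
  simp only [partialDeriv]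
  have h1 : HasFDerivAt (fun y : Plane => ‖y‖ ^ 2) (2 • (innerSL ℝ x)) x :=
    (hasStrictFDerivAt_norm_sq x).hasFDerivAt
  have h2 : HasFDerivAt (fun y : Plane => k (‖y‖ ^ 2)) _ x :=
    hk.hasDerivAt.hasFDerivAt.comp x h1
  rw [h2.fderiv]
  simp [EuclideanSpace.inner_single_right, mul_assoc]

theorem partialDeriv_toComplex (x : Plane) (j : Fin 2) :
    partialDeriv j toComplex x = if j = 0 then 1 else Complex.I := by
  have h : HasFDerivAt toComplex
      ((Complex.ofRealCLM.comp (EuclideanSpace.proj 0 : Plane →L[ℝ] ℝ)) +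
      (Complex.ofRealCLM.comp (EuclideanSpace.proj 1 : Plane →L[ℝ] ℝ)).smulRight Complex.I) x := by
    have : toComplex = ((Complex.ofRealCLM.comp (EuclideanSpace.proj 0 : Plane →L[ℝ] ℝ)) +
      (Complex.ofRealCLM.comp (EuclideanSpace.proj 1 : Plane →L[ℝ] ℝ)).smulRight Complex.I :
        Plane →L[ℝ] ℂ) := by
      funext y
      simp [toComplex]
    exact (ContinuousLinearMap.hasFDerivAt _).congr_of_eventuallyEq
      (Filter.Eventually.of_forall fun y => congrFun this y)
  rw [partialDeriv, h.fderiv]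
  fin_cases j <;> simp

theorem differentiable_toComplex : Differentiable ℝ toComplex :=
  contDiff_toComplex.differentiable (by simp)

theorem toComplex_mul_conj (x : Plane) :
    toComplex x * (starRingEnd ℂ) (toComplex x) = ((‖x‖ ^ 2 : ℝ) : ℂ) := by
  rw [Complex.mul_conj, Complex.normSq_eq_norm_sq, norm_toComplex]

/-- With `z = toComplex x`, the operator `∂₀ + i∂₁` annihilates the holomorphic factor `zⁿ`, and it
sends `|z|²` to `2z`. -/
theorem wirtP_radial_mul_pow {k : ℝ → ℂ} (hk : Differentiable ℝ k) (n : ℕ) (x : Plane) :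
    wirtP (fun y => k (‖y‖ ^ 2) * toComplex y ^ n) x =
      2 * deriv k (‖x‖ ^ 2) * toComplex x ^ (n + 1) := by
  have h1 : DifferentiableAt ℝ (fun y : Plane => k (‖y‖ ^ 2)) x :=
    hk.differentiableAt.comp x (contDiff_norm_sq ℝ (n := 1)).differentiable_one.differentiableAt
  have h2 := differentiable_toComplex x
  have h3 : DifferentiableAt ℝ (fun y => toComplex y ^ n) x := h2.pow n
  rw [wirtP, partialDeriv_mul h1 h3, partialDeriv_mul h1 h3,
    partialDeriv_pow h2, partialDeriv_pow h2, partialDeriv_radial hk.differentiableAt,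
    partialDeriv_radial hk.differentiableAt, partialDeriv_toComplex, partialDeriv_toComplex]
  have h3 : toComplex x = x 0 + x 1 * Complex.I := rfl
  simp only [if_true, one_ne_zero, if_false]
  linear_combination (k (‖x‖ ^ 2) * n * toComplex x ^ (n - 1)) * Complex.I_sq -
    2 * deriv k (‖x‖ ^ 2) * toComplex x ^ n * h3

/-- Here both factors contribute: `∂₀ - i∂₁` sends `|z|²` to `2z̄` and `z^{n+1}` to `2(n + 1)zⁿ`,
and `z̄ z = |x|²` absorbs one power of `z`. -/
theorem wirtM_radial_mul_pow {k : ℝ → ℂ} (hk : Differentiable ℝ k) (n : ℕ) (x : Plane) :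
    wirtM (fun y => k (‖y‖ ^ 2) * toComplex y ^ (n + 1)) x =
      2 * (((‖x‖ ^ 2 : ℝ) : ℂ) * deriv k (‖x‖ ^ 2) + (n + 1) * k (‖x‖ ^ 2)) *
        toComplex x ^ n := by
  have h1 : DifferentiableAt ℝ (fun y : Plane => k (‖y‖ ^ 2)) x :=
    hk.differentiableAt.comp x (contDiff_norm_sq ℝ (n := 1)).differentiable_one.differentiableAt
  have h2 := differentiable_toComplex x
  have h3 : DifferentiableAt ℝ (fun y => toComplex y ^ (n + 1)) x := h2.pow _
  rw [wirtM, partialDeriv_mul h1 h3, partialDeriv_mul h1 h3,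
    partialDeriv_pow h2, partialDeriv_pow h2, partialDeriv_radial hk.differentiableAt,
    partialDeriv_radial hk.differentiableAt, partialDeriv_toComplex, partialDeriv_toComplex,
    ← toComplex_mul_conj]
  have h3 : (starRingEnd ℂ) (toComplex x) = x 0 - x 1 * Complex.I := by simp [toComplex]; ring
  rw [h3]
  simp only [if_true, one_ne_zero, if_false, Nat.add_sub_cancel]
  push_cast
  rw [pow_succ (toComplex x)]
  linear_combination (-(k (‖x‖ ^ 2) * (n + 1) * toComplex x ^ n)) * Complex.I_sq

theorem wirtM_radial {k : ℝ → ℂ} (hk : Differentiable ℝ k) (x : Plane) :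
    wirtM (fun y => k (‖y‖ ^ 2)) x = 2 * deriv k (‖x‖ ^ 2) * (starRingEnd ℂ) (toComplex x) := by
  have h3 : (starRingEnd ℂ) (toComplex x) = x 0 - x 1 * Complex.I := by simp [toComplex]; ring
  rw [wirtM, partialDeriv_radial hk.differentiableAt, partialDeriv_radial hk.differentiableAt, h3]
  ring

theorem wirtM_conj {f : Plane → ℂ} (hf : Differentiable ℝ f) (x : Plane) :
    wirtM (fun y => (starRingEnd ℂ) (f y)) x = (starRingEnd ℂ) (wirtP f x) := by
  rw [wirtM, wirtP, partialDeriv_conj hf.differentiableAt, partialDeriv_conj hf.differentiableAt]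
  simp
  ring

theorem wirtP_conj {f : Plane → ℂ} (hf : Differentiable ℝ f) (x : Plane) :
    wirtP (fun y => (starRingEnd ℂ) (f y)) x = (starRingEnd ℂ) (wirtM f x) := by
  rw [wirtM, wirtP, partialDeriv_conj hf.differentiableAt, partialDeriv_conj hf.differentiableAt]
  simp

theorem contDiff_partialDeriv {f : Plane → ℂ} (hf : ContDiff ℝ ∞ f) (j : Fin 2) :
    ContDiff ℝ ∞ (partialDeriv j f) :=
  (hf.fderiv_right (m := ∞) (by simp)).clm_apply contDiff_const

theorem contDiff_wirtM {f : Plane → ℂ} (hf : ContDiff ℝ ∞ f) : ContDiff ℝ ∞ (wirtM f) :=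
  (contDiff_partialDeriv hf 0).sub (contDiff_const.mul (contDiff_partialDeriv hf 1))

theorem contDiff_wirtP {f : Plane → ℂ} (hf : ContDiff ℝ ∞ f) : ContDiff ℝ ∞ (wirtP f) :=
  (contDiff_partialDeriv hf 0).add (contDiff_const.mul (contDiff_partialDeriv hf 1))

theorem partialDeriv_comm {f : Plane → ℂ} (hf : ContDiff ℝ ∞ f) (i j : Fin 2) (x : Plane) :
    partialDeriv i (partialDeriv j f) x = partialDeriv j (partialDeriv i f) x := by
  have h1 : DifferentiableAt ℝ (fderiv ℝ f) x :=
    ((hf.fderiv_right (m := ∞) (by simp)).differentiable (by simp)).differentiableAt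
  have h2 (j : Fin 2) (v : Plane) : fderiv ℝ (partialDeriv j f) x v =
      fderiv ℝ (fderiv ℝ f) x v (EuclideanSpace.single j 1) := by
    have : HasFDerivAt (partialDeriv j f) _ x := h1.hasFDerivAt.clm_apply
      (hasFDerivAt_const (EuclideanSpace.single j (1 : ℝ)) x)
    rw [this.fderiv]
    simp
  have h3 : IsSymmSndFDerivAt ℝ f x := hf.contDiffAt.isSymmSndFDerivAt
    (by simpa using WithTop.coe_le_coe.2 (le_top : (2 : ℕ∞) ≤ ⊤))
  rw [partialDeriv, h2, partialDeriv, h2]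
  exact h3 _ _

/-- Factorisation of the Laplacian; the cross terms cancel by symmetry of second derivatives. -/
theorem wirtP_wirtM {f : Plane → ℂ} (hf : ContDiff ℝ ∞ f) (x : Plane) :
    wirtP (wirtM f) x = partialDeriv 0 (partialDeriv 0 f) x + partialDeriv 1 (partialDeriv 1 f) x := by
  have h (j : Fin 2) : DifferentiableAt ℝ (partialDeriv j f) x :=
    ((contDiff_partialDeriv hf j).differentiable (by simp)).differentiableAt
  have e (j : Fin 2) : partialDeriv j (wirtM f) x =
      partialDeriv j (partialDeriv 0 f) x - Complex.I * partialDeriv j (partialDeriv 1 f) x := by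
    have : wirtM f = fun y => partialDeriv 0 f y + (-Complex.I) * partialDeriv 1 f y := by
      funext y; simp [wirtM]; ring
    rw [this, partialDeriv_add (h 0) ((h 1).const_mul _), partialDeriv_const_mul (h 1)]
    ring
  rw [wirtP, e, e, partialDeriv_comm hf 1 0]
  linear_combination (-partialDeriv 1 (partialDeriv 1 f) x) * Complex.I_sq

theorem wirtM_wirtP {f : Plane → ℂ} (hf : ContDiff ℝ ∞ f) (x : Plane) :
    wirtM (wirtP f) x = wirtP (wirtM f) x := by
  have h (j : Fin 2) : DifferentiableAt ℝ (partialDeriv j f) x :=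
    ((contDiff_partialDeriv hf j).differentiable (by simp)).differentiableAt
  have e (j : Fin 2) : partialDeriv j (wirtP f) x =
      partialDeriv j (partialDeriv 0 f) x + Complex.I * partialDeriv j (partialDeriv 1 f) x := by
    have : wirtP f = fun y => partialDeriv 0 f y + Complex.I * partialDeriv 1 f y := rfl
    rw [this, partialDeriv_add (h 0) ((h 1).const_mul _), partialDeriv_const_mul (h 1)]
  rw [wirtP_wirtM hf, wirtM, e, e, partialDeriv_comm hf 1 0]
  linear_combination (-partialDeriv 1 (partialDeriv 1 f) x) * Complex.I_sq

/-! ### Circular waves under Wirtinger derivatives -/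

/-- The radial profile of the circular waves of order `±n`, as a function of `r²`. -/
def profile (κ : ℝ) (n : ℕ) (s : ℝ) : ℂ :=
  ((κ / 2 : ℝ) : ℂ) ^ n * besselE n (((κ / 2) ^ 2 * s : ℝ) : ℂ)

theorem contDiff_profile (κ : ℝ) (n : ℕ) : ContDiff ℝ ∞ (profile κ n) := by
  have h1 : ContDiff ℝ ∞ (besselE n) :=
    ((differentiable_besselE n).contDiff (n := ∞)).restrict_scalars ℝ
  have h2 : ContDiff ℝ ∞ fun s : ℝ => (((κ / 2) ^ 2 * s : ℝ) : ℂ) :=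
    Complex.ofRealCLM.contDiff.comp (contDiff_const.mul contDiff_id)
  exact contDiff_const.mul (h1.comp h2)

theorem hasDerivAt_profile (κ : ℝ) (n : ℕ) (s : ℝ) :
    HasDerivAt (profile κ n) (-((κ / 2 : ℝ) : ℂ) * profile κ (n + 1) s) s := by
  have h2 : HasDerivAt (fun s : ℝ => (((κ / 2) ^ 2 * s : ℝ) : ℂ)) (((κ / 2) ^ 2 : ℝ) : ℂ) s := by
    have := ((hasDerivAt_id s).const_mul ((κ / 2) ^ 2)).ofReal_comp
    simpa using this
  have := ((hasDerivAt_besselE n _).comp s h2).const_mul (((κ / 2 : ℝ) : ℂ) ^ n)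
  refine HasDerivAt.congr_deriv (f := profile κ n) this ?_
  simp only [profile]
  push_cast
  ring

theorem differentiable_profile (κ : ℝ) (n : ℕ) : Differentiable ℝ (profile κ n) :=
  fun s => (hasDerivAt_profile κ n s).differentiableAt

theorem deriv_profile (κ : ℝ) (n : ℕ) (s : ℝ) :
    deriv (profile κ n) s = -((κ / 2 : ℝ) : ℂ) * profile κ (n + 1) s :=
  (hasDerivAt_profile κ n s).deriv

/-- This is the radial form of the lowering relation: combined with `wirtM_radial_mul_pow`, it gives
`κ` times the wave of order `n`. -/
theorem profile_recurrence (κ : ℝ) (n : ℕ) (s : ℝ) :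
    (s : ℂ) * deriv (profile κ (n + 1)) s + (n + 1) * profile κ (n + 1) s =
      ((κ / 2 : ℝ) : ℂ) * profile κ n s := by
  rw [deriv_profile]
  simp only [profile]
  rw [← besselE_recurrence n]
  push_cast
  ring

theorem circularWave_natCast (κ : ℝ) (n : ℕ) (x : Plane) :
    circularWave κ n x = profile κ n (‖x‖ ^ 2) * toComplex x ^ n :=
  circularWave_ofNat κ n x

/-- The Bessel factor is real, so conjugation reverses only the angular exponential. Statements
about negative orders are thereby reduced to nonnegative ones. -/
theorem circularWave_neg (κ : ℝ) (p : ℤ) (x : Plane) :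
    circularWave κ (-p) x = (-1) ^ p * (starRingEnd ℂ) (circularWave κ p x) := by
  have key (n : ℕ) : circularWave κ (-(n : ℤ)) x =
      (-1) ^ n * (starRingEnd ℂ) (circularWave κ n x) := by
    have hc : (starRingEnd ℂ) (circularWave κ n x) = (besselJNat n (κ * ‖x‖) : ℂ) *
        Complex.exp (-(Complex.I * n * (Complex.arg (toComplex x) : ℂ))) := by
      rw [circularWave, map_mul, ← Complex.exp_conj]
      simp [besselJ]
    rw [hc]
    rcases n with _ | n
    · simp [circularWave, besselJ]
    · rw [circularWave, show -((n + 1 : ℕ) : ℤ) = Int.negSucc n from rfl, besselJ,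
        Int.cast_negSucc]
      push_cast
      ring_nf
  obtain ⟨n, rfl | rfl⟩ := p.eq_nat_or_neg
  · rw [key, zpow_natCast]
  · have h1 : ((-1 : ℂ) ^ n) * (-1) ^ n = 1 := by rw [← mul_pow]; simp
    rw [key, neg_neg, zpow_neg, zpow_natCast, map_mul, Complex.conj_conj]
    have h2 : ((-1 : ℂ) ^ n)⁻¹ = (-1) ^ n := by
      rw [inv_eq_iff_eq_inv]
      exact eq_inv_of_mul_eq_one_left h1
    rw [h2]
    simp only [map_pow, map_neg, map_one]
    rw [← mul_assoc, h1, one_mul]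

theorem differentiable_circularWave (κ : ℝ) (p : ℤ) : Differentiable ℝ (circularWave κ p) :=
  (contDiff_circularWave κ p).differentiable (by simp)

/-- The ladder relations. For nonnegative orders they are the derivative and the recurrence of the
profile; conjugation exchanges the two operators and gives the negative orders. -/
theorem wirtP_circularWave (κ : ℝ) (p : ℤ) (x : Plane) :
    wirtP (circularWave κ p) x = -κ * circularWave κ (p + 1) x ∧
    wirtM (circularWave κ p) x = κ * circularWave κ (p - 1) x := by
  have hn (n : ℕ) : (circularWave κ n : Plane → ℂ) =
      fun y => profile κ n (‖y‖ ^ 2) * toComplex y ^ n := funext fun y => circularWave_natCast κ n y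
  have key (n : ℕ) : wirtP (circularWave κ n) x = -κ * circularWave κ (n + 1) x ∧
      wirtM (circularWave κ n) x = κ * circularWave κ (n - 1) x := by
    constructor
    · rw [hn, wirtP_radial_mul_pow (differentiable_profile κ n), deriv_profile,
        show ((n : ℤ) + 1) = ((n + 1 : ℕ) : ℤ) by push_cast; ring, hn]
      push_cast
      ring
    · rcases n with _ | n
      -- At order zero there is no power of `z` to lower. The derivative produces `z̄` instead,
      -- which is the wave of order `-1`.
      · have h0 : (circularWave κ (0 : ℕ) : Plane → ℂ) = fun y => profile κ 0 (‖y‖ ^ 2) := by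
          rw [hn]; simp
        rw [h0, wirtM_radial (differentiable_profile κ 0), deriv_profile,
          show (((0 : ℕ) : ℤ) - 1) = -((1 : ℕ) : ℤ) by simp, circularWave_neg, hn]
        have hr : (starRingEnd ℂ) (profile κ 1 (‖x‖ ^ 2)) = profile κ 1 (‖x‖ ^ 2) := by
          have h2 : (starRingEnd ℂ) 2 = 2 := Complex.conj_ofNat 2
          rw [profile, map_mul, besselE, Complex.conj_tsum]
          simp [h2]
        simp [hr]
        ring
      · rw [hn, wirtM_radial_mul_pow (differentiable_profile κ _), profile_recurrence,
          show (((n + 1 : ℕ) : ℤ) - 1) = (n : ℤ) by push_cast; ring, hn]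
        push_cast
        ring
  obtain ⟨n, rfl | rfl⟩ := p.eq_nat_or_neg
  · exact key n
  · have hc : circularWave κ (-(n : ℤ)) =
        fun y => (starRingEnd ℂ) ((-1) ^ n * circularWave κ n y) := by
      funext y
      simp [circularWave_neg]
    have hd : Differentiable ℝ fun y => (-1 : ℂ) ^ n * circularWave κ n y :=
      (differentiable_circularWave κ n).const_mul _
    have e1 : wirtM (fun y => (-1 : ℂ) ^ n * circularWave κ n y) x =
        (-1) ^ n * wirtM (circularWave κ n) x := by
      rw [wirtM, partialDeriv_const_mul (differentiable_circularWave κ n).differentiableAt,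
        partialDeriv_const_mul (differentiable_circularWave κ n).differentiableAt, wirtM]
      ring
    have e2 : wirtP (fun y => (-1 : ℂ) ^ n * circularWave κ n y) x =
        (-1) ^ n * wirtP (circularWave κ n) x := by
      rw [wirtP, partialDeriv_const_mul (differentiable_circularWave κ n).differentiableAt,
        partialDeriv_const_mul (differentiable_circularWave κ n).differentiableAt, wirtP]
      ring
    rw [hc, wirtP_conj hd, wirtM_conj hd, e1, e2, (key n).1, (key n).2,
      show -(n : ℤ) + 1 = -((n : ℤ) - 1) by ring, show -(n : ℤ) - 1 = -((n : ℤ) + 1) by ring,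
      circularWave_neg, circularWave_neg, zpow_add_one₀ (by simp), zpow_sub_one₀ (by simp)]
    simp
    constructor <;> ring

/-- Lowering and then raising returns to order `p` with the factor `κ · (-κ)`. -/
theorem laplacian_circularWave (κ : ℝ) (p : ℤ) (x : Plane) :
    wirtP (wirtM (circularWave κ p)) x = -(κ : ℂ) ^ 2 * circularWave κ p x := by
  have h : wirtM (circularWave κ p) = fun y => κ * circularWave κ (p - 1) y :=
    funext fun y => (wirtP_circularWave κ p y).2
  have hd := (differentiable_circularWave κ (p - 1)).differentiableAt (x := x)
  rw [h, wirtP, partialDeriv_const_mul hd, partialDeriv_const_mul hd]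
  have := (wirtP_circularWave κ (p - 1) x).1
  rw [wirtP, sub_add_cancel] at this
  linear_combination (κ : ℂ) * this

/-! ### Angular modes -/

/-- The function `r^|p| e^{ipθ}`. -/
def modeMon (p : ℤ) (x : Plane) : ℂ :=
  toComplex x ^ p.toNat * (starRingEnd ℂ) (toComplex x) ^ (-p).toNat

/-- Smooth functions of the form `k(r²) r^|p| e^{ipθ}`. -/
def IsMode (p : ℤ) (ψ : Plane → ℂ) : Prop :=
  ∃ k : ℝ → ℂ, ContDiff ℝ ∞ k ∧ ψ = fun x => k (‖x‖ ^ 2) * modeMon p x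

theorem modeMon_natCast (n : ℕ) (x : Plane) : modeMon n x = toComplex x ^ n := by
  simp [modeMon]

theorem conj_modeMon (p : ℤ) (x : Plane) : (starRingEnd ℂ) (modeMon p x) = modeMon (-p) x := by
  simp [modeMon, mul_comm]

theorem contDiff_conj : ContDiff ℝ ∞ (starRingEnd ℂ : ℂ → ℂ) := Complex.conjCLE.contDiff

theorem contDiff_modeMon (p : ℤ) : ContDiff ℝ ∞ (modeMon p) :=
  (contDiff_toComplex.pow _).mul ((contDiff_conj.comp contDiff_toComplex).pow _)

theorem IsMode.contDiff {p : ℤ} {ψ : Plane → ℂ} (h : IsMode p ψ) : ContDiff ℝ ∞ ψ := by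
  obtain ⟨k, hk, rfl⟩ := h
  exact (hk.comp (contDiff_norm_sq ℝ)).mul (contDiff_modeMon p)

theorem IsMode.conj {p : ℤ} {ψ : Plane → ℂ} (h : IsMode p ψ) :
    IsMode (-p) fun x => (starRingEnd ℂ) (ψ x) := by
  obtain ⟨k, hk, rfl⟩ := h
  refine ⟨fun s => (starRingEnd ℂ) (k s), contDiff_conj.comp hk, ?_⟩
  funext x
  rw [map_mul, conj_modeMon]

theorem IsMode.const_mul {p : ℤ} {ψ : Plane → ℂ} (h : IsMode p ψ) (c : ℂ) :
    IsMode p fun x => c * ψ x := by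
  obtain ⟨k, hk, rfl⟩ := h
  exact ⟨fun s => c * k s, contDiff_const.mul hk, funext fun x => (mul_assoc _ _ _).symm⟩

theorem IsMode.radial_mul {p : ℤ} {ψ : Plane → ℂ} (h : IsMode p ψ) {χ : ℝ → ℂ}
    (hχ : ContDiff ℝ ∞ χ) : IsMode p fun x => χ (‖x‖ ^ 2) * ψ x := by
  obtain ⟨k, hk, rfl⟩ := h
  exact ⟨fun s => χ s * k s, hχ.mul hk, funext fun x => (mul_assoc _ _ _).symm⟩

theorem isMode_circularWave (κ : ℝ) (p : ℤ) : IsMode p (circularWave κ p) := by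
  have key (n : ℕ) : IsMode n (circularWave κ n) :=
    ⟨profile κ n, contDiff_profile κ n, funext fun x => by
      rw [circularWave_natCast, modeMon_natCast]⟩
  obtain ⟨n, rfl | rfl⟩ := p.eq_nat_or_neg
  · exact key n
  · rw [show circularWave κ (-(n : ℤ)) = _ from funext (circularWave_neg κ n)]
    exact (key n).conj.const_mul _

theorem contDiff_deriv {k : ℝ → ℂ} (hk : ContDiff ℝ ∞ k) : ContDiff ℝ ∞ (deriv k) :=
  ((contDiff_infty_iff_deriv (𝕜 := ℝ)).1 hk).2

/-- The shift of the frequency by one preserves smoothness of the radial factor in `r²`, at the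
origin too. This lets weak derivatives be tested one mode at a time. -/
theorem IsMode.wirt {p : ℤ} {ψ : Plane → ℂ} (h : IsMode p ψ) :
    IsMode (p + 1) (wirtP ψ) ∧ IsMode (p - 1) (wirtM ψ) := by
  have key (n : ℕ) (k : ℝ → ℂ) (hk : ContDiff ℝ ∞ k) :
      IsMode (n + 1) (wirtP fun x => k (‖x‖ ^ 2) * modeMon n x) ∧
      IsMode (n - 1) (wirtM fun x => k (‖x‖ ^ 2) * modeMon n x) := by
    have hd : Differentiable ℝ k := hk.differentiable (by simp)
    constructor
    · refine ⟨fun s => 2 * deriv k s, contDiff_const.mul (contDiff_deriv hk), funext fun x => ?_⟩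
      simp only [modeMon_natCast]
      rw [wirtP_radial_mul_pow hd, ← modeMon_natCast]
      push_cast
      rfl
    · rcases n with _ | n
      · refine ⟨fun s => 2 * deriv k s, contDiff_const.mul (contDiff_deriv hk), funext fun x => ?_⟩
        have : modeMon ((0 : ℕ) - 1) x = (starRingEnd ℂ) (toComplex x) := by simp [modeMon]
        rw [this, ← wirtM_radial hd]
        simp [modeMon]
      · refine ⟨fun s => 2 * ((s : ℂ) * deriv k s + (n + 1) * k s), ?_, funext fun x => ?_⟩
        · exact contDiff_const.mul ((Complex.ofRealCLM.contDiff.mul (contDiff_deriv hk)).add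
            (contDiff_const.mul hk))
        · simp only [modeMon_natCast]
          rw [wirtM_radial_mul_pow hd, show (((n + 1 : ℕ) : ℤ) - 1) = (n : ℤ) by push_cast; ring,
            modeMon_natCast]
  obtain ⟨n, rfl | rfl⟩ := p.eq_nat_or_neg
  · obtain ⟨k, hk, rfl⟩ := h
    exact key n k hk
  · have h' := h.conj
    rw [neg_neg] at h'
    have hd : Differentiable ℝ fun x => (starRingEnd ℂ) (ψ x) :=
      h'.contDiff.differentiable (by simp)
    have hψ : ψ = fun x => (starRingEnd ℂ) ((starRingEnd ℂ) (ψ x)) := by simp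
    obtain ⟨k, hk, hk'⟩ := h'
    have h2 := key n k hk
    rw [← hk'] at h2
    constructor
    · rw [hψ, show wirtP _ = _ from funext (wirtP_conj hd)]
      have := h2.2.conj
      rwa [neg_sub, sub_eq_neg_add] at this
    · rw [hψ, show wirtM _ = _ from funext (wirtM_conj hd)]
      have := h2.1.conj
      rwa [neg_add, ← sub_eq_add_neg] at this

/-- The margin `δ` keeps the closed support inside `‖x‖² ≤ 1 - δ`, away from the boundary circle. -/
theorem isTestFunction_of_radial {k : ℝ → ℂ} (hk : ContDiff ℝ ∞ k) {δ : ℝ} (hδ : 0 < δ)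
    (h0 : ∀ s, 1 - δ ≤ s → k s = 0) {f : Plane → ℂ} (hf : ContDiff ℝ ∞ f) :
    IsTestFunction fun x => k (‖x‖ ^ 2) * f x := by
  have hs : tsupport (fun x => k (‖x‖ ^ 2) * f x) ⊆ {x : Plane | ‖x‖ ^ 2 ≤ 1 - δ} := by
    refine closure_minimal (fun x hx => ?_) (isClosed_le (by fun_prop) continuous_const)
    by_contra h
    exact hx (by simp [h0 _ (not_le.1 h).le])
  have hs' : {x : Plane | ‖x‖ ^ 2 ≤ 1 - δ} ⊆ unitDisk := fun x hx => by
    have : ‖x‖ ^ 2 < 1 := lt_of_le_of_lt hx (by linarith)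
    rw [unitDisk, mem_ball_zero_iff]
    nlinarith [norm_nonneg x]
  refine ⟨(hk.comp (contDiff_norm_sq ℝ)).mul hf, ?_, hs.trans hs'⟩
  exact (isCompact_closedBall (0 : Plane) 1).of_isClosed_subset (isClosed_tsupport _)
    ((hs.trans hs').trans Metric.ball_subset_closedBall)

theorem IsTestFunction.wirt {ψ : Plane → ℂ} (h : IsTestFunction ψ) :
    IsTestFunction (wirtP ψ) ∧ IsTestFunction (wirtM ψ) := by
  have h0 (j : Fin 2) : tsupport (partialDeriv j ψ) ⊆ tsupport ψ := by
    refine closure_minimal (fun x hx => ?_) (isClosed_tsupport _)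
    by_contra hn
    exact hx (by simp [partialDeriv, image_eq_zero_of_notMem_tsupport
      (fun h' => hn (tsupport_fderiv_subset ℝ h'))])
  have key (c : ℂ) (f : Plane → ℂ) (hf : f = fun x => partialDeriv 0 ψ x + c * partialDeriv 1 ψ x) :
      tsupport f ⊆ tsupport ψ := by
    refine closure_minimal (fun x hx => ?_) (isClosed_tsupport _)
    by_contra hn
    refine hx ?_
    rw [hf]
    simp [image_eq_zero_of_notMem_tsupport (fun h' => hn (h0 0 h')),
      image_eq_zero_of_notMem_tsupport (fun h' => hn (h0 1 h'))]
  have kP := key Complex.I (wirtP ψ) rfl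
  have kM := key (-Complex.I) (wirtM ψ) (by funext x; simp [wirtM]; ring)
  exact ⟨⟨contDiff_wirtP h.1, h.2.1.of_isClosed_subset (isClosed_tsupport _) kP, kP.trans h.2.2⟩,
    ⟨contDiff_wirtM h.1, h.2.1.of_isClosed_subset (isClosed_tsupport _) kM, kM.trans h.2.2⟩⟩

/-! ### Integrals over the disk -/

/-- The rotation of the plane by the angle `α`. -/
def planeRotation (α : ℝ) : Plane ≃ₗᵢ[ℝ] Plane :=
  (Complex.orthonormalBasisOneI.repr.symm.trans (rotation (Circle.exp α))).trans
    Complex.orthonormalBasisOneI.repr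

theorem toComplex_eq_repr_symm (x : Plane) :
    toComplex x = Complex.orthonormalBasisOneI.repr.symm x := by
  obtain ⟨z, rfl⟩ := Complex.orthonormalBasisOneI.repr.surjective x
  rw [LinearIsometryEquiv.symm_apply_apply, toComplex]
  simp [Complex.orthonormalBasisOneI_repr_apply]

theorem toComplex_planeRotation (α : ℝ) (x : Plane) :
    toComplex (planeRotation α x) = Complex.exp (α * Complex.I) * toComplex x := by
  rw [toComplex_eq_repr_symm, toComplex_eq_repr_symm, planeRotation]
  simp [rotation_apply]

theorem integral_comp_planeRotation (α : ℝ) (f : Plane → ℂ) :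
    ∫ x, f (planeRotation α x) ∂diskMeasure = ∫ x, f x ∂diskMeasure := by
  have h := (planeRotation α).measurePreserving
  have hpre : planeRotation α ⁻¹' unitDisk = unitDisk := by
    ext x
    simp [unitDisk]
  have := h.setIntegral_preimage_emb (planeRotation α).toHomeomorph.measurableEmbedding f unitDisk
  rwa [hpre] at this

/-- Functions that are multiplied by `e^{ipα}` under the rotation by `α`. -/
def IsEquivariant (p : ℤ) (f : Plane → ℂ) : Prop :=
  ∀ (α : ℝ) (x : Plane), f (planeRotation α x) = Complex.exp (p * (α * Complex.I)) * f x

theorem IsEquivariant.mul {p q : ℤ} {f g : Plane → ℂ} (hf : IsEquivariant p f)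
    (hg : IsEquivariant q g) : IsEquivariant (p + q) fun x => f x * g x := by
  intro α x
  simp only
  rw [hf, hg]
  push_cast
  rw [add_mul, Complex.exp_add]
  ring

theorem IsMode.isEquivariant {p : ℤ} {f : Plane → ℂ} (h : IsMode p f) : IsEquivariant p f := by
  obtain ⟨k, -, rfl⟩ := h
  intro α x
  have e1 : (starRingEnd ℂ) (Complex.exp (α * Complex.I)) = Complex.exp (-(α * Complex.I)) := by
    rw [← Complex.exp_conj]
    simp
  simp only [LinearIsometryEquiv.norm_map, modeMon]
  rw [toComplex_planeRotation, map_mul, mul_pow, mul_pow, e1, ← Complex.exp_nat_mul,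
    ← Complex.exp_nat_mul]
  have e2 : Complex.exp (p * (α * Complex.I)) = Complex.exp (p.toNat * (α * Complex.I)) *
      Complex.exp ((-p).toNat * -(α * Complex.I)) := by
    rw [← Complex.exp_add]
    congr 1
    have : (p : ℂ) = (p.toNat : ℂ) - ((-p).toNat : ℂ) := by
      have h : p = (p.toNat : ℤ) - ((-p).toNat : ℤ) := by omega
      exact_mod_cast congrArg (Int.cast (R := ℂ)) h
    rw [this]
    ring
  rw [e2]
  ring

/-- Rotation by `π/p` preserves the measure and multiplies the function by `e^{iπ} = -1`, so the
integral equals its own negative. -/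
theorem IsEquivariant.integral_eq_zero {p : ℤ} (hp : p ≠ 0) {f : Plane → ℂ}
    (h : IsEquivariant p f) : ∫ x, f x ∂diskMeasure = 0 := by
  have h1 := integral_comp_planeRotation (Real.pi / p) f
  have hp' : (p : ℂ) ≠ 0 := by exact_mod_cast hp
  have e : Complex.exp (p * (((Real.pi / p : ℝ) : ℂ) * Complex.I)) = -1 := by
    rw [← Complex.exp_pi_mul_I]
    congr 1
    push_cast
    field_simp
  simp only [h _ _] at h1
  rw [integral_const_mul, e] at h1
  linear_combination (-1 / 2 : ℂ) * h1

/-- Polar coordinates followed by `s = r²`, which turns `2πr dr` into `π ds`. -/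
theorem integral_disk_radial {F : ℝ → ℂ} (hF : Continuous F) :
    ∫ x, F (‖x‖ ^ 2) ∂diskMeasure = Real.pi * ∫ s in (0 : ℝ)..1, F s := by
  have h1 : ∫ x, F (‖x‖ ^ 2) ∂diskMeasure =
      ∫ x : Plane, (Set.Iio (1 : ℝ)).indicator (fun r => F (r ^ 2)) ‖x‖ := by
    rw [diskMeasure, ← integral_indicator (s := unitDisk) Metric.isOpen_ball.measurableSet]
    refine integral_congr_ae (Filter.Eventually.of_forall fun x => ?_)
    simp [Set.indicator, unitDisk]
  have h2 : (volume : Measure Plane).real (Metric.ball 0 1) = Real.pi := by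
    rw [Measure.real, EuclideanSpace.volume_ball_fin_two]
    simp [Real.pi_pos.le]
  have h3 : ∫ y in Set.Ioi (0 : ℝ), y ^ (Module.finrank ℝ Plane - 1) •
      (Set.Iio (1 : ℝ)).indicator (fun r => F (r ^ 2)) y = ∫ y in (0 : ℝ)..1, y • F (y ^ 2) := by
    rw [intervalIntegral.integral_of_le zero_le_one, integral_Ioc_eq_integral_Ioo,
      ← integral_indicator measurableSet_Ioi, ← integral_indicator measurableSet_Ioo]
    refine integral_congr_ae (Filter.Eventually.of_forall fun y => ?_)
    by_cases hy0 : 0 < y <;> by_cases hy1 : y < 1 <;> simp [Set.indicator, hy0, hy1]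
  have h4 : ∫ y in (0 : ℝ)..1, (2 * y) • F (y ^ 2) = ∫ s in (0 : ℝ)..1, F s := by
    have := intervalIntegral.integral_deriv_smul_comp (a := 0) (b := 1) (f := fun y : ℝ => y ^ 2)
      (f' := fun y => 2 * y) (g := F) (fun y _ => by simpa using hasDerivAt_pow 2 y)
      (by fun_prop) hF
    simpa using this
  rw [h1, integral_fun_norm_addHaar, h2, h3, ← h4]
  simp only [mul_smul]
  rw [intervalIntegral.integral_smul]
  simp
  ring

theorem integral_disk_norm_pow (n : ℕ) :
    ∫ x, (‖x‖ ^ 2) ^ n ∂diskMeasure = Real.pi / (n + 1) := by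
  have h := integral_disk_radial (F := fun s => ((s ^ n : ℝ) : ℂ)) (by fun_prop)
  rw [intervalIntegral.integral_ofReal, integral_pow] at h
  have h' : ((∫ x, (‖x‖ ^ 2) ^ n ∂diskMeasure : ℝ) : ℂ) = ((Real.pi / (n + 1) : ℝ) : ℂ) := by
    rw [← integral_complex_ofReal, h]
    push_cast
    simp
    ring
  exact_mod_cast h'

theorem integral_disk_pos {f : Plane → ℝ} (hf : Continuous f) (h0 : ∀ x, 0 ≤ f x)
    {x : Plane} (hx : x ∈ unitDisk) (hfx : f x ≠ 0) : 0 < ∫ x, f x ∂diskMeasure := by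
  have hi : Integrable f diskMeasure := (memLp_disk hf).integrable (by norm_num)
  rw [integral_pos_iff_support_of_nonneg h0 hi, diskMeasure,
    Measure.restrict_apply' (s := unitDisk) Metric.isOpen_ball.measurableSet]
  exact (hf.isOpen_support.inter Metric.isOpen_ball).measure_pos _ ⟨x, hfx, hx⟩

theorem besselE_zero (n : ℕ) : besselE n 0 = 1 / (n.factorial : ℂ) := by
  rw [besselE, tsum_eq_single 0]
  · simp
  · intro k hk
    simp [hk]

/-- The profile takes the value `(κ/2)ⁿ/n! ≠ 0` at the origin, so the wave does not vanish at small
positive points of the first axis. -/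
theorem exists_circularWave_ne_zero {κ : ℝ} (hκ : 0 < κ) (p : ℤ) {δ : ℝ} (hδ : 0 < δ) :
    ∃ x : Plane, ‖x‖ < δ ∧ circularWave κ p x ≠ 0 := by
  have key (n : ℕ) : ∃ x : Plane, ‖x‖ < δ ∧ circularWave κ n x ≠ 0 := by
    have h0 : profile κ n 0 ≠ 0 := by
      have : (κ : ℂ) ≠ 0 := by exact_mod_cast hκ.ne'
      simp [profile, besselE_zero, this, Nat.factorial_ne_zero]
    have hc : Filter.Tendsto (fun t : ℝ => profile κ n (t ^ 2)) (nhds 0)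
        (nhds (profile κ n 0)) := by
      have : Continuous fun t : ℝ => profile κ n (t ^ 2) :=
        (contDiff_profile κ n).continuous.comp (by fun_prop)
      simpa using this.tendsto 0
    have h1 := (hc.eventually_ne h0).filter_mono (nhdsWithin_le_nhds (s := Set.Ioi 0))
    obtain ⟨t, ht, ht', ht''⟩ := (h1.and (Ioo_mem_nhdsGT hδ)).exists
    refine ⟨EuclideanSpace.single 0 t, by simpa [abs_of_pos ht'] using ht'', ?_⟩
    rw [circularWave_natCast]
    simp only [PiLp.norm_single, Real.norm_eq_abs, sq_abs]
    refine mul_ne_zero ht (pow_ne_zero _ ?_)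
    simp [toComplex, ht'.ne']
  obtain ⟨n, rfl | rfl⟩ := p.eq_nat_or_neg
  · exact key n
  · obtain ⟨x, hx, hx'⟩ := key n
    refine ⟨x, hx, ?_⟩
    rw [circularWave_neg]
    simpa using hx'

/-! ### Orthogonality of the circular waves -/

theorem continuous_circularWave (κ : ℝ) (p : ℤ) : Continuous (circularWave κ p) :=
  (contDiff_circularWave κ p).continuous

theorem memLp_conj_circularWave (κ : ℝ) (p : ℤ) :
    MemLp (fun x => (starRingEnd ℂ) (circularWave κ p x)) 2 diskMeasure :=
  memLp_disk (contDiff_conj.continuous.comp (continuous_circularWave κ p))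

/-- The operator `(u, g) ↦ g₀ - i g₁`. -/
def lowerL : L2Pair →L[ℂ] Lp ℂ 2 diskMeasure := sndL 0 - Complex.I • sndL 1

/-- The operator `(u, g) ↦ g₀ + i g₁`. -/
def raiseL : L2Pair →L[ℂ] Lp ℂ 2 diskMeasure := sndL 0 + Complex.I • sndL 1

theorem lowerL_ae (U : L2Pair) :
    lowerL U =ᵐ[diskMeasure] fun x => U.snd x 0 - Complex.I * U.snd x 1 := by
  have : lowerL U = sndL 0 U - Complex.I • sndL 1 U := rfl
  rw [this]
  filter_upwards [Lp.coeFn_sub (sndL 0 U) (Complex.I • sndL 1 U),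
    Lp.coeFn_smul Complex.I (sndL 1 U), sndL_ae 0 U, sndL_ae 1 U] with x h1 h2 h3 h4
  rw [h1, Pi.sub_apply, h2, Pi.smul_apply, h3, h4, smul_eq_mul]

theorem raiseL_ae (U : L2Pair) :
    raiseL U =ᵐ[diskMeasure] fun x => U.snd x 0 + Complex.I * U.snd x 1 := by
  have : raiseL U = sndL 0 U + Complex.I • sndL 1 U := rfl
  rw [this]
  filter_upwards [Lp.coeFn_add (sndL 0 U) (Complex.I • sndL 1 U),
    Lp.coeFn_smul Complex.I (sndL 1 U), sndL_ae 0 U, sndL_ae 1 U] with x h1 h2 h3 h4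
  rw [h1, Pi.add_apply, h2, Pi.smul_apply, h3, h4, smul_eq_mul]

theorem bTilde_fst_ae {κ : ℝ} (hκ : 0 < κ) (p : ℤ) :
    (bTilde hκ p : L2Pair).fst =ᵐ[diskMeasure] circularWave κ p :=
  (memLp_disk (continuous_circularWave κ p)).coeFn_toLp

theorem bTilde_snd_ae {κ : ℝ} (hκ : 0 < κ) (p : ℤ) :
    (bTilde hκ p : L2Pair).snd =ᵐ[diskMeasure]
      fun x => (κ : ℂ)⁻¹ • grad (circularWave κ p) x :=
  (memLp_disk ((continuous_grad ((contDiff_circularWave κ p).of_le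
    (by exact_mod_cast le_top))).const_smul (κ : ℂ)⁻¹)).coeFn_toLp

theorem bTilde_snd_coord_ae {κ : ℝ} (hκ : 0 < κ) (p : ℤ) :
    ∀ᵐ x ∂diskMeasure, (bTilde hκ p : L2Pair).snd x 0 =
        (circularWave κ (p - 1) x - circularWave κ (p + 1) x) / 2 ∧
      (bTilde hκ p : L2Pair).snd x 1 =
        Complex.I * (circularWave κ (p - 1) x + circularWave κ (p + 1) x) / 2 := by
  have hk : (κ : ℂ) ≠ 0 := by exact_mod_cast hκ.ne'
  filter_upwards [bTilde_snd_ae hκ p] with x hx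
  have h1 := (wirtP_circularWave κ p x).1
  have h2 := (wirtP_circularWave κ p x).2
  rw [wirtP] at h1
  rw [wirtM] at h2
  rw [hx]
  simp only [grad, PiLp.smul_apply, smul_eq_mul]
  constructor
  · field_simp
    linear_combination h1 + h2
  · field_simp
    linear_combination (-Complex.I) * (h1 - h2) +
      2 * partialDeriv 1 (circularWave κ p) x * Complex.I_sq

/-- In the combinations `g₀ ∓ i g₁` the inner product of gradients is half the sum of two scalar
products, and the ladder relations identify these combinations for `b̃_p` with `b̃_{p-1}` and
`-b̃_{p+1}`. The formula holds for every `V`, whether or not it solves the equation, and serves both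
orthogonality and completeness. -/
theorem inner_bTilde {κ : ℝ} (hκ : 0 < κ) (p : ℤ) (V : H1 κ) :
    inner ℂ (bTilde hκ p) V = pairing _ (memLp_conj_circularWave κ p) (fstL V) +
      (1 / 2) * pairing _ (memLp_conj_circularWave κ (p - 1)) (lowerL V) -
      (1 / 2) * pairing _ (memLp_conj_circularWave κ (p + 1)) (raiseL V) := by
  have hi (q : ℤ) (f : Lp ℂ 2 diskMeasure) :
      Integrable (fun x => f x * (starRingEnd ℂ) (circularWave κ q x)) diskMeasure :=
    (Lp.memLp f).integrable_mul (memLp_conj_circularWave κ q)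
  rw [Submodule.coe_inner, WithLp.prod_inner_apply, L2.inner_def, L2.inner_def, add_sub_assoc]
  congr 1
  · rw [pairing_apply, fstL_apply]
    refine integral_congr_ae ?_
    filter_upwards [bTilde_fst_ae hκ p] with x hx
    refine (RCLike.inner_apply' _ _).trans ((mul_comm _ _).trans ?_)
    exact congrArg (fun z => (V : L2Pair).fst x * (starRingEnd ℂ) z) hx
  · rw [pairing_apply, pairing_apply, ← integral_const_mul, ← integral_const_mul,
      ← integral_sub ((hi _ _).const_mul _) ((hi _ _).const_mul _)]
    refine integral_congr_ae ?_
    filter_upwards [bTilde_snd_coord_ae hκ p, lowerL_ae V, raiseL_ae V] with x h1 h2 h3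
    have h4 : (starRingEnd ℂ) 2 = 2 := Complex.conj_ofNat 2
    rw [h2, h3]
    refine (PiLp.inner_apply _ _).trans ?_
    rw [Fin.sum_univ_two]
    refine (congrArg₂ (· + ·) (RCLike.inner_apply' _ _) (RCLike.inner_apply' _ _)).trans ?_
    rw [show ((bTilde hκ p : L2Pair).ofLp.2 x).ofLp 0 = _ from h1.1,
      show ((bTilde hκ p : L2Pair).ofLp.2 x).ofLp 1 = _ from h1.2]
    simp only [map_div₀, map_sub, map_add, map_mul, Complex.conj_I, h4]
    simp only [WithLp.snd]
    ring

theorem lowerL_bTilde {κ : ℝ} (hκ : 0 < κ) (p : ℤ) :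
    lowerL (bTilde hκ p : L2Pair) =ᵐ[diskMeasure] circularWave κ (p - 1) := by
  filter_upwards [lowerL_ae (bTilde hκ p : L2Pair), bTilde_snd_coord_ae hκ p] with x h1 h2
  rw [h1, h2.1, h2.2]
  linear_combination (-(circularWave κ (p - 1) x + circularWave κ (p + 1) x) / 2) * Complex.I_sq

theorem raiseL_bTilde {κ : ℝ} (hκ : 0 < κ) (p : ℤ) :
    raiseL (bTilde hκ p : L2Pair) =ᵐ[diskMeasure] fun x => -circularWave κ (p + 1) x := by
  filter_upwards [raiseL_ae (bTilde hκ p : L2Pair), bTilde_snd_coord_ae hκ p] with x h1 h2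
  rw [h1, h2.1, h2.2]
  linear_combination ((circularWave κ (p - 1) x + circularWave κ (p + 1) x) / 2) * Complex.I_sq

/-- The squared `L²` norm of a circular wave. -/
def waveNormSq (κ : ℝ) (p : ℤ) : ℝ := ∫ x, ‖circularWave κ p x‖ ^ 2 ∂diskMeasure

theorem waveNormSq_pos {κ : ℝ} (hκ : 0 < κ) (p : ℤ) : 0 < waveNormSq κ p := by
  obtain ⟨x, hx, hx'⟩ := exists_circularWave_ne_zero hκ p zero_lt_one
  exact integral_disk_pos ((continuous_circularWave κ p).norm.pow 2) (fun _ => by positivity)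
    (by simpa [unitDisk] using hx) (by simpa using hx')

theorem integral_wave_mul_conj (κ : ℝ) (p q : ℤ) :
    ∫ x, circularWave κ q x * (starRingEnd ℂ) (circularWave κ p x) ∂diskMeasure =
      if p = q then (waveNormSq κ p : ℂ) else 0 := by
  split_ifs with h
  · subst h
    rw [waveNormSq, ← integral_complex_ofReal]
    refine integral_congr_ae (Filter.Eventually.of_forall fun x => ?_)
    simp only
    rw [Complex.mul_conj, Complex.normSq_eq_norm_sq]
  · refine IsEquivariant.integral_eq_zero (p := q + -p) (by omega) ?_
    exact (isMode_circularWave κ q).isEquivariant.mul (isMode_circularWave κ p).conj.isEquivariant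

/-- Raising and lowering shift both indices equally, so each of the three pairings is diagonal. -/
theorem inner_bTilde_bTilde {κ : ℝ} (hκ : 0 < κ) (p q : ℤ) :
    inner ℂ (bTilde hκ p) (bTilde hκ q) = if p = q then
      ((waveNormSq κ p + (waveNormSq κ (p - 1) + waveNormSq κ (p + 1)) / 2 : ℝ) : ℂ) else 0 := by
  have e0 : pairing _ (memLp_conj_circularWave κ p) (fstL (bTilde hκ q)) =
      if p = q then (waveNormSq κ p : ℂ) else 0 := by
    rw [pairing_apply, ← integral_wave_mul_conj]
    refine integral_congr_ae ?_
    filter_upwards [bTilde_fst_ae hκ q] with x hx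
    rw [fstL_apply, hx]
  have e1 : pairing _ (memLp_conj_circularWave κ (p - 1)) (lowerL (bTilde hκ q)) =
      if p = q then (waveNormSq κ (p - 1) : ℂ) else 0 := by
    have := integral_wave_mul_conj κ (p - 1) (q - 1)
    simp only [sub_left_inj] at this
    rw [pairing_apply, ← this]
    refine integral_congr_ae ?_
    filter_upwards [lowerL_bTilde hκ q] with x hx
    rw [hx]
  have e2 : pairing _ (memLp_conj_circularWave κ (p + 1)) (raiseL (bTilde hκ q)) =
      -if p = q then (waveNormSq κ (p + 1) : ℂ) else 0 := by
    have := integral_wave_mul_conj κ (p + 1) (q + 1)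
    simp only [add_left_inj] at this
    rw [pairing_apply, ← this, ← integral_neg]
    refine integral_congr_ae ?_
    filter_upwards [raiseL_bTilde hκ q] with x hx
    rw [hx, neg_mul]
  rw [inner_bTilde, e0, e1, e2]
  split_ifs
  · push_cast
    ring
  · simp

theorem norm_bTilde_sq {κ : ℝ} (hκ : 0 < κ) (p : ℤ) : ‖bTilde hκ p‖ ^ 2 =
    waveNormSq κ p + (waveNormSq κ (p - 1) + waveNormSq κ (p + 1)) / 2 := by
  have h := inner_self_eq_norm_sq_to_K (𝕜 := ℂ) (bTilde hκ p)
  rw [inner_bTilde_bTilde, if_pos rfl] at h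
  exact Complex.ofReal_injective ((Complex.ofReal_pow _ _).trans h.symm)

theorem norm_bTilde_pos {κ : ℝ} (hκ : 0 < κ) (p : ℤ) : 0 < ‖bTilde hκ p‖ := by
  have := norm_bTilde_sq hκ p
  have h1 := waveNormSq_pos hκ p
  have h2 := waveNormSq_pos hκ (p - 1)
  have h3 := waveNormSq_pos hκ (p + 1)
  refine (norm_nonneg _).lt_of_ne fun h => ?_
  rw [← h] at this
  nlinarith

theorem orthonormal_b {κ : ℝ} (hκ : 0 < κ) : Orthonormal ℂ (b hκ) := by
  rw [orthonormal_iff_ite]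
  intro p q
  have h0 : inner ℂ (b hκ p) (b hκ q) =
      (beta hκ p : ℂ) * ((beta hκ q : ℂ) * inner ℂ (bTilde hκ p) (bTilde hκ q)) := by
    refine (inner_smul_left (𝕜 := ℂ) (bTilde hκ p) ((beta hκ q : ℂ) • bTilde hκ q) _).trans ?_
    exact congrArg₂ (· * ·) (Complex.conj_ofReal _) 
      (inner_smul_right (𝕜 := ℂ) (bTilde hκ p) (bTilde hκ q) _)
  rw [h0, inner_bTilde_bTilde]
  split_ifs with h
  · subst h
    rw [← norm_bTilde_sq hκ, beta]
    have := (norm_bTilde_pos hκ p).ne'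
    norm_cast
    field_simp
  · simp

/-! ### Integrals over the cylinder -/

/-- The squared weight, as a function of `ζ`. -/
def weightSq (κ t : ℝ) : ℝ := Real.exp (-κ * Real.sinh |t| + |t| / 4) ^ 2

theorem restrict_cylinder : (volume.restrict cylinder : Measure (ℝ × ℝ)) =
    (volume.restrict (Set.Ico 0 (2 * Real.pi))).prod volume := by
  rw [cylinder, Measure.volume_eq_prod, ← Measure.prod_restrict, Measure.restrict_univ]

theorem measurable_weight_sq (κ : ℝ) :
    Measurable fun y : ℝ × ℝ => ENNReal.ofReal (weight κ y ^ 2) :=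
  ((continuous_weight κ).pow 2).measurable.ennreal_ofReal

theorem integrable_weighted_iff {F : Type*} [NormedAddCommGroup F] [NormedSpace ℝ F] (κ : ℝ)
    (f : ℝ × ℝ → F) : Integrable f (weightedMeasure κ) ↔
      Integrable (fun y => weight κ y ^ 2 • f y) (volume.restrict cylinder) := by
  rw [weightedMeasure, integrable_withDensity_iff_integrable_smul' (measurable_weight_sq κ)
    (Filter.Eventually.of_forall fun _ => ENNReal.ofReal_lt_top)]
  simp only [ENNReal.toReal_ofReal (sq_nonneg _)]

theorem integral_weighted (κ : ℝ) (f : ℝ × ℝ → ℂ) :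
    ∫ y, f y ∂(weightedMeasure κ) = ∫ y in cylinder, f y * ((weight κ y ^ 2 : ℝ) : ℂ) := by
  rw [weightedMeasure, integral_withDensity_eq_integral_toReal_smul (measurable_weight_sq κ)
    (Filter.Eventually.of_forall fun _ => ENNReal.ofReal_lt_top)]
  simp only [ENNReal.toReal_ofReal (sq_nonneg _), Complex.real_smul, mul_comm]

/-- The angle is integrated first, at fixed `ζ`: this is where Fourier orthogonality and the
Jacobi–Anger expansion act, since the weight does not depend on `φ`. -/
theorem integral_weighted_iterated {κ : ℝ} {f : ℝ × ℝ → ℂ}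
    (hf : Integrable f (weightedMeasure κ)) :
    ∫ y, f y ∂(weightedMeasure κ) =
      ∫ t : ℝ, (∫ φ in (0 : ℝ)..2 * Real.pi, f (φ, t)) * (weightSq κ t : ℂ) := by
  rw [integrable_weighted_iff, restrict_cylinder] at hf
  have h : ∀ y, weight κ y ^ 2 • f y = f y * ((weight κ y ^ 2 : ℝ) : ℂ) := fun y => by
    rw [Complex.real_smul, mul_comm]
  simp only [h] at hf
  rw [integral_weighted, restrict_cylinder, integral_prod_symm _ hf]
  refine integral_congr_ae (Filter.Eventually.of_forall fun t => ?_)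
  simp only
  rw [intervalIntegral.integral_of_le (by positivity), integral_Ioc_eq_integral_Ioo,
    ← integral_Ico_eq_integral_Ioo, ← integral_mul_const]
  rfl

theorem integral_exp_int (n : ℤ) :
    ∫ φ in (0 : ℝ)..2 * Real.pi, Complex.exp (Complex.I * n * φ) =
      if n = 0 then (2 * Real.pi : ℂ) else 0 := by
  split_ifs with h
  · subst h
    simp
  · have h0 : (n : ℂ) ≠ 0 := by exact_mod_cast h
    rw [integral_exp_mul_complex (mul_ne_zero Complex.I_ne_zero h0)]
    have : Complex.I * n * ((2 * Real.pi : ℝ) : ℂ) = n * (2 * Real.pi * Complex.I) := by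
      push_cast
      ring
    rw [this, Complex.exp_int_mul_two_pi_mul_I]
    simp

/-- The integral `∫ e^{2pζ} w² dζ`. -/
def modeNormSq (κ : ℝ) (p : ℤ) : ℝ := ∫ t : ℝ, weightSq κ t * Real.exp (p * t) ^ 2

theorem modeNormSq_pos {κ : ℝ} (hκ : 0 < κ) (p : ℤ) : 0 < modeNormSq κ p := by
  refine (integral_pos_iff_support_of_nonneg (fun t => ?_) (integrable_mode_weight hκ p)).2 ?_
  · positivity
  · have : (Function.support fun t : ℝ =>
        Real.exp (-κ * Real.sinh |t| + |t| / 4) ^ 2 * Real.exp (p * t) ^ 2) = Set.univ := by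
      refine Set.eq_univ_of_forall fun t => ?_
      have : 0 < Real.exp (-κ * Real.sinh |t| + |t| / 4) ^ 2 * Real.exp (p * t) ^ 2 := by
        positivity
      exact this.ne'
    rw [this]
    simp

theorem conj_herglotzMode (p : ℤ) (y : ℝ × ℝ) : (starRingEnd ℂ) (herglotzMode p y) =
    Complex.exp (p * y.2) * Complex.exp (-(Complex.I * p * y.1)) := by
  rw [herglotzMode, map_mul, ← Complex.exp_conj, ← Complex.exp_conj]
  simp

theorem aTilde_ae {κ : ℝ} (hκ : 0 < κ) (p : ℤ) :
    aTilde hκ p =ᵐ[weightedMeasure κ] herglotzMode p :=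
  (memLp_herglotzMode hκ p).coeFn_toLp

theorem inner_aTilde {κ : ℝ} (hκ : 0 < κ) (p q : ℤ) :
    inner ℂ (aTilde hκ p) (aTilde hκ q) =
      if p = q then ((2 * Real.pi * modeNormSq κ p : ℝ) : ℂ) else 0 := by
  have h1 : inner ℂ (aTilde hκ p) (aTilde hκ q) =
      ∫ y, (starRingEnd ℂ) (herglotzMode p y) * herglotzMode q y ∂(weightedMeasure κ) := by
    rw [L2.inner_def]
    refine integral_congr_ae ?_
    filter_upwards [aTilde_ae hκ p, aTilde_ae hκ q] with y h1 h2
    rw [h1, h2, RCLike.inner_apply']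
  have hi : Integrable (fun y => (starRingEnd ℂ) (herglotzMode p y) * herglotzMode q y)
      (weightedMeasure κ) :=
    (memLp_herglotzMode hκ p).star.integrable_mul (memLp_herglotzMode hκ q)
  rw [h1, integral_weighted_iterated hi]
  have h2 : ∀ t : ℝ, ∫ φ in (0 : ℝ)..2 * Real.pi,
      (starRingEnd ℂ) (herglotzMode p (φ, t)) * herglotzMode q (φ, t) =
      Complex.exp ((p + q) * t) * if q - p = 0 then (2 * Real.pi : ℂ) else 0 := fun t => by
    rw [← integral_exp_int, ← intervalIntegral.integral_const_mul]
    refine intervalIntegral.integral_congr fun φ _ => ?_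
    rw [conj_herglotzMode, herglotzMode, ← Complex.exp_add, ← Complex.exp_add, ← Complex.exp_add,
      ← Complex.exp_add]
    congr 1
    push_cast
    ring
  rw [integral_congr_ae (Filter.Eventually.of_forall fun t => congrArg (· * _) (h2 t))]
  split_ifs with h3 h4 h4
  · subst h4
    rw [modeNormSq]
    push_cast
    rw [← integral_complex_ofReal, ← integral_const_mul]
    refine integral_congr_ae (Filter.Eventually.of_forall fun t => ?_)
    push_cast
    rw [← Complex.exp_nat_mul]
    push_cast
    ring_nf
  · omega
  · omega
  · simp

theorem norm_aTilde_sq {κ : ℝ} (hκ : 0 < κ) (p : ℤ) :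
    ‖aTilde hκ p‖ ^ 2 = 2 * Real.pi * modeNormSq κ p := by
  have h := inner_self_eq_norm_sq_to_K (𝕜 := ℂ) (aTilde hκ p)
  rw [inner_aTilde, if_pos rfl] at h
  exact Complex.ofReal_injective ((Complex.ofReal_pow _ _).trans h.symm)

theorem norm_aTilde_pos {κ : ℝ} (hκ : 0 < κ) (p : ℤ) : 0 < ‖aTilde hκ p‖ := by
  have h := norm_aTilde_sq hκ p
  have h1 : 0 < 2 * Real.pi * modeNormSq κ p := mul_pos (by positivity) (modeNormSq_pos hκ p)
  refine (norm_nonneg _).lt_of_ne fun h' => ?_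
  rw [← h'] at h
  linarith

theorem orthonormal_a {κ : ℝ} (hκ : 0 < κ) : Orthonormal ℂ (a hκ) := by
  rw [orthonormal_iff_ite]
  intro p q
  have h0 : inner ℂ (a hκ p) (a hκ q) =
      (alpha hκ p : ℂ) * ((alpha hκ q : ℂ) * inner ℂ (aTilde hκ p) (aTilde hκ q)) := by
    refine (inner_smul_left (𝕜 := ℂ) (aTilde hκ p) ((alpha hκ q : ℂ) • aTilde hκ q) _).trans ?_
    exact congrArg₂ (· * ·) (Complex.conj_ofReal _)
      (inner_smul_right (𝕜 := ℂ) (aTilde hκ p) (aTilde hκ q) _)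
  rw [h0, inner_aTilde]
  split_ifs with h
  · subst h
    rw [← norm_aTilde_sq hκ, alpha]
    have := (norm_aTilde_pos hκ p).ne'
    norm_cast
    field_simp
  · simp

/-! ### Evanescent plane waves -/

/-- Writing `cos` and `sin` as exponentials gives the shape `exp(A e^{-iφ}) exp(B e^{iφ})` of the
Bessel generating function, with `A = iκ z e^ζ / 2` and `B = iκ z̄ e^{-ζ} / 2`. -/
theorem evanescentWave_eq (κ : ℝ) (y : ℝ × ℝ) (x : Plane) : evanescentWave κ y x =
    Complex.exp (Complex.I * (κ / 2) * toComplex x * Complex.exp y.2 *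
      Complex.exp (-(Complex.I * y.1))) *
    Complex.exp (Complex.I * (κ / 2) * (starRingEnd ℂ) (toComplex x) * Complex.exp (-y.2) *
      Complex.exp (Complex.I * y.1)) := by
  rw [evanescentWave, ← Complex.exp_add]
  congr 1
  have h3 : (starRingEnd ℂ) (toComplex x) = x 0 - x 1 * Complex.I := by simp [toComplex]; ring
  have e1 : Complex.exp ((y.1 + Complex.I * y.2) * Complex.I) =
      Complex.exp (-y.2) * Complex.exp (Complex.I * y.1) := by
    rw [← Complex.exp_add]
    congr 1
    linear_combination (y.2 : ℂ) * Complex.I_sq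
  have e2 : Complex.exp (-(y.1 + Complex.I * y.2) * Complex.I) =
      Complex.exp y.2 * Complex.exp (-(Complex.I * y.1)) := by
    rw [← Complex.exp_add]
    congr 1
    linear_combination (-(y.2 : ℂ)) * Complex.I_sq
  rw [Complex.cos, Complex.sin, e1, e2, h3, toComplex]
  ring_nf

/-- The exponent is `α q - β q̄` with `α`, `β` real and `|q| = |x|`, so its real part is `(α - β) Re
q = κ sinh ζ · Re q`. -/
theorem norm_evanescentWave_le {κ : ℝ} (hκ : 0 < κ) (y : ℝ × ℝ) (x : Plane) :
    ‖evanescentWave κ y x‖ ≤ Real.exp (κ * ‖x‖ * Real.sinh |y.2|) := by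
  set q : ℂ := Complex.I * toComplex x * Complex.exp (-(Complex.I * y.1)) with hq
  have hqc : (starRingEnd ℂ) q = -(Complex.I * (starRingEnd ℂ) (toComplex x) *
      Complex.exp (Complex.I * y.1)) := by
    rw [hq, map_mul, map_mul, ← Complex.exp_conj]
    simp
  have hqn : ‖q‖ = ‖x‖ := by
    rw [hq, norm_mul, norm_mul, norm_toComplex, Complex.norm_exp]
    simp
  have h1 : evanescentWave κ y x = Complex.exp (((κ / 2 * Real.exp y.2 : ℝ) : ℂ) * q -
      ((κ / 2 * Real.exp (-y.2) : ℝ) : ℂ) * (starRingEnd ℂ) q) := by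
    rw [evanescentWave_eq, ← Complex.exp_add, hqc, hq]
    congr 1
    push_cast
    ring
  rw [h1, Complex.norm_exp, Real.exp_le_exp, Complex.sub_re, Complex.re_ofReal_mul,
    Complex.re_ofReal_mul, Complex.conj_re]
  have h2 : κ / 2 * Real.exp y.2 * q.re - κ / 2 * Real.exp (-y.2) * q.re =
      κ * (Real.sinh y.2 * q.re) := by
    rw [Real.sinh_eq]
    ring
  rw [h2, mul_assoc]
  refine mul_le_mul_of_nonneg_left ?_ hκ.le
  calc Real.sinh y.2 * q.re ≤ |Real.sinh y.2| * |q.re| := by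
        rw [← abs_mul]
        exact le_abs_self _
    _ ≤ Real.sinh |y.2| * ‖x‖ := by
        rw [← hqn, Real.abs_sinh]
        gcongr
        exact Complex.abs_re_le_norm q
    _ = _ := mul_comm _ _

theorem continuous_evanescentWave (κ : ℝ) (x : Plane) :
    Continuous fun y => evanescentWave κ y x := by
  unfold evanescentWave
  have h : Continuous fun y : ℝ × ℝ => ((y.1 : ℂ) + Complex.I * y.2) := by fun_prop
  exact Complex.continuous_exp.comp (continuous_const.mul
    (((Complex.continuous_cos.comp h).mul continuous_const).add
      ((Complex.continuous_sin.comp h).mul continuous_const)))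

/-- The wave grows at most like `e^{κ|x| sinh|ζ|}`, which the weight beats for `|x| < 1`. What
remains is the integral of the zeroth mode with `κ` replaced by `κ(1 - |x|)`. -/
theorem memLp_evanescentWave {κ : ℝ} (hκ : 0 < κ) {x : Plane} (hx : x ∈ unitDisk) :
    MemLp (fun y => evanescentWave κ y x) 2 (weightedMeasure κ) := by
  have hx1 : ‖x‖ < 1 := mem_ball_zero_iff.1 hx
  have hκ' : 0 < κ * (1 - ‖x‖) := mul_pos hκ (by linarith)
  rw [memLp_two_iff_integrable_sq_norm (continuous_evanescentWave κ x).aestronglyMeasurable,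
    integrable_weighted_iff, restrict_cylinder]
  have h1 : Integrable (fun _ : ℝ => (1 : ℝ))
      (volume.restrict (Set.Ico 0 (2 * Real.pi))) := integrableOn_const measure_Ico_lt_top.ne
  refine (h1.mul_prod (integrable_mode_weight hκ' 0)).mono' ?_
    (Filter.Eventually.of_forall fun y => ?_)
  · exact (((continuous_weight κ).pow 2).smul
      ((continuous_evanescentWave κ x).norm.pow 2)).aestronglyMeasurable
  · have h2 := norm_evanescentWave_le hκ y x
    rw [Real.norm_of_nonneg (by positivity), smul_eq_mul, weight]
    calc _ ≤ Real.exp (-κ * Real.sinh |y.2| + |y.2| / 4) ^ 2 *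
          Real.exp (κ * ‖x‖ * Real.sinh |y.2|) ^ 2 := by gcongr
      _ = _ := by
          simp only [← Real.exp_nat_mul, ← Real.exp_add]
          simp
          ring

/-! ### The Jacobi–Anger expansion -/

theorem hasSum_exp_series (A : ℂ) :
    HasSum (fun n : ℕ => A ^ n / (n.factorial : ℂ)) (Complex.exp A) := by
  rw [Complex.exp_eq_exp_ℂ]
  exact NormedSpace.expSeries_div_hasSum_exp A

/-- Both exponentials are expanded and the double series is integrated term by term. The angular
factors are unimodular, so the dominating series does not depend on `φ`. -/
theorem hasSum_jacobiAnger (A B : ℂ) (p : ℤ) :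
    HasSum (fun i : ℕ × ℕ => A ^ i.1 / (i.1.factorial : ℂ) * (B ^ i.2 / (i.2.factorial : ℂ)) *
        if p - i.1 + i.2 = 0 then (2 * Real.pi : ℂ) else 0)
      (∫ φ in (0 : ℝ)..2 * Real.pi, Complex.exp (Complex.I * p * φ) *
        (Complex.exp (A * Complex.exp (-(Complex.I * φ))) *
          Complex.exp (B * Complex.exp (Complex.I * φ)))) := by
  have hs (C : ℂ) : Summable fun n : ℕ => ‖C ^ n / (n.factorial : ℂ)‖ := by
    refine (Real.summable_pow_div_factorial ‖C‖).congr fun n => ?_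
    simp
  have hb : Summable fun i : ℕ × ℕ =>
      ‖A ^ i.1 / (i.1.factorial : ℂ)‖ * ‖B ^ i.2 / (i.2.factorial : ℂ)‖ :=
    (hs A).mul_of_nonneg (hs B) (fun _ => norm_nonneg _) (fun _ => norm_nonneg _)
  have he1 (φ : ℝ) : ‖Complex.exp (Complex.I * φ)‖ = 1 := by
    rw [mul_comm, Complex.norm_exp_ofReal_mul_I]
  have he2 (φ : ℝ) : ‖Complex.exp (-(Complex.I * φ))‖ = 1 := by
    rw [Complex.norm_exp]
    simp
  have he3 (φ : ℝ) : ‖Complex.exp (Complex.I * p * φ)‖ = 1 := by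
    rw [Complex.norm_exp]
    simp
  have key := intervalIntegral.hasSum_integral_of_dominated_convergence (μ := volume)
    (a := 0) (b := 2 * Real.pi)
    (F := fun (i : ℕ × ℕ) (φ : ℝ) => Complex.exp (Complex.I * p * φ) *
      ((A * Complex.exp (-(Complex.I * φ))) ^ i.1 / (i.1.factorial : ℂ) *
        ((B * Complex.exp (Complex.I * φ)) ^ i.2 / (i.2.factorial : ℂ))))
    (f := fun φ : ℝ => Complex.exp (Complex.I * p * φ) *
        (Complex.exp (A * Complex.exp (-(Complex.I * φ))) *
          Complex.exp (B * Complex.exp (Complex.I * φ))))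
    (fun i _ => ‖A ^ i.1 / (i.1.factorial : ℂ)‖ * ‖B ^ i.2 / (i.2.factorial : ℂ)‖)
    (fun i => Continuous.aestronglyMeasurable (by fun_prop))
    (fun i => Filter.Eventually.of_forall fun φ _ => ?_)
    (Filter.Eventually.of_forall fun φ _ => hb)
    intervalIntegrable_const
    (Filter.Eventually.of_forall fun φ _ => ?_)
  · convert! key using 1
    funext i
    have : ∀ φ : ℝ, Complex.exp (Complex.I * p * φ) *
      ((A * Complex.exp (-(Complex.I * φ))) ^ i.1 / (i.1.factorial : ℂ) *
        ((B * Complex.exp (Complex.I * φ)) ^ i.2 / (i.2.factorial : ℂ))) =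
        A ^ i.1 / (i.1.factorial : ℂ) * (B ^ i.2 / (i.2.factorial : ℂ)) *
          Complex.exp (Complex.I * ((p - i.1 + i.2 : ℤ) : ℂ) * φ) := fun φ => by
      have : Complex.exp (Complex.I * ((p - i.1 + i.2 : ℤ) : ℂ) * φ) =
          Complex.exp (Complex.I * p * φ) * (Complex.exp (-(Complex.I * φ)) ^ i.1 *
            Complex.exp (Complex.I * φ) ^ i.2) := by
        rw [← Complex.exp_nat_mul, ← Complex.exp_nat_mul, ← Complex.exp_add, ← Complex.exp_add]
        congr 1
        push_cast
        ring
      rw [this, mul_pow, mul_pow]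
      ring
    simp only [this]
    rw [intervalIntegral.integral_const_mul, integral_exp_int]
  · rw [norm_mul, he3, one_mul, norm_mul, norm_div, norm_div, norm_div, norm_div, norm_pow,
      norm_pow, norm_pow, norm_pow, norm_mul, norm_mul, he1, he2, mul_one, mul_one]
  · have h1 := hs (A * Complex.exp (-(Complex.I * φ)))
    have h2 := hs (B * Complex.exp (Complex.I * φ))
    have h3 := summable_mul_of_summable_norm h1 h2
    exact ((hasSum_exp_series _).mul (hasSum_exp_series _) h3).mul_left _

theorem jacobiAnger_natCast (A B : ℂ) (n : ℕ) :
    ∫ φ in (0 : ℝ)..2 * Real.pi, Complex.exp (Complex.I * (n : ℤ) * φ) *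
        (Complex.exp (A * Complex.exp (-(Complex.I * φ))) *
          Complex.exp (B * Complex.exp (Complex.I * φ))) =
      2 * Real.pi * (A ^ n * besselE n (-(A * B))) := by
  have h := hasSum_jacobiAnger A B n
  -- The surviving pairs satisfy `i.1 = n + i.2`. Along them the double series is `Aⁿ` times the
  -- series of `besselE n` at `-AB`.
  have hinj : Function.Injective fun k : ℕ => (n + k, k) := fun k l hkl => (Prod.ext_iff.1 hkl).2
  rw [← hinj.hasSum_iff] at h
  · refine h.unique ?_
    rw [← mul_assoc]
    have := (hasSum_besselE n (-(A * B))).mul_left (2 * Real.pi * A ^ n)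
    convert! this using 1
    funext k
    have e : (n : ℤ) - ((n + k : ℕ) : ℤ) + k = 0 := by push_cast; ring
    have : (-1 : ℂ) ^ k * (-1) ^ k = 1 := by rw [← mul_pow]; simp
    simp only [Function.comp_apply, e, if_true]
    rw [neg_pow (A * B), mul_pow, pow_add]
    have : (k.factorial : ℂ) ≠ 0 := by exact_mod_cast Nat.factorial_ne_zero _
    have : ((n + k).factorial : ℂ) ≠ 0 := by exact_mod_cast Nat.factorial_ne_zero _
    field_simp
    simp [← pow_mul]
  · rintro ⟨m, l⟩ hml
    have : ¬ ((n : ℤ) - m + l = 0) := fun h0 => hml ⟨l, by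
      simp only [Prod.mk.injEq, and_true]
      omega⟩
    simp [this]

theorem jacobiAnger_neg (A B : ℂ) (n : ℕ) :
    ∫ φ in (0 : ℝ)..2 * Real.pi, Complex.exp (Complex.I * (-(n : ℤ) : ℤ) * φ) *
        (Complex.exp (A * Complex.exp (-(Complex.I * φ))) *
          Complex.exp (B * Complex.exp (Complex.I * φ))) =
      2 * Real.pi * (B ^ n * besselE n (-(A * B))) := by
  have h := hasSum_jacobiAnger A B (-(n : ℤ))
  have hinj : Function.Injective fun k : ℕ => (k, n + k) := fun k l hkl => (Prod.ext_iff.1 hkl).1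
  rw [← hinj.hasSum_iff] at h
  · refine h.unique ?_
    rw [← mul_assoc]
    have := (hasSum_besselE n (-(A * B))).mul_left (2 * Real.pi * B ^ n)
    convert! this using 1
    funext k
    have e : -(n : ℤ) - k + ((n + k : ℕ) : ℤ) = 0 := by push_cast; ring
    simp only [Function.comp_apply, e, if_true]
    rw [neg_pow (A * B), mul_pow, pow_add]
    have : (k.factorial : ℂ) ≠ 0 := by exact_mod_cast Nat.factorial_ne_zero _
    have : ((n + k).factorial : ℂ) ≠ 0 := by exact_mod_cast Nat.factorial_ne_zero _
    field_simp
    simp [← pow_mul]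
  · rintro ⟨m, l⟩ hml
    have : ¬ (-(n : ℤ) - m + l = 0) := fun h0 => hml ⟨m, by
      simp only [Prod.mk.injEq, true_and]
      omega⟩
    simp [this]

theorem conj_profile (κ : ℝ) (n : ℕ) (s : ℝ) :
    (starRingEnd ℂ) (profile κ n s) = profile κ n s := by
  have h2 : (starRingEnd ℂ) 2 = 2 := Complex.conj_ofNat 2
  rw [profile, map_mul, besselE, Complex.conj_tsum]
  simp [h2]

theorem circularWave_neg_natCast (κ : ℝ) (n : ℕ) (x : Plane) : circularWave κ (-(n : ℤ)) x =
    (-1) ^ n * (profile κ n (‖x‖ ^ 2) * (starRingEnd ℂ) (toComplex x) ^ n) := by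
  rw [circularWave_neg, circularWave_natCast, map_mul, conj_profile, map_pow, zpow_natCast]

/-- In `-AB = (κ/2)²|x|²` the dependence on `ζ` cancels. It survives only in the power `Aⁿ` or `Bⁿ`,
which supplies both `e^{pζ}` and the angular factor of the wave. -/
theorem integral_mode_mul_evanescentWave (κ : ℝ) (p : ℤ) (x : Plane) (t : ℝ) :
    ∫ φ in (0 : ℝ)..2 * Real.pi, Complex.exp (Complex.I * p * φ) * evanescentWave κ (φ, t) x =
      2 * Real.pi * Complex.I ^ p * circularWave κ p x * Complex.exp (p * t) := by
  have hAB : -(Complex.I * (κ / 2) * toComplex x * Complex.exp t *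
      (Complex.I * (κ / 2) * (starRingEnd ℂ) (toComplex x) * Complex.exp (-t))) =
      (((κ / 2) ^ 2 * ‖x‖ ^ 2 : ℝ) : ℂ) := by
    have h1 := toComplex_mul_conj x
    have h2 : Complex.exp t * Complex.exp (-t) = 1 := by rw [← Complex.exp_add]; simp
    push_cast at h1 ⊢
    linear_combination (-(κ / 2 : ℂ) ^ 2 * toComplex x * (starRingEnd ℂ) (toComplex x) *
      Complex.exp t * Complex.exp (-t)) * Complex.I_sq + (κ / 2 : ℂ) ^ 2 * h1 +
      (κ / 2 : ℂ) ^ 2 * toComplex x * (starRingEnd ℂ) (toComplex x) * h2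
  simp only [evanescentWave_eq]
  obtain ⟨n, rfl | rfl⟩ := p.eq_nat_or_neg
  · rw [jacobiAnger_natCast, hAB, circularWave_natCast, profile, zpow_natCast, mul_pow, mul_pow,
      mul_pow, ← Complex.exp_nat_mul]
    push_cast
    ring
  · rw [jacobiAnger_neg, hAB, circularWave_neg_natCast, profile, mul_pow, mul_pow,
      mul_pow, ← Complex.exp_nat_mul]
    have h : Complex.I ^ (-(n : ℤ)) * (-1) ^ n = Complex.I ^ n := by
      rw [zpow_neg, zpow_natCast, ← Complex.I_sq, ← pow_mul, mul_comm 2 n, pow_mul, sq]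
      have : Complex.I ^ n ≠ 0 := pow_ne_zero _ Complex.I_ne_zero
      field_simp
    rw [← h]
    push_cast
    ring_nf

/-! ### The Herglotz transform -/

theorem herglotzTransform_eq (κ : ℝ) (v : ℝ × ℝ → ℂ) (x : Plane) :
    herglotzTransform κ v x = ∫ y, v y * evanescentWave κ y x ∂(weightedMeasure κ) := by
  rw [integral_weighted]
  rfl

theorem integrableOn_herglotzIntegrand {κ : ℝ} (hκ : 0 < κ) (v : L2Cylinder κ) {x : Plane}
    (hx : x ∈ unitDisk) : IntegrableOn (herglotzIntegrand κ v x) cylinder := by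
  have h : Integrable (fun y => v y * evanescentWave κ y x) (weightedMeasure κ) :=
    (Lp.memLp v).integrable_mul (memLp_evanescentWave hκ hx)
  rw [integrable_weighted_iff] at h
  refine h.congr (Filter.Eventually.of_forall fun y => ?_)
  simp only [herglotzIntegrand]
  rw [Complex.real_smul, mul_comm]

/-- The Herglotz transform at a point of the disk, as a continuous linear functional. -/
def herglotzEval {κ : ℝ} (hκ : 0 < κ) {x : Plane} (hx : x ∈ unitDisk) : L2Cylinder κ →L[ℂ] ℂ :=
  innerSL ℂ ((memLp_evanescentWave hκ hx).star.toLp (star fun y => evanescentWave κ y x))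

theorem herglotzEval_apply {κ : ℝ} (hκ : 0 < κ) {x : Plane} (hx : x ∈ unitDisk)
    (v : L2Cylinder κ) : herglotzEval hκ hx v = herglotzTransform κ v x := by
  rw [herglotzTransform_eq, herglotzEval, innerSL_apply_apply, L2.inner_def]
  refine integral_congr_ae ?_
  filter_upwards [(memLp_evanescentWave hκ hx).star.coeFn_toLp] with y hy
  rw [hy]
  simp

/-- The angular integral leaves a second factor `e^{pζ}`, so the integral over `ζ` is that of
`e^{2pζ} w²` and rebuilds `‖ã_p‖²`. -/
theorem herglotzEval_aTilde {κ : ℝ} (hκ : 0 < κ) {x : Plane} (hx : x ∈ unitDisk) (p : ℤ) :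
    herglotzEval hκ hx (aTilde hκ p) =
      Complex.I ^ p * ((‖aTilde hκ p‖ ^ 2 : ℝ) : ℂ) * circularWave κ p x := by
  have h1 : herglotzEval hκ hx (aTilde hκ p) =
      ∫ y, herglotzMode p y * evanescentWave κ y x ∂(weightedMeasure κ) := by
    rw [herglotzEval_apply, herglotzTransform_eq]
    refine integral_congr_ae ?_
    filter_upwards [aTilde_ae hκ p] with y hy
    rw [hy]
  have hi : Integrable (fun y => herglotzMode p y * evanescentWave κ y x) (weightedMeasure κ) :=
    (memLp_herglotzMode hκ p).integrable_mul (memLp_evanescentWave hκ hx)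
  have h2 : ∀ t : ℝ, ∫ φ in (0 : ℝ)..2 * Real.pi,
      herglotzMode p (φ, t) * evanescentWave κ (φ, t) x =
      Complex.exp (p * t) * (2 * Real.pi * Complex.I ^ p * circularWave κ p x *
        Complex.exp (p * t)) := fun t => by
    rw [← integral_mode_mul_evanescentWave, ← intervalIntegral.integral_const_mul]
    refine intervalIntegral.integral_congr fun φ _ => ?_
    simp only [herglotzMode, mul_assoc]
  rw [h1, integral_weighted_iterated hi, norm_aTilde_sq, modeNormSq]
  simp only [h2]
  push_cast
  rw [← integral_complex_ofReal, ← integral_const_mul, ← integral_const_mul, ← integral_mul_const]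
  refine integral_congr_ae (Filter.Eventually.of_forall fun t => ?_)
  simp only
  push_cast
  ring

/-! ### Two-sided bounds for the multipliers -/

/-- Every term after the constant one has `(n + k)! ≥ (n + 1)!`. For large `n` the constant term
therefore dominates, locally uniformly in `s`. -/
theorem norm_besselE_sub_le (n : ℕ) (s : ℂ) :
    ‖besselE n s - 1 / (n.factorial : ℂ)‖ ≤ Real.exp ‖s‖ / ((n + 1).factorial : ℝ) := by
  have h := (hasSum_besselE n s).sub (hasSum_ite_eq 0 (1 / (n.factorial : ℂ)))
  have hb : HasSum (fun k : ℕ => ‖s‖ ^ k / (k.factorial : ℝ) / ((n + 1).factorial : ℝ))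
      (Real.exp ‖s‖ / ((n + 1).factorial : ℝ)) := by
    refine HasSum.div_const ?_ _
    rw [Real.exp_eq_exp_ℝ]
    exact NormedSpace.expSeries_div_hasSum_exp ‖s‖
  rw [← h.tsum_eq]
  refine tsum_of_norm_bounded hb fun k => ?_
  rcases k with _ | k
  · simp
  · rw [if_neg (Nat.succ_ne_zero k), sub_zero, norm_mul, norm_div, norm_mul, norm_pow, norm_pow,
      norm_neg, norm_one, one_pow, Complex.norm_natCast, Complex.norm_natCast, div_div,
      div_mul_eq_mul_div, one_mul]
    have h1 : ((n + 1).factorial : ℝ) ≤ ((n + (k + 1)).factorial : ℝ) := by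
      exact_mod_cast Nat.factorial_le (by omega)
    gcongr

theorem waveNormSq_natCast (κ : ℝ) (n : ℕ) : waveNormSq κ n =
    ∫ x, ‖profile κ n (‖x‖ ^ 2)‖ ^ 2 * (‖x‖ ^ 2) ^ n ∂diskMeasure := by
  refine integral_congr_ae (Filter.Eventually.of_forall fun x => ?_)
  simp only
  rw [circularWave_natCast, norm_mul, norm_pow, norm_toComplex]
  ring

theorem waveNormSq_neg (κ : ℝ) (p : ℤ) : waveNormSq κ (-p) = waveNormSq κ p := by
  refine integral_congr_ae (Filter.Eventually.of_forall fun x => ?_)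
  simp only
  rw [circularWave_neg, norm_mul, norm_zpow, norm_neg, norm_one, one_zpow, one_mul,
    RCLike.norm_conj]

theorem modeNormSq_neg (κ : ℝ) (p : ℤ) : modeNormSq κ (-p) = modeNormSq κ p := by
  rw [modeNormSq, ← integral_neg_eq_self, modeNormSq]
  refine integral_congr_ae (Filter.Eventually.of_forall fun t => ?_)
  simp [weightSq]

theorem norm_profile_eq {κ : ℝ} (hκ : 0 < κ) (n : ℕ) (s : ℝ) :
    ‖profile κ n s‖ = (κ / 2) ^ n * ‖besselE n (((κ / 2) ^ 2 * s : ℝ) : ℂ)‖ := by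
  rw [profile, norm_mul, norm_pow, Complex.norm_real, Real.norm_of_nonneg (by positivity)]

theorem ae_diskMeasure_norm_le : ∀ᵐ x ∂diskMeasure, ‖x‖ ^ 2 ≤ 1 := by
  refine (ae_restrict_iff' (s := unitDisk) Metric.isOpen_ball.measurableSet).2
    (Filter.Eventually.of_forall fun x hx => ?_)
  have := mem_ball_zero_iff.1 hx
  nlinarith [norm_nonneg x]

theorem integrable_profile (κ : ℝ) (n : ℕ) : Integrable (fun x : Plane =>
    ‖profile κ n (‖x‖ ^ 2)‖ ^ 2 * (‖x‖ ^ 2) ^ n) diskMeasure := by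
  have h := (contDiff_profile κ n).continuous
  exact (memLp_disk (by fun_prop)).integrable (by norm_num : (1 : ℝ≥0∞) ≤ 2)

/-- On the disk `|besselE n|` is at most `(1 + e^{(κ/2)²})/n!`, for every order; the rest is `∫
|x|^{2n} = π/(n + 1)`. -/
theorem waveNormSq_le {κ : ℝ} (hκ : 0 < κ) (n : ℕ) : waveNormSq κ n ≤
    Real.pi * (1 + Real.exp ((κ / 2) ^ 2)) ^ 2 *
      (((κ / 2) ^ 2) ^ n / ((n.factorial : ℝ) ^ 2 * (n + 1))) := by
  have h1 : waveNormSq κ n ≤ ∫ x, ((κ / 2) ^ n * ((1 + Real.exp ((κ / 2) ^ 2)) /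
      (n.factorial : ℝ))) ^ 2 * (‖x‖ ^ 2) ^ n ∂diskMeasure := by
    rw [waveNormSq_natCast]
    refine integral_mono_ae (integrable_profile κ n)
      ((memLp_disk (by fun_prop)).integrable (by norm_num : (1 : ℝ≥0∞) ≤ 2)) ?_
    filter_upwards [ae_diskMeasure_norm_le] with x hx
    rw [norm_profile_eq hκ]
    gcongr
    set σ : ℂ := (((κ / 2) ^ 2 * ‖x‖ ^ 2 : ℝ) : ℂ) with hσ
    have hs : ‖σ‖ ≤ (κ / 2) ^ 2 := by
      rw [hσ, Complex.norm_real, Real.norm_of_nonneg (by positivity)]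
      nlinarith [sq_nonneg (κ / 2)]
    have h2 := norm_besselE_sub_le n σ
    have h3 : Real.exp ‖σ‖ / ((n + 1).factorial : ℝ) ≤
        Real.exp ((κ / 2) ^ 2) / (n.factorial : ℝ) := by
      have : (n.factorial : ℝ) ≤ ((n + 1).factorial : ℝ) := by
        exact_mod_cast Nat.factorial_le (by omega)
      gcongr
    have h4 : ‖(1 / (n.factorial : ℂ))‖ = 1 / (n.factorial : ℝ) := by simp
    have h5 := norm_sub_norm_le (besselE n σ) (1 / (n.factorial : ℂ))
    rw [add_div]
    linarith
  refine h1.trans (le_of_eq ?_)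
  rw [integral_const_mul, integral_disk_norm_pow, mul_pow, pow_right_comm]
  generalize ((κ / 2) ^ 2) ^ n = X
  field_simp

/-- The condition on `n` makes the remainder at most half of the leading term `1/n!`; squaring the
surviving half gives the factor `1/4`. -/
theorem le_waveNormSq {κ : ℝ} (hκ : 0 < κ) (n : ℕ) (hn : 2 * Real.exp ((κ / 2) ^ 2) ≤ n + 1) :
    Real.pi / 4 * (((κ / 2) ^ 2) ^ n / ((n.factorial : ℝ) ^ 2 * (n + 1))) ≤ waveNormSq κ n := by
  have h1 : ∫ x, ((κ / 2) ^ n * (1 / (2 * (n.factorial : ℝ)))) ^ 2 * (‖x‖ ^ 2) ^ n ∂diskMeasure ≤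
      waveNormSq κ n := by
    rw [waveNormSq_natCast]
    refine integral_mono_ae
      ((memLp_disk (by fun_prop)).integrable (by norm_num : (1 : ℝ≥0∞) ≤ 2))
      (integrable_profile κ n) ?_
    filter_upwards [ae_diskMeasure_norm_le] with x hx
    rw [norm_profile_eq hκ]
    gcongr
    set σ : ℂ := (((κ / 2) ^ 2 * ‖x‖ ^ 2 : ℝ) : ℂ) with hσ
    have hs : ‖σ‖ ≤ (κ / 2) ^ 2 := by
      rw [hσ, Complex.norm_real, Real.norm_of_nonneg (by positivity)]
      nlinarith [sq_nonneg (κ / 2)]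
    have h2 := norm_besselE_sub_le n σ
    have h3 : Real.exp ‖σ‖ / ((n + 1).factorial : ℝ) ≤ 1 / (2 * (n.factorial : ℝ)) := by
      have h0 : Real.exp ‖σ‖ ≤ Real.exp ((κ / 2) ^ 2) := Real.exp_le_exp.2 hs
      rw [div_le_div_iff₀ (by positivity) (by positivity), Nat.factorial_succ]
      push_cast
      have : (0 : ℝ) < n.factorial := by positivity
      nlinarith
    have h4 : ‖(1 / (n.factorial : ℂ))‖ = 1 / (n.factorial : ℝ) := by simp
    have h5 := norm_sub_norm_le (1 / (n.factorial : ℂ)) (besselE n σ)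
    rw [norm_sub_rev] at h5
    have h6 : 1 / (n.factorial : ℝ) = 2 * (1 / (2 * (n.factorial : ℝ))) := by field_simp
    linarith
  refine le_trans (le_of_eq ?_) h1
  rw [integral_const_mul, integral_disk_norm_pow, mul_pow, pow_right_comm]
  generalize ((κ / 2) ^ 2) ^ n = X
  field_simp
  ring

/-! ### Gamma integrals and the norms of the density modes -/

/-- The integrand of the Gamma function with rate `κ`. -/
def gammaIntegrand (κ a x : ℝ) : ℝ := x ^ (a - 1) * Real.exp (-(κ * x))

theorem integral_gammaIntegrand {κ a : ℝ} (hκ : 0 < κ) (ha : 0 < a) :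
    ∫ x in Set.Ioi 0, gammaIntegrand κ a x = (1 / κ) ^ a * Real.Gamma a :=
  Real.integral_rpow_mul_exp_neg_mul_Ioi ha hκ

theorem integrableOn_gammaIntegrand {κ a : ℝ} (hκ : 0 < κ) (ha : 0 < a) :
    IntegrableOn (gammaIntegrand κ a) (Set.Ioi 0) := by
  refine Integrable.of_integral_ne_zero ?_
  rw [integral_gammaIntegrand hκ ha]
  have := Real.Gamma_pos_of_pos ha
  positivity

theorem gammaIntegrand_nonneg {κ a x : ℝ} (hx : 0 ≤ x) : 0 ≤ gammaIntegrand κ a x :=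
  mul_nonneg (Real.rpow_nonneg hx _) (Real.exp_pos _).le

/-- For `a ≥ 1` the integrand is at most `1` on `(0, 1]` and at least `e^{-2κ}` on `(1, 2]`. The
head is therefore at most `e^{2κ}` times the tail, with a constant independent of `a`. -/
theorem integral_gammaIntegrand_tail_bounds {κ a : ℝ} (hκ : 0 < κ) (ha : 1 ≤ a) :
    ∫ x in Set.Ioi 1, gammaIntegrand κ a x ≤ (1 / κ) ^ a * Real.Gamma a ∧
    (1 / κ) ^ a * Real.Gamma a ≤
      (1 + Real.exp (2 * κ)) * ∫ x in Set.Ioi 1, gammaIntegrand κ a x := by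
  have hi := integrableOn_gammaIntegrand hκ (by linarith : 0 < a)
  have hi1 : IntegrableOn (gammaIntegrand κ a) (Set.Ioi 1) :=
    hi.mono_set (Set.Ioi_subset_Ioi zero_le_one)
  have hi2 : IntegrableOn (gammaIntegrand κ a) (Set.Ioc 0 1) :=
    hi.mono_set Set.Ioc_subset_Ioi_self
  have hi3 : IntegrableOn (gammaIntegrand κ a) (Set.Ioc 1 2) :=
    hi1.mono_set Set.Ioc_subset_Ioi_self
  rw [← integral_gammaIntegrand hκ (by linarith : 0 < a), ← Set.Ioc_union_Ioi_eq_Ioi zero_le_one,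
    setIntegral_union (Set.Ioc_disjoint_Ioi le_rfl) measurableSet_Ioi hi2 hi1]
  have h0 : 0 ≤ ∫ x in Set.Ioc 0 1, gammaIntegrand κ a x :=
    setIntegral_nonneg measurableSet_Ioc fun x hx => gammaIntegrand_nonneg hx.1.le
  have h1 : ∫ x in Set.Ioc 0 1, gammaIntegrand κ a x ≤ 1 := by
    calc ∫ x in Set.Ioc 0 1, gammaIntegrand κ a x ≤ ∫ x in Set.Ioc (0 : ℝ) 1, (1 : ℝ) := by
          refine setIntegral_mono_on hi2 (integrableOn_const measure_Ioc_lt_top.ne)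
            measurableSet_Ioc fun x hx => ?_
          refine mul_le_one₀ (Real.rpow_le_one hx.1.le hx.2 (by linarith)) (Real.exp_pos _).le ?_
          rw [Real.exp_le_one_iff]
          have := mul_pos hκ hx.1
          linarith
      _ = 1 := by simp
  have h2 : Real.exp (-(2 * κ)) ≤ ∫ x in Set.Ioi 1, gammaIntegrand κ a x := by
    calc Real.exp (-(2 * κ)) = ∫ x in Set.Ioc (1 : ℝ) 2, Real.exp (-(2 * κ)) := by
          rw [setIntegral_const]
          simp
          norm_num
      _ ≤ ∫ x in Set.Ioc 1 2, gammaIntegrand κ a x := by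
          refine setIntegral_mono_on (integrableOn_const measure_Ioc_lt_top.ne) hi3
            measurableSet_Ioc fun x hx => ?_
          have e1 : 1 ≤ x ^ (a - 1) := Real.one_le_rpow hx.1.le (by linarith)
          have e2 : Real.exp (-(2 * κ)) ≤ Real.exp (-(κ * x)) := by
            rw [Real.exp_le_exp]
            nlinarith [hx.2]
          rw [gammaIntegrand]
          nlinarith [Real.exp_pos (-(κ * x))]
      _ ≤ _ := setIntegral_mono_set hi1
          ((ae_restrict_iff' measurableSet_Ioi).2 (Filter.Eventually.of_forall fun x hx =>
            gammaIntegrand_nonneg (zero_le_one.trans hx.le)))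
          (Filter.Eventually.of_forall Set.Ioc_subset_Ioi_self)
  refine ⟨by linarith, ?_⟩
  have h3 : 1 ≤ Real.exp (2 * κ) * ∫ x in Set.Ioi 1, gammaIntegrand κ a x := by
    calc 1 = Real.exp (2 * κ) * Real.exp (-(2 * κ)) := by rw [← Real.exp_add]; simp
      _ ≤ _ := by gcongr
  linarith

theorem gammaIntegrand_exp (κ a t : ℝ) : gammaIntegrand κ a (Real.exp t) * Real.exp t =
    Real.exp (a * t - κ * Real.exp t) := by
  rw [gammaIntegrand, ← Real.exp_mul, ← Real.exp_add, ← Real.exp_add]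
  congr 1
  ring

theorem integral_gammaIntegrand_exp {κ a : ℝ} (hκ : 0 < κ) (ha : 0 < a) :
    IntegrableOn (fun t => Real.exp (a * t - κ * Real.exp t)) (Set.Ioi 0) ∧
    ∫ t in Set.Ioi 0, Real.exp (a * t - κ * Real.exp t) =
      ∫ x in Set.Ioi 1, gammaIntegrand κ a x := by
  have hc : ContinuousOn (gammaIntegrand κ a) (Set.Ioi 0) := by
    refine ContinuousOn.mul (fun x hx => ?_) (by fun_prop)
    exact (Real.continuousAt_rpow_const x _ (Or.inl hx.ne')).continuousWithinAt
  have himg : Real.exp '' Set.Ioi 0 ⊆ Set.Ioi 1 := by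
    rintro _ ⟨t, ht, rfl⟩
    exact Real.one_lt_exp_iff.2 ht
  have himg' : Real.exp '' Set.Ici 0 ⊆ Set.Ici 1 := by
    rintro _ ⟨t, ht, rfl⟩
    exact Real.one_le_exp ht
  have hi : IntegrableOn (gammaIntegrand κ a) (Set.Ici 1) :=
    (integrableOn_gammaIntegrand hκ ha).mono_set fun x hx =>
      Set.mem_Ioi.2 (zero_lt_one.trans_le (Set.mem_Ici.1 hx))
  have hint : IntegrableOn (fun t => Real.exp (a * t - κ * Real.exp t)) (Set.Ioi 0) := by
    have := integrableOn_image_iff_integrableOn_abs_deriv_smul (s := Set.Ioi (0 : ℝ))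
      measurableSet_Ioi (fun t _ => (Real.hasDerivAt_exp t).hasDerivWithinAt)
      Real.exp_injective.injOn (gammaIntegrand κ a)
    have := this.1 (hi.mono_set (himg.trans Set.Ioi_subset_Ici_self))
    refine this.congr_fun (fun t _ => ?_) measurableSet_Ioi
    simp only
    rw [abs_of_pos (Real.exp_pos t), smul_eq_mul, mul_comm, gammaIntegrand_exp]
  refine ⟨hint, ?_⟩
  have h := integral_comp_mul_deriv_Ioi (f := Real.exp) (f' := Real.exp)
    (g := gammaIntegrand κ a) (a := 0) Real.continuous_exp.continuousOn Real.tendsto_exp_atTop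
    (fun t _ => (Real.hasDerivAt_exp t).hasDerivWithinAt)
    (hc.mono fun x hx => Set.mem_Ioi.2 (zero_lt_one.trans (Set.mem_Ioi.1 (himg hx)))) (hi.mono_set himg') ?_
  · rw [Real.exp_zero] at h
    rw [← h]
    refine setIntegral_congr_fun measurableSet_Ioi fun t _ => ?_
    simp only [Function.comp_apply]
    rw [gammaIntegrand_exp]
  · rw [integrableOn_Ici_iff_integrableOn_Ioi]
    refine hint.congr_fun (fun t _ => ?_) measurableSet_Ioi
    simp only [Function.comp_apply]
    rw [gammaIntegrand_exp]

/-- For `ζ ≥ 0` the integrand is `exp((2n + 1/2)ζ - κe^ζ)` times `exp(κe^{-ζ})`, and the latter lies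
in `[1, e^κ]`. The half line `ζ < 0` contributes no more than `ζ > 0`, hence the factor `2`. The
substitution `x = e^ζ` produces the Gamma tail. -/
theorem modeNormSq_bounds {κ : ℝ} (hκ : 0 < κ) (n : ℕ) (hn : 1 ≤ n) :
    ∫ x in Set.Ioi 1, gammaIntegrand κ (2 * n + 1 / 2) x ≤ modeNormSq κ n ∧
    modeNormSq κ n ≤
      2 * Real.exp κ * ∫ x in Set.Ioi 1, gammaIntegrand κ (2 * n + 1 / 2) x := by
  have ha : (0 : ℝ) < 2 * n + 1 / 2 := by positivity
  obtain ⟨hi, he⟩ := integral_gammaIntegrand_exp hκ ha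
  set g : ℝ → ℝ := fun t => weightSq κ t * Real.exp ((n : ℤ) * t) ^ 2 with hg
  have hgi : Integrable g := integrable_mode_weight hκ n
  have hg0 : ∀ t, 0 ≤ g t := fun t => by
    simp only [hg, weightSq]
    positivity
  have hge : ∀ t, 0 ≤ t → g t =
      Real.exp ((2 * n + 1 / 2) * t - κ * Real.exp t + κ * Real.exp (-t)) := fun t ht => by
    simp only [hg, weightSq]
    rw [abs_of_nonneg ht, ← Real.exp_nat_mul, ← Real.exp_nat_mul, ← Real.exp_add, Real.sinh_eq]
    congr 1
    push_cast
    ring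
  have hneg : ∀ t, 0 ≤ t → g (-t) ≤ g t := fun t ht => by
    simp only [hg, weightSq, abs_neg]
    gcongr
    nlinarith [(Nat.cast_nonneg n : (0 : ℝ) ≤ n)]
  have hsplit : modeNormSq κ n = (∫ t in Set.Iic 0, g t) + ∫ t in Set.Ioi 0, g t :=
    (intervalIntegral.integral_Iic_add_Ioi hgi.integrableOn hgi.integrableOn).symm
  have h1 : ∫ t in Set.Iic 0, g t ≤ ∫ t in Set.Ioi 0, g t := by
    have : ∫ t in Set.Iic 0, g t = ∫ t in Set.Ioi 0, g (-t) := by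
      rw [integral_comp_neg_Ioi, neg_zero]
    rw [this]
    exact setIntegral_mono_on hgi.comp_neg.integrableOn hgi.integrableOn measurableSet_Ioi
      fun t ht => hneg t (le_of_lt ht)
  have h2 : 0 ≤ ∫ t in Set.Iic 0, g t := setIntegral_nonneg measurableSet_Iic fun t _ => hg0 t
  have h3 : ∫ x in Set.Ioi 1, gammaIntegrand κ (2 * n + 1 / 2) x ≤ ∫ t in Set.Ioi 0, g t := by
    rw [← he]
    refine setIntegral_mono_on hi hgi.integrableOn measurableSet_Ioi fun t ht => ?_
    rw [hge t (le_of_lt ht), Real.exp_le_exp]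
    have := mul_pos hκ (Real.exp_pos (-t))
    linarith
  have h4 : ∫ t in Set.Ioi 0, g t ≤
      Real.exp κ * ∫ x in Set.Ioi 1, gammaIntegrand κ (2 * n + 1 / 2) x := by
    rw [← he, ← integral_const_mul]
    refine setIntegral_mono_on hgi.integrableOn (hi.const_mul _) measurableSet_Ioi fun t ht => ?_
    rw [hge t (le_of_lt ht), ← Real.exp_add, Real.exp_le_exp]
    have : Real.exp (-t) ≤ 1 := Real.exp_le_one_iff.2 (by linarith [Set.mem_Ioi.1 ht])
    nlinarith
  constructor <;> linarith

/-- The sequence `Γ(2m + 5/2) / (4^m m!² (m + 1))`, which governs the size of the multipliers. -/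
def gammaRatio (m : ℕ) : ℝ :=
  Real.Gamma (2 * m + 5 / 2) / (4 ^ m * (m.factorial : ℝ) ^ 2 * (m + 1))

theorem gammaRatio_pos (m : ℕ) : 0 < gammaRatio m := by
  have : 0 < Real.Gamma (2 * m + 5 / 2) := Real.Gamma_pos_of_pos (by positivity)
  rw [gammaRatio]
  positivity

/-- The quotient is `(2m + 5/2)(2m + 7/2) / (4(m + 1)(m + 2))`; its numerator and denominator agree
up to the constant `3/4`. Their linear terms match because of the `|ζ|/4` in the weight. -/
theorem gammaRatio_succ (m : ℕ) :
    gammaRatio (m + 1) = gammaRatio m * (1 + 3 / (16 * (m + 1) * (m + 2))) := by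
  have h1 : Real.Gamma (2 * ((m + 1 : ℕ) : ℝ) + 5 / 2) =
      (2 * m + 7 / 2) * ((2 * m + 5 / 2) * Real.Gamma (2 * m + 5 / 2)) := by
    rw [← Real.Gamma_add_one (by positivity), show (2 * (m : ℝ) + 5 / 2 + 1) = 2 * m + 7 / 2 by ring,
      ← Real.Gamma_add_one (by positivity)]
    congr 1
    push_cast
    ring
  rw [gammaRatio, gammaRatio, h1, Nat.factorial_succ]
  push_cast
  field_simp
  ring

theorem gammaRatio_zero_le (m : ℕ) : gammaRatio 0 ≤ gammaRatio m := by
  induction m with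
  | zero => exact le_rfl
  | succ m ih =>
    rw [gammaRatio_succ]
    have := gammaRatio_pos m
    have h : (0 : ℝ) ≤ 3 / (16 * (m + 1) * (m + 2)) := by positivity
    nlinarith

theorem gammaRatio_le (m : ℕ) : gammaRatio m ≤ 2 * gammaRatio 0 := by
  -- The auxiliary factor `(m + 2)/(m + 1)` decreases fast enough to make the product nonincreasing;
  -- at `m = 0` it equals `2`.
  have h2 : gammaRatio m * ((m + 2) / (m + 1)) ≤ 2 * gammaRatio 0 := by
    induction m with
    | zero => simp [mul_comm]
    | succ m ih =>
      refine le_trans ?_ ih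
      rw [gammaRatio_succ, mul_assoc]
      refine mul_le_mul_of_nonneg_left ?_ (gammaRatio_pos m).le
      push_cast
      rw [← sub_nonneg]
      have : ((m : ℝ) + 2) / (m + 1) - (1 + 3 / (16 * (m + 1) * (m + 2))) *
          ((m + 1 + 2) / (m + 1 + 1)) =
          (16 * (m + 2) - 3 * (m + 3)) / (16 * (m + 1) * (m + 2) ^ 2) := by
        field_simp
        ring
      rw [this]
      have : (0 : ℝ) ≤ 16 * (m + 2) - 3 * (m + 3) := by
        linarith [(Nat.cast_nonneg m : (0 : ℝ) ≤ m)]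
      positivity
  refine le_trans ?_ h2
  have : (1 : ℝ) ≤ (m + 2) / (m + 1) := by
    rw [le_div_iff₀ (by positivity)]
    linarith
  nlinarith [gammaRatio_pos m]

/-! ### Uniform bounds for the multipliers -/

theorem norm_tau {κ : ℝ} (hκ : 0 < κ) (p : ℤ) : ‖tau hκ p‖ = ‖aTilde hκ p‖ * ‖bTilde hκ p‖ := by
  rw [tau, norm_mul, norm_zpow, Complex.norm_I, one_zpow, one_mul, norm_inv, Complex.norm_real,
    alpha, beta, ← mul_inv, norm_inv, inv_inv, norm_mul, norm_norm, norm_norm]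

theorem norm_tau_sq {κ : ℝ} (hκ : 0 < κ) (p : ℤ) : ‖tau hκ p‖ ^ 2 = 2 * Real.pi *
    modeNormSq κ p * (waveNormSq κ p + (waveNormSq κ (p - 1) + waveNormSq κ (p + 1)) / 2) := by
  rw [norm_tau, mul_pow, norm_aTilde_sq, norm_bTilde_sq]

theorem norm_tau_pos {κ : ℝ} (hκ : 0 < κ) (p : ℤ) : 0 < ‖tau hκ p‖ := by
  rw [norm_tau]
  exact mul_pos (norm_aTilde_pos hκ p) (norm_bTilde_pos hκ p)

theorem norm_tau_neg {κ : ℝ} (hκ : 0 < κ) (p : ℤ) : ‖tau hκ (-p)‖ = ‖tau hκ p‖ := by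
  refine (sq_eq_sq₀ (norm_nonneg _) (norm_nonneg _)).1 ?_
  rw [norm_tau_sq, norm_tau_sq, modeNormSq_neg, waveNormSq_neg,
    show -p - 1 = -(p + 1) by ring, show -p + 1 = -(p - 1) by ring, waveNormSq_neg, waveNormSq_neg,
    add_comm (waveNormSq κ (p + 1))]

/-- The exact size of the product of the leading terms. -/
theorem gamma_mul_wave {κ : ℝ} (hκ : 0 < κ) (m : ℕ) :
    (1 / κ) ^ (2 * ((m + 1 : ℕ) : ℝ) + 1 / 2) * Real.Gamma (2 * ((m + 1 : ℕ) : ℝ) + 1 / 2) *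
      (((κ / 2) ^ 2) ^ m / ((m.factorial : ℝ) ^ 2 * (m + 1))) =
      (1 / κ) ^ (5 / 2 : ℝ) * gammaRatio m := by
  have h1 : (2 * ((m + 1 : ℕ) : ℝ) + 1 / 2) = 2 * m + 5 / 2 := by push_cast; ring
  have h2 : (1 / κ) ^ (2 * (m : ℝ) + 5 / 2) = ((1 / κ) ^ 2) ^ m * (1 / κ) ^ (5 / 2 : ℝ) := by
    rw [Real.rpow_add (by positivity), ← pow_mul, ← Real.rpow_natCast]
    push_cast
    rfl
  have h3 : ((κ / 2) ^ 2) ^ m = (κ ^ 2) ^ m / 4 ^ m := by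
    rw [← div_pow]
    congr 1
    ring
  -- The powers of `κ` growing with `m` cancel between the two norms; this is what makes a uniform
  -- bound possible.
  have h4 : ((1 / κ) ^ 2) ^ m * (κ ^ 2) ^ m = 1 := by
    rw [← mul_pow, ← mul_pow]
    simp [hκ.ne']
  rw [h1, h2, h3, gammaRatio]
  calc _ = (((1 / κ) ^ 2) ^ m * (κ ^ 2) ^ m) * (1 / κ) ^ (5 / 2 : ℝ) *
        (Real.Gamma (2 * m + 5 / 2) / (4 ^ m * (m.factorial : ℝ) ^ 2 * (m + 1))) := by
        field_simp
    _ = _ := by rw [h4, one_mul]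

/-- The finitely many exceptional terms are absorbed into a minimum. -/
theorem exists_pos_lower_bound {f : ℕ → ℝ} (hf : ∀ n, 0 < f n) {c : ℝ} (hc : 0 < c) (N : ℕ)
    (h : ∀ n, N ≤ n → c ≤ f n) : ∃ c', 0 < c' ∧ ∀ n, c' ≤ f n := by
  induction N generalizing c with
  | zero => exact ⟨c, hc, fun n => h n (Nat.zero_le n)⟩
  | succ N ih =>
    refine ih (lt_min hc (hf N)) fun n hn => ?_
    rcases hn.eq_or_lt with rfl | hn
    · exact min_le_right _ _
    · exact (min_le_left _ _).trans (h n hn)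

theorem exists_tau_lower_bound {κ : ℝ} (hκ : 0 < κ) :
    ∃ c, 0 < c ∧ ∀ n : ℕ, c ≤ ‖tau hκ n‖ ^ 2 := by
  obtain ⟨N, hN⟩ := exists_nat_ge (2 * Real.exp ((κ / 2) ^ 2))
  refine exists_pos_lower_bound (fun n => pow_pos (norm_tau_pos hκ n) 2)
    (c := 2 * Real.pi * (1 / (1 + Real.exp (2 * κ))) * (Real.pi / 8) *
      ((1 / κ) ^ (5 / 2 : ℝ) * gammaRatio 0)) ?_ (N + 1) fun n hn => ?_
  · have := gammaRatio_pos 0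
    positivity
  obtain ⟨m, rfl⟩ : ∃ m, n = m + 1 := ⟨n - 1, by omega⟩
  have hm : 2 * Real.exp ((κ / 2) ^ 2) ≤ m + 1 := by
    have : (N : ℝ) ≤ m := by exact_mod_cast Nat.le_of_succ_le_succ hn
    linarith
  have h1 := le_waveNormSq hκ m hm
  have h2 := (modeNormSq_bounds hκ (m + 1) (by omega)).1
  have h3 := (integral_gammaIntegrand_tail_bounds hκ (a := 2 * ((m + 1 : ℕ) : ℝ) + 1 / 2)
    (by push_cast; linarith [(Nat.cast_nonneg m : (0 : ℝ) ≤ m)])).2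
  set G := (1 / κ) ^ (2 * ((m + 1 : ℕ) : ℝ) + 1 / 2) *
    Real.Gamma (2 * ((m + 1 : ℕ) : ℝ) + 1 / 2) with hG
  set D := ((κ / 2) ^ 2) ^ m / ((m.factorial : ℝ) ^ 2 * (m + 1)) with hD
  have hGD : G * D = _ := gamma_mul_wave hκ m
  have hD0 : 0 ≤ D := by positivity
  have hG0 : 0 ≤ G := by
    have := Real.Gamma_pos_of_pos (by positivity : 0 < (2 * ((m + 1 : ℕ) : ℝ) + 1 / 2))
    positivity
  have h4 : 1 / (1 + Real.exp (2 * κ)) * G ≤ modeNormSq κ ((m + 1 : ℕ) : ℤ) := by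
    refine le_trans ?_ h2
    rw [div_mul_eq_mul_div, one_mul, div_le_iff₀ (by positivity), mul_comm]
    exact h3
  -- Only the wave of order `m = p - 1` is kept, with its weight `1/2`; the bound `π/4` thus becomes
  -- `π/8`.
  have h5 : Real.pi / 8 * D ≤ waveNormSq κ ((m + 1 : ℕ) : ℤ) +
      (waveNormSq κ (((m + 1 : ℕ) : ℤ) - 1) + waveNormSq κ (((m + 1 : ℕ) : ℤ) + 1)) / 2 := by
    have e1 := waveNormSq_pos hκ ((m + 1 : ℕ) : ℤ)
    have e2 := waveNormSq_pos hκ (((m + 1 : ℕ) : ℤ) + 1)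
    rw [show (((m + 1 : ℕ) : ℤ) - 1) = (m : ℤ) by push_cast; ring]
    linarith
  have h6 := (modeNormSq_pos hκ ((m + 1 : ℕ) : ℤ)).le
  rw [norm_tau_sq]
  calc _ ≤ 2 * Real.pi * (1 / (1 + Real.exp (2 * κ))) * (Real.pi / 8) * (G * D) := by
        rw [hGD]
        have := gammaRatio_zero_le m
        gcongr
    _ = 2 * Real.pi * (1 / (1 + Real.exp (2 * κ)) * G) * (Real.pi / 8 * D) := by ring
    _ ≤ _ := by gcongr

theorem exists_tau_upper_bound {κ : ℝ} (hκ : 0 < κ) :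
    ∃ C, ∀ n : ℕ, ‖tau hκ n‖ ^ 2 ≤ C := by
  set c := (κ / 2) ^ 2 with hc
  set K := Real.pi * (1 + Real.exp c) ^ 2 with hK
  have key : ∀ m : ℕ, ‖tau hκ ((m + 1 : ℕ) : ℤ)‖ ^ 2 ≤ 2 * Real.pi * (2 * Real.exp κ) *
      (K * (c + (1 + c ^ 2) / 2)) * ((1 / κ) ^ (5 / 2 : ℝ) * (2 * gammaRatio 0)) := fun m => by
    have h2 := (modeNormSq_bounds hκ (m + 1) (by omega)).2
    have h3 := (integral_gammaIntegrand_tail_bounds hκ (a := 2 * ((m + 1 : ℕ) : ℝ) + 1 / 2)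
      (by push_cast; linarith [(Nat.cast_nonneg m : (0 : ℝ) ≤ m)])).1
    set G := (1 / κ) ^ (2 * ((m + 1 : ℕ) : ℝ) + 1 / 2) *
      Real.Gamma (2 * ((m + 1 : ℕ) : ℝ) + 1 / 2) with hG
    have hD0 (j : ℕ) : 0 ≤ c ^ j / ((j.factorial : ℝ) ^ 2 * (j + 1)) := by positivity
    -- Raising the order by one costs at most a factor `c = (κ/2)²`. All three waves in the norm are
    -- thus bounded through the one of order `m`, giving `c + (1 + c²)/2`.
    have hDs (j : ℕ) : c ^ (j + 1) / (((j + 1).factorial : ℝ) ^ 2 * (((j + 1 : ℕ) : ℝ) + 1)) ≤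
        c * (c ^ j / ((j.factorial : ℝ) ^ 2 * (j + 1))) := by
      rw [pow_succ, mul_comm, mul_div_assoc]
      have : (j.factorial : ℝ) ≤ ((j + 1).factorial : ℝ) := by
        exact_mod_cast Nat.factorial_le (by omega)
      gcongr
      linarith
    have w0 := waveNormSq_le hκ m
    have w1 := waveNormSq_le hκ (m + 1)
    have w2 := waveNormSq_le hκ (m + 2)
    rw [← hc, ← hK] at w0 w1 w2
    have d1 := hDs m
    have d2 := hDs (m + 1)
    have hGD : G * (c ^ m / ((m.factorial : ℝ) ^ 2 * (m + 1))) = _ := gamma_mul_wave hκ m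
    set D := c ^ m / ((m.factorial : ℝ) ^ 2 * (m + 1)) with hD
    have hK0 : 0 ≤ K := by positivity
    have hc0 : 0 ≤ c := by positivity
    have w1' : waveNormSq κ ((m + 1 : ℕ) : ℤ) ≤ K * (c * D) :=
      w1.trans (mul_le_mul_of_nonneg_left d1 hK0)
    have w2' : waveNormSq κ ((m + 2 : ℕ) : ℤ) ≤ K * (c * (c * D)) :=
      w2.trans (mul_le_mul_of_nonneg_left (d2.trans (mul_le_mul_of_nonneg_left d1 hc0)) hK0)
    have hG0 : 0 ≤ G := by
      have := Real.Gamma_pos_of_pos (by positivity : 0 < (2 * ((m + 1 : ℕ) : ℝ) + 1 / 2))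
      positivity
    have h4 : modeNormSq κ ((m + 1 : ℕ) : ℤ) ≤ 2 * Real.exp κ * G :=
      h2.trans (mul_le_mul_of_nonneg_left h3 (by positivity))
    have h5 : waveNormSq κ ((m + 1 : ℕ) : ℤ) +
        (waveNormSq κ (((m + 1 : ℕ) : ℤ) - 1) + waveNormSq κ (((m + 1 : ℕ) : ℤ) + 1)) / 2 ≤
        K * (c + (1 + c ^ 2) / 2) * D := by
      rw [show (((m + 1 : ℕ) : ℤ) - 1) = (m : ℤ) by push_cast; ring,
        show (((m + 1 : ℕ) : ℤ) + 1) = ((m + 2 : ℕ) : ℤ) by push_cast; ring]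
      linarith
    have h6 : 0 ≤ waveNormSq κ ((m + 1 : ℕ) : ℤ) +
        (waveNormSq κ (((m + 1 : ℕ) : ℤ) - 1) + waveNormSq κ (((m + 1 : ℕ) : ℤ) + 1)) / 2 := by
      have e1 := waveNormSq_pos hκ ((m + 1 : ℕ) : ℤ)
      have e2 := waveNormSq_pos hκ (((m + 1 : ℕ) : ℤ) + 1)
      have e3 := waveNormSq_pos hκ (((m + 1 : ℕ) : ℤ) - 1)
      linarith
    rw [norm_tau_sq]
    calc _ ≤ 2 * Real.pi * (2 * Real.exp κ * G) * (K * (c + (1 + c ^ 2) / 2) * D) := by gcongr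
      _ = 2 * Real.pi * (2 * Real.exp κ) * (K * (c + (1 + c ^ 2) / 2)) * (G * D) := by ring
      _ ≤ _ := by
          rw [hGD]
          have := gammaRatio_le m
          gcongr
  -- Order zero has no predecessor of the form treated above and is added by hand.
  refine ⟨max (‖tau hκ 0‖ ^ 2) (2 * Real.pi * (2 * Real.exp κ) *
    (K * (c + (1 + c ^ 2) / 2)) * ((1 / κ) ^ (5 / 2 : ℝ) * (2 * gammaRatio 0))), fun n => ?_⟩
  rcases n with _ | m
  · exact le_max_left _ _
  · exact (key m).trans (le_max_right _ _)

theorem exists_tau_bounds {κ : ℝ} (hκ : 0 < κ) :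
    ∃ m M, 0 < m ∧ ∀ p : ℤ, m ≤ ‖tau hκ p‖ ∧ ‖tau hκ p‖ ≤ M := by
  obtain ⟨c, hc, h1⟩ := exists_tau_lower_bound hκ
  obtain ⟨C, h2⟩ := exists_tau_upper_bound hκ
  have key (n : ℕ) : √c ≤ ‖tau hκ n‖ ∧ ‖tau hκ n‖ ≤ √C :=
    ⟨Real.sqrt_le_iff.2 ⟨norm_nonneg _, h1 n⟩, Real.le_sqrt_of_sq_le (h2 n)⟩
  refine ⟨√c, √C, Real.sqrt_pos.2 hc, fun p => ?_⟩
  obtain ⟨n, rfl | rfl⟩ := p.eq_nat_or_neg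
  · exact key n
  · rw [norm_tau_neg]
    exact key n

theorem bddAbove_tau {κ : ℝ} (hκ : 0 < κ) : BddAbove (Set.range fun p : ℤ => ‖tau hκ p‖) := by
  obtain ⟨m, M, -, h⟩ := exists_tau_bounds hκ
  exact ⟨M, by rintro _ ⟨p, rfl⟩; exact (h p).2⟩

theorem tauMinus_pos {κ : ℝ} (hκ : 0 < κ) : 0 < tauMinus hκ := by
  obtain ⟨m, M, hm, h⟩ := exists_tau_bounds hκ
  exact hm.trans_le (le_ciInf fun p => (h p).1)

theorem tauMinus_le {κ : ℝ} (hκ : 0 < κ) (p : ℤ) : tauMinus hκ ≤ ‖tau hκ p‖ :=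
  ciInf_le ⟨0, by rintro _ ⟨p, rfl⟩; exact norm_nonneg _⟩ p

theorem le_tauPlus {κ : ℝ} (hκ : 0 < κ) (p : ℤ) : ‖tau hκ p‖ ≤ tauPlus hκ :=
  le_ciSup (bddAbove_tau hκ) p

/-! ### The diagonal representation of the Herglotz transform -/

/-- The Hilbert basis `(a_p)` of `𝒜`. -/
def basisA {κ : ℝ} (hκ : 0 < κ) : HilbertBasis ℤ ℂ (spaceA hκ) :=
  (exists_hilbertBasis_of_closure_span _ (a hκ) (fun _ => rfl) (orthonormal_a hκ)).choose

theorem coe_basisA {κ : ℝ} (hκ : 0 < κ) : ⇑(basisA hκ) = a hκ :=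
  (exists_hilbertBasis_of_closure_span _ (a hκ) (fun _ => rfl) (orthonormal_a hκ)).choose_spec

/-- The Hilbert basis `(b_p)` of `ℬ`. -/
def basisB {κ : ℝ} (hκ : 0 < κ) : HilbertBasis ℤ ℂ (spaceB hκ) :=
  (exists_hilbertBasis_of_closure_span _ (b hκ) (fun _ => rfl) (orthonormal_b hκ)).choose

theorem coe_basisB {κ : ℝ} (hκ : 0 < κ) : ⇑(basisB hκ) = b hκ :=
  (exists_hilbertBasis_of_closure_span _ (b hκ) (fun _ => rfl) (orthonormal_b hκ)).choose_spec

theorem herglotzEval_a {κ : ℝ} (hκ : 0 < κ) {x : Plane} (hx : x ∈ unitDisk) (p : ℤ) :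
    herglotzEval hκ hx (a hκ p : L2Cylinder κ) =
      tau hκ p * ((beta hκ p : ℂ) * circularWave κ p x) := by
  have h1 : herglotzEval hκ hx (a hκ p : L2Cylinder κ) =
      (alpha hκ p : ℂ) * herglotzEval hκ hx (aTilde hκ p) :=
    map_smul (herglotzEval hκ hx) (alpha hκ p : ℂ) (aTilde hκ p)
  have ha : (‖aTilde hκ p‖ : ℂ) ≠ 0 := by exact_mod_cast (norm_aTilde_pos hκ p).ne'
  have hb : (‖bTilde hκ p‖ : ℂ) ≠ 0 := by exact_mod_cast (norm_bTilde_pos hκ p).ne'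
  rw [h1, herglotzEval_aTilde, tau, alpha, beta]
  push_cast
  field_simp

/-- Evaluation at a point of the disk is a continuous functional, so it can be applied term by term
to the expansion in the `a_p`. -/
theorem hasSum_herglotzTransform {κ : ℝ} (hκ : 0 < κ) (v : spaceA hκ) {x : Plane}
    (hx : x ∈ unitDisk) : HasSum (fun p : ℤ => tau hκ p * inner ℂ (a hκ p) v *
      ((beta hκ p : ℂ) * circularWave κ p x)) (herglotzTransform κ (v : L2Cylinder κ) x) := by
  have h := ((basisA hκ).hasSum_repr v).mapL ((herglotzEval hκ hx).comp (spaceA hκ).subtypeL)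
  rw [ContinuousLinearMap.comp_apply, Submodule.subtypeL_apply, herglotzEval_apply] at h
  convert! h using 1
  funext p
  rw [map_smul, ContinuousLinearMap.comp_apply, Submodule.subtypeL_apply, coe_basisA,
    herglotzEval_a, (basisA hκ).repr_apply_apply, coe_basisA, smul_eq_mul]
  ring

/-- Convergence in `ℬ` implies `L²` convergence of the function components, and the same series
converges pointwise to the integral. This identifies the abstract sum with the transform without
differentiating under the integral sign. -/
theorem toFun_ae_eq_herglotzTransform {κ : ℝ} (hκ : 0 < κ) (v : spaceA hκ) (u : spaceB hκ)
    (hu : HasSum (fun p : ℤ => (tau hκ p * inner ℂ (a hκ p) v) • b hκ p) u) :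
    H1.toFun (u : H1 κ) =ᵐ[diskMeasure] herglotzTransform κ (v : L2Cylinder κ) := by
  have h := hu.mapL ((fstL.comp (H1 κ).subtypeL).comp (spaceB hκ).subtypeL)
  refine ae_eq_of_hasSum_Lp h (g := fun p x => tau hκ p * inner ℂ (a hκ p) v *
      ((beta hκ p : ℂ) * circularWave κ p x)) (fun p => ?_) ?_
  · have h1 : ((fstL.comp (H1 κ).subtypeL).comp (spaceB hκ).subtypeL)
        ((tau hκ p * inner ℂ (a hκ p) v) • b hκ p) =
        (tau hκ p * inner ℂ (a hκ p) v * (beta hκ p : ℂ)) • fstL (bTilde hκ p : L2Pair) := by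
      rw [map_smul, mul_smul (tau hκ p * inner ℂ (a hκ p) v) (beta hκ p : ℂ)]
      refine congrArg _ ?_
      exact map_smul (fstL.comp (H1 κ).subtypeL) (beta hκ p : ℂ) (bTilde hκ p)
    rw [h1]
    filter_upwards [Lp.coeFn_smul (tau hκ p * inner ℂ (a hκ p) v * (beta hκ p : ℂ))
      (fstL (bTilde hκ p : L2Pair)), bTilde_fst_ae hκ p] with x h2 h3
    rw [h2, Pi.smul_apply, fstL_apply, h3, smul_eq_mul, mul_assoc]
  · exact (ae_restrict_iff' (s := unitDisk) Metric.isOpen_ball.measurableSet).2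
      (Filter.Eventually.of_forall fun x hx => hasSum_herglotzTransform hκ v hx)

theorem exists_herglotz_equiv {κ : ℝ} (hκ : 0 < κ) :
    ∃ T : spaceA hκ ≃L[ℂ] spaceB hκ,
      (∀ v : spaceA hκ, H1.toFun (T v : H1 κ) =ᵐ[diskMeasure]
          herglotzTransform κ (v : L2Cylinder κ)) ∧
      (∀ v : spaceA hκ,
        HasSum (fun p : ℤ => (tau hκ p * inner ℂ (a hκ p) v) • b hκ p) (T v)) ∧
      (∀ p : ℤ, T (a hκ p) = tau hκ p • b hκ p) ∧
      (∀ v : spaceA hκ, tauMinus hκ * ‖v‖ ≤ ‖T v‖ ∧ ‖T v‖ ≤ tauPlus hκ * ‖v‖) := by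
  have hM : 0 ≤ tauPlus hκ := (norm_nonneg _).trans (le_tauPlus hκ 0)
  obtain ⟨T, hT, ha, hn⟩ := exists_diagonal_equiv (basisA hκ) (basisB hκ) (coe_basisA hκ)
    (coe_basisB hκ) (tau hκ) (tauMinus_pos hκ) hM (tauMinus_le hκ) (le_tauPlus hκ)
  exact ⟨T, fun v => toFun_ae_eq_herglotzTransform hκ v _ (hT v), hT, ha, hn⟩

/-! ### Weak solutions -/

/-- The functional on `L² × (L²)²` expressing the weak Helmholtz equation tested with `ψ`. -/
def helmholtzL (κ : ℝ) {ψ : Plane → ℂ} (h : IsTestFunction ψ) : L2Pair →L[ℂ] ℂ :=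
  ∑ j : Fin 2, (κ : ℂ) • (pairing _ (h.memLp_partialDeriv j)).comp (sndL j) -
    (κ : ℂ) ^ 2 • (pairing ψ h.memLp).comp fstL

theorem helmholtzL_apply (κ : ℝ) {ψ : Plane → ℂ} (h : IsTestFunction ψ) (U : L2Pair) :
    helmholtzL κ h U = ∫ x, ∑ j : Fin 2, ((κ : ℂ) • U.snd x) j * partialDeriv j ψ x ∂diskMeasure -
      (κ : ℂ) ^ 2 * ∫ x, U.fst x * ψ x ∂diskMeasure := by
  have hi (j : Fin 2) : Integrable (fun x => ((κ : ℂ) • U.snd x) j * partialDeriv j ψ x)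
      diskMeasure :=
    (memLp_coord ((Lp.memLp U.snd).const_smul (κ : ℂ)) j).integrable_mul (h.memLp_partialDeriv j)
  rw [integral_finsetSum _ fun j _ => hi j, Fin.sum_univ_two,
    integral_smul_snd_mul κ U 0 _ (h.memLp_partialDeriv 0),
    integral_smul_snd_mul κ U 1 _ (h.memLp_partialDeriv 1), ← fstL_apply, ← pairing_apply ψ h.memLp]
  simp [helmholtzL, Fin.sum_univ_two]

theorem isHelmholtzSolution_iff {κ : ℝ} {f : Plane → ℂ} (U : H1 κ)
    (hU : ∀ ψ (h : IsTestFunction ψ), helmholtzL κ h (U : L2Pair) = 0)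
    (hf : H1.toFun U =ᵐ[diskMeasure] f) : IsHelmholtzSolution κ f := by
  have hc (χ : Plane → ℂ) : ∫ x, f x * χ x ∂diskMeasure =
      ∫ x, (U : L2Pair).fst x * χ x ∂diskMeasure := by
    refine integral_congr_ae ?_
    filter_upwards [hf] with x hx
    rw [← hx]
    rfl
  refine ⟨(memLp_congr_ae hf).1 (Lp.memLp _), fun x => (κ : ℂ) • (U : L2Pair).snd x,
    (Lp.memLp (U : L2Pair).snd).const_smul (κ : ℂ), fun ψ hψ j => ?_, fun ψ hψ => ?_⟩
  · rw [hc]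
    exact U.2 ψ hψ j
  · rw [hc, ← helmholtzL_apply κ hψ]
    exact hU ψ hψ

/-- One integration by parts in each variable moves the derivative from `ψ` back onto the smooth
wave, whose Laplacian is known. -/
theorem helmholtzL_bTilde {κ : ℝ} (hκ : 0 < κ) (p : ℤ) {ψ : Plane → ℂ} (h : IsTestFunction ψ) :
    helmholtzL κ h (bTilde hκ p : L2Pair) = 0 := by
  have hk : (κ : ℂ) ≠ 0 := by exact_mod_cast hκ.ne'
  have hd := contDiff_partialDeriv (contDiff_circularWave κ p)
  have h1 (j : Fin 2) : ∫ x, partialDeriv j (circularWave κ p) x * partialDeriv j ψ x ∂diskMeasure =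
      - ∫ x, partialDeriv j (partialDeriv j (circularWave κ p)) x * ψ x ∂diskMeasure :=
    isWeakGradient_grad ((hd j).of_le (by exact_mod_cast le_top)) ψ h j
  have hi (j : Fin 2) : Integrable (fun x => partialDeriv j (circularWave κ p) x *
      partialDeriv j ψ x) diskMeasure :=
    (memLp_disk (hd j).continuous).integrable_mul (h.memLp_partialDeriv j)
  have hi2 (j : Fin 2) : Integrable (fun x => partialDeriv j (partialDeriv j (circularWave κ p)) x *
      ψ x) diskMeasure :=
    (memLp_disk (contDiff_partialDeriv (hd j) j).continuous).integrable_mul h.memLp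
  have hi3 : Integrable (fun x => -(partialDeriv 0 (partialDeriv 0 (circularWave κ p)) x * ψ x +
      partialDeriv 1 (partialDeriv 1 (circularWave κ p)) x * ψ x)) diskMeasure :=
    ((hi2 0).add (hi2 1)).neg
  have hi4 : Integrable (fun x => (κ : ℂ) ^ 2 * (circularWave κ p x * ψ x)) diskMeasure :=
    ((memLp_disk (continuous_circularWave κ p)).integrable_mul h.memLp).const_mul _
  have e1 : ∫ x, ∑ j : Fin 2, ((κ : ℂ) • (bTilde hκ p : L2Pair).snd x) j *
      partialDeriv j ψ x ∂diskMeasure =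
      ∫ x, ∑ j : Fin 2, partialDeriv j (circularWave κ p) x * partialDeriv j ψ x ∂diskMeasure := by
    refine integral_congr_ae ?_
    filter_upwards [bTilde_snd_ae hκ p] with x hx
    rw [hx]
    simp [grad, hk]
  have e2 : ∫ x, (bTilde hκ p : L2Pair).fst x * ψ x ∂diskMeasure =
      ∫ x, circularWave κ p x * ψ x ∂diskMeasure := by
    refine integral_congr_ae ?_
    filter_upwards [bTilde_fst_ae hκ p] with x hx
    rw [hx]
  rw [helmholtzL_apply, e1, e2, integral_finsetSum _ fun j _ => hi j, Fin.sum_univ_two, h1, h1,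
    ← neg_add, ← integral_add (hi2 0) (hi2 1), ← integral_neg, ← integral_const_mul,
    ← integral_sub hi3 hi4]
  refine (integral_congr_ae (Filter.Eventually.of_forall fun x => ?_)).trans
    (integral_zero Plane ℂ)
  have := laplacian_circularWave κ p x
  rw [wirtP_wirtM (contDiff_circularWave κ p)] at this
  linear_combination (-ψ x) * this

/-- The kernel of a continuous functional is closed, so containing the waves it contains the closure
of their span. -/
theorem helmholtzL_spaceB {κ : ℝ} (hκ : 0 < κ) (U : spaceB hκ) {ψ : Plane → ℂ}
    (h : IsTestFunction ψ) : helmholtzL κ h ((U : H1 κ) : L2Pair) = 0 := by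
  have h1 : spaceB hκ ≤ LinearMap.ker ((helmholtzL κ h).comp (H1 κ).subtypeL).toLinearMap := by
    refine Submodule.topologicalClosure_minimal _ ?_
      (ContinuousLinearMap.isClosed_ker ((helmholtzL κ h).comp (H1 κ).subtypeL))
    rw [Submodule.span_le]
    rintro _ ⟨p, rfl⟩
    refine (map_smul ((helmholtzL κ h).comp (H1 κ).subtypeL) (beta hκ p : ℂ)
      (bTilde hκ p)).trans ?_
    refine (congrArg _ (helmholtzL_bTilde hκ p h)).trans (smul_zero _)
  exact h1 U.2

/-! ### Linear ordinary differential equations -/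

section LinearODE

variable {E : Type*} [NormedAddCommGroup E] [NormedSpace ℝ E]

/-- The Picard iterates of `Y' = A Y + g`, `Y t₁ = 0`, as the terms of a series. -/
def picardTerm (A : ℝ → E →L[ℝ] E) (g : ℝ → E) (t₁ : ℝ) : ℕ → ℝ → E
  | 0, t => ∫ s in t₁..t, g s
  | m + 1, t => ∫ s in t₁..t, A s (picardTerm A g t₁ m s)

variable {A : ℝ → E →L[ℝ] E} {g : ℝ → E} (t₁ : ℝ)

/-- Each iterated integral raises the power of `|t - t₁|` by one and divides by the new exponent, so
the series is dominated by an exponential one. -/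
theorem norm_picardTerm_le {R K C : ℝ} (hK : ∀ t, |t - t₁| ≤ R → ‖A t‖ ≤ K) (hK0 : 0 ≤ K)
    (hC : ∀ t, |t - t₁| ≤ R → ‖picardTerm A g t₁ 0 t‖ ≤ C) (m : ℕ) {t : ℝ}
    (ht : |t - t₁| ≤ R) :
    ‖picardTerm A g t₁ m t‖ ≤ C * (K ^ m * |t - t₁| ^ m / m.factorial) := by
  induction m generalizing t with
  | zero => simpa using hC t ht
  | succ m ih =>
    have hs (s : ℝ) (h : s ∈ Set.uIoc t₁ t) : |s - t₁| ≤ R :=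
      (Set.abs_sub_left_of_mem_uIcc (Set.uIoc_subset_uIcc h)).trans ht
    have hC0 : 0 ≤ C := (norm_nonneg _).trans (hC t ht)
    rw [picardTerm]
    calc ‖∫ s in t₁..t, A s (picardTerm A g t₁ m s)‖
        ≤ |∫ s in t₁..t, C * K ^ (m + 1) / m.factorial * |s - t₁| ^ m| := by
          refine intervalIntegral.norm_integral_le_abs_of_norm_le ?_ ?_
          · refine ae_restrict_of_forall_mem measurableSet_uIoc fun s h => ?_
            refine ((A s).le_opNorm _).trans
              ((mul_le_mul (hK s (hs s h)) (ih (hs s h)) (norm_nonneg _) hK0).trans_eq ?_)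
            ring
          · exact Continuous.intervalIntegrable (by fun_prop) _ _
      _ = C * (K ^ (m + 1) * |t - t₁| ^ (m + 1) / (m + 1).factorial) := by
          rw [intervalIntegral.integral_const_mul, abs_mul,
            abs_of_nonneg (by positivity : 0 ≤ C * K ^ (m + 1) / m.factorial),
            intervalIntegral.abs_integral_eq_abs_integral_uIoc, integral_pow_abs_sub_uIoc,
            abs_of_nonneg (by positivity), Nat.factorial_succ]
          push_cast
          field_simp

variable [CompleteSpace E]

theorem hasDerivAt_picardTerm_zero (hg : Continuous g) (t : ℝ) :
    HasDerivAt (picardTerm A g t₁ 0) (g t) t :=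
  intervalIntegral.integral_hasDerivAt_right (hg.intervalIntegrable _ _)
    (hg.stronglyMeasurableAtFilter _ _) hg.continuousAt

theorem continuous_picardTerm (hA : Continuous A) (hg : Continuous g) (m : ℕ) :
    Continuous (picardTerm A g t₁ m) := by
  induction m with
  | zero =>
    exact continuous_iff_continuousAt.2 fun t =>
      (hasDerivAt_picardTerm_zero (A := A) t₁ hg t).continuousAt
  | succ m ih =>
    have h : Continuous fun s => A s (picardTerm A g t₁ m s) := hA.clm_apply ih
    exact continuous_iff_continuousAt.2 fun t =>
      (intervalIntegral.integral_hasDerivAt_right (h.intervalIntegrable t₁ t)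
        (h.stronglyMeasurableAtFilter _ _) h.continuousAt).continuousAt

theorem hasDerivAt_picardTerm_succ (hA : Continuous A) (hg : Continuous g) (m : ℕ) (t : ℝ) :
    HasDerivAt (picardTerm A g t₁ (m + 1)) (A t (picardTerm A g t₁ m t)) t := by
  have h : Continuous fun s => A s (picardTerm A g t₁ m s) :=
    hA.clm_apply (continuous_picardTerm t₁ hA hg m)
  exact intervalIntegral.integral_hasDerivAt_right (h.intervalIntegrable t₁ t)
    (h.stronglyMeasurableAtFilter _ _) h.continuousAt

/-- Linearity makes the Picard series converge on every bounded interval, so the solution is global.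
A source that vanishes to the right of `t₁` makes every term vanish there. -/
theorem exists_hasDerivAt_linear (hA : Continuous A) (hg : Continuous g) :
    ∃ Y : ℝ → E, (∀ t, HasDerivAt Y (A t (Y t) + g t) t) ∧
      ((∀ t, t₁ ≤ t → g t = 0) → ∀ t, t₁ ≤ t → Y t = 0) := by
  have bound (R : ℝ) : ∃ (C K : ℝ), 0 ≤ C ∧ 0 ≤ K ∧ (∀ t, |t - t₁| ≤ R → ‖A t‖ ≤ K) ∧
      ∀ m t, |t - t₁| ≤ R → ‖picardTerm A g t₁ m t‖ ≤ C * ((K * R) ^ m / m.factorial) := by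
    obtain ⟨K, hK⟩ := (isCompact_closedBall t₁ R).exists_bound_of_continuousOn hA.continuousOn
    obtain ⟨C, hC⟩ := (isCompact_closedBall t₁ R).exists_bound_of_continuousOn
      (continuous_picardTerm (A := A) t₁ hA hg 0).continuousOn
    refine ⟨max C 0, max K 0, le_max_right _ _, le_max_right _ _,
      fun t ht => (hK t ht).trans (le_max_left _ _), fun m t ht => ?_⟩
    refine (norm_picardTerm_le t₁ (fun t ht => (hK t ht).trans (le_max_left _ _))
      (le_max_right _ _) (fun t ht => (hC t ht).trans (le_max_left C 0)) m ht).trans ?_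
    rw [← mul_pow]
    have := le_max_right C 0
    have := le_max_right K 0
    gcongr
  have sum (t : ℝ) : Summable fun m => picardTerm A g t₁ m t := by
    obtain ⟨C, K, -, -, -, h⟩ := bound |t - t₁|
    exact Summable.of_norm_bounded ((Real.summable_pow_div_factorial _).mul_left C)
      fun m => h m t le_rfl
  refine ⟨fun t => ∑' m, picardTerm A g t₁ m t, fun t => ?_, fun h0 t ht => ?_⟩
  · beta_reduce
    obtain ⟨C, K, hC0, hK0, hK, h⟩ := bound (|t - t₁| + 1)
    have hd := hasDerivAt_tsum_of_isPreconnected (t := Metric.ball t₁ (|t - t₁| + 1))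
      (u := fun m => K * (C * ((K * (|t - t₁| + 1)) ^ m / m.factorial)))
      (g := fun m => picardTerm A g t₁ (m + 1)) (g' := fun m s => A s (picardTerm A g t₁ m s))
      (y₀ := t₁) (y := t)
      (((Real.summable_pow_div_factorial _).mul_left C).mul_left K) Metric.isOpen_ball
      (convex_ball _ _).isPreconnected (fun m s _ => hasDerivAt_picardTerm_succ t₁ hA hg m s)
      (fun m s hs => ((A s).le_opNorm _).trans
        (mul_le_mul (hK s (Metric.mem_ball.1 hs).le) (h m s (Metric.mem_ball.1 hs).le)
          (norm_nonneg _) hK0))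
      (Metric.mem_ball_self (by positivity)) ((summable_nat_add_iff 1).2 (sum t₁))
      (by rw [Metric.mem_ball, Real.dist_eq]; linarith)
    -- The term of index `m + 1` has derivative `A` applied to the term of index `m`, so the shifted
    -- series has derivative `A` applied to the whole sum.
    rw [← ContinuousLinearMap.map_tsum _ (sum t)] at hd
    rw [show (fun t => ∑' m, picardTerm A g t₁ m t) =
      fun t => picardTerm A g t₁ 0 t + ∑' m, picardTerm A g t₁ (m + 1) t from
        funext fun t => (sum t).tsum_eq_zero_add]
    convert! (hasDerivAt_picardTerm_zero (A := A) t₁ hg t).add hd using 1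
    rw [add_comm]
  · have (m : ℕ) : ∀ t, t₁ ≤ t → picardTerm A g t₁ m t = 0 := by
      induction m with
      | zero =>
        intro t ht
        refine intervalIntegral.integral_zero_ae (Filter.Eventually.of_forall fun s hs => ?_)
        rw [Set.uIoc_of_le ht] at hs
        exact h0 s hs.1.le
      | succ m ih =>
        intro t ht
        refine intervalIntegral.integral_zero_ae (Filter.Eventually.of_forall fun s hs => ?_)
        rw [Set.uIoc_of_le ht] at hs
        rw [ih s hs.1.le, map_zero]
    simp [this _ t ht]

end LinearODE

/-! ### The radial Helmholtz equation -/

theorem profile_zero_ne_zero {κ : ℝ} (hκ : 0 < κ) (n : ℕ) : profile κ n 0 ≠ 0 := by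
  have h : (κ : ℂ) ≠ 0 := by exact_mod_cast hκ.ne'
  simp [profile, besselE_zero, h, Nat.factorial_ne_zero]

/-- The Helmholtz equation in the variable `s = |x|²`: the Laplacian of `h(|x|²) zⁿ` is `4(s h'' +
(n + 1) h') zⁿ`. -/
theorem profile_equation (κ : ℝ) (n : ℕ) (s : ℝ) :
    4 * ((s : ℂ) * deriv (deriv (profile κ n)) s + (n + 1) * deriv (profile κ n) s)
      + (κ : ℂ) ^ 2 * profile κ n s = 0 := by
  have h := profile_recurrence κ n s
  rw [funext (deriv_profile κ n), deriv_const_mul_field]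
  push_cast at h ⊢
  linear_combination (-2 * (κ : ℂ)) * h

/-- The first-order system of the inhomogeneous radial Helmholtz equation, regularised to the left
of `ε` and solved backwards from `t₁`. -/
theorem exists_radial_system (κ : ℝ) (n : ℕ) {k : ℝ → ℂ} (hk : Continuous k) {ε : ℝ} (hε : 0 < ε)
    (t₁ : ℝ) (h1 : ∀ s, t₁ ≤ s → k s = 0) :
    ∃ y z : ℝ → ℂ, (∀ t, HasDerivAt y (z t) t) ∧
      (∀ t, ε ≤ t → HasDerivAt z (((t⁻¹ : ℝ) : ℂ) *
        (k t / 4 - (κ : ℂ) ^ 2 / 4 * y t - (n + 1) * z t)) t) ∧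
      ∀ t, t₁ ≤ t → y t = 0 ∧ z t = 0 := by
  let f : ℂ × ℂ →L[ℝ] ℂ := ContinuousLinearMap.fst ℝ ℂ ℂ
  let e : ℂ × ℂ →L[ℝ] ℂ := ContinuousLinearMap.snd ℝ ℂ ℂ
  -- The singular coefficient `1/t` is replaced by `1/max t ε`, which is continuous on the whole
  -- line and unchanged for `t ≥ ε`.
  let A (t : ℝ) : ℂ × ℂ →L[ℝ] ℂ × ℂ := (e.prod 0) +
    (max t ε)⁻¹ • ((0 : ℂ × ℂ →L[ℝ] ℂ).prod (-((κ ^ 2 / 4 : ℝ) • f) - ((n + 1 : ℝ) • e)))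
  let g (t : ℝ) : ℂ × ℂ := (0, (((max t ε)⁻¹ : ℝ) : ℂ) * (k t / 4))
  have hm : Continuous fun t : ℝ => (max t ε)⁻¹ :=
    (continuous_id.max continuous_const).inv₀ fun t => (hε.trans_le (le_max_right _ _)).ne'
  have hA : Continuous A := continuous_const.add (hm.smul continuous_const)
  have hg : Continuous g := by
    have := Complex.continuous_ofReal.comp hm
    exact continuous_const.prodMk (this.mul (hk.div_const 4))
  obtain ⟨Y, hY, h0⟩ := exists_hasDerivAt_linear t₁ hA hg
  have hz (t : ℝ) := (e.hasFDerivAt (x := Y t)).comp_hasDerivAt t (hY t)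
  refine ⟨fun t => (Y t).1, fun t => (Y t).2, fun t => ?_, fun t ht => ?_, fun t ht => ?_⟩
  · convert! (f.hasFDerivAt (x := Y t)).comp_hasDerivAt t (hY t) using 1
    simp [f, A, g, e]
  · convert! hz t using 1
    simp only [f, A, g, e, max_eq_left ht]
    simp
    ring
  · have := h0 (fun s hs => by simp [g, h1 s hs]) t ht
    simp [this]

/-- Bootstrapping: the system expresses `y'` and `z'` through `y`, `z` and smooth data, so each pass
gains one derivative of both. -/
theorem contDiffOn_radial_system {κ : ℝ} {n : ℕ} {k : ℝ → ℂ} (hk : ContDiff ℝ ∞ k) {ε : ℝ}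
    (hε : 0 < ε) {y z : ℝ → ℂ} (hy : ∀ t, HasDerivAt y (z t) t)
    (hz : ∀ t, ε ≤ t → HasDerivAt z (((t⁻¹ : ℝ) : ℂ) *
        (k t / 4 - (κ : ℂ) ^ 2 / 4 * y t - (n + 1) * z t)) t) :
    ContDiffOn ℝ ∞ y (Set.Ioi ε) := by
  have dy : DifferentiableOn ℝ y (Set.Ioi ε) := fun t _ =>
    (hy t).differentiableAt.differentiableWithinAt
  have dz : DifferentiableOn ℝ z (Set.Ioi ε) := fun t ht =>
    (hz t (le_of_lt ht)).differentiableAt.differentiableWithinAt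
  have hi : ContDiffOn ℝ ∞ (fun t : ℝ => ((t⁻¹ : ℝ) : ℂ)) (Set.Ioi ε) :=
    Complex.ofRealCLM.contDiff.comp_contDiffOn
      (contDiffOn_id.inv fun t ht => (hε.trans ht).ne')
  have key (N : ℕ) : ContDiffOn ℝ N y (Set.Ioi ε) ∧ ContDiffOn ℝ N z (Set.Ioi ε) := by
    induction N with
    | zero =>
      exact ⟨contDiffOn_zero.2 dy.continuousOn, contDiffOn_zero.2 dz.continuousOn⟩
    | succ N ih =>
      push_cast
      rw [contDiffOn_succ_iff_deriv_of_isOpen isOpen_Ioi,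
        contDiffOn_succ_iff_deriv_of_isOpen isOpen_Ioi]
      have hN : ((N : ℕ∞) : ℕ∞ω) ≤ ((⊤ : ℕ∞) : ℕ∞ω) := by exact_mod_cast le_top
      refine ⟨⟨dy, by simp, ih.2.congr fun t _ => (hy t).deriv⟩, dz, by simp, ?_⟩
      refine ContDiffOn.congr ?_ fun t ht => (hz t (le_of_lt ht)).deriv
      exact (hi.of_le hN).mul ((((hk.of_le hN).contDiffOn.div_const _).sub
        (contDiffOn_const.mul ih.1)).sub (contDiffOn_const.mul ih.2))
  exact contDiffOn_infty.2 fun N => (key N).1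

/-- Lagrange's identity: `s^{n+1}` times the Wronskian of the solution and the profile is an
antiderivative of `profile · sⁿ · k / 4`. It vanishes at `t₁`, and the integral condition carries
this down to `t`. -/
theorem wronskian_radial_system {κ : ℝ} {n : ℕ} {k : ℝ → ℂ} (hk : Continuous k) {ε : ℝ}
    (hε : 0 < ε) {y z : ℝ → ℂ} (hy : ∀ t, HasDerivAt y (z t) t)
    (hz : ∀ t, ε ≤ t → HasDerivAt z (((t⁻¹ : ℝ) : ℂ) *
        (k t / 4 - (κ : ℂ) ^ 2 / 4 * y t - (n + 1) * z t)) t) {t t₁ : ℝ} (ht : ε ≤ t)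
    (htt : t ≤ t₁) (h1 : y t₁ = 0 ∧ z t₁ = 0)
    (hint : ∫ s in t..t₁, profile κ n s * (s : ℂ) ^ n * k s = 0) :
    z t * profile κ n t = y t * deriv (profile κ n) t := by
  have hd (s : ℝ) (hs : s ∈ Set.uIcc t t₁) : HasDerivAt (fun s : ℝ => (s : ℂ) ^ (n + 1) *
      (z s * profile κ n s - y s * deriv (profile κ n) s))
      (profile κ n s * (s : ℂ) ^ n * k s / 4) s := by
    rw [Set.uIcc_of_le htt] at hs
    have hs' := ht.trans hs.1
    have e1 : HasDerivAt (profile κ n) (deriv (profile κ n) s) s :=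
      (differentiable_profile κ n s).hasDerivAt
    have e2 : HasDerivAt (deriv (profile κ n)) (deriv (deriv (profile κ n)) s) s :=
      (((contDiff_deriv (contDiff_profile κ n)).differentiable (by simp)) s).hasDerivAt
    have e3 : HasDerivAt (fun s : ℝ => (s : ℂ) ^ (n + 1)) (((n + 1 : ℕ) : ℂ) * (s : ℂ) ^ n) s := by
      refine (((hasDerivAt_id s).ofReal_comp).fun_pow (n + 1)).congr_deriv ?_
      simp
    refine (e3.fun_mul (((hz s hs').fun_mul e1).fun_sub ((hy s).fun_mul e2))).congr_deriv ?_
    have h := profile_equation κ n s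
    have hs0 : (s : ℂ) ≠ 0 := by exact_mod_cast (hε.trans_le hs').ne'
    have h2 := mul_inv_cancel₀ hs0
    push_cast
    linear_combination (-(y s) * (s : ℂ) ^ n / 4) * h + ((s : ℂ) ^ n * profile κ n s *
      (k s / 4 - (κ : ℂ) ^ 2 / 4 * y s - (n + 1) * z s)) * h2
  have hi := intervalIntegral.integral_eq_sub_of_hasDerivAt hd
    (((((contDiff_profile κ n).continuous.mul (by fun_prop)).mul hk).div_const 4).intervalIntegrable
      _ _)
  have ht0 : (t : ℂ) ≠ 0 := by exact_mod_cast (hε.trans_le ht).ne'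
  rw [intervalIntegral.integral_div, hint, h1.1, h1.2] at hi
  simp [ht0] at hi
  linear_combination hi

/-- Solvability of the inhomogeneous radial Helmholtz equation with compact support in `[0, 1)`,
for right-hand sides orthogonal to the regular solution. -/
theorem exists_radial_solution {κ : ℝ} (hκ : 0 < κ) (n : ℕ) {k : ℝ → ℂ} (hk : ContDiff ℝ ∞ k)
    {δ : ℝ} (hδ : 0 < δ) (hδ' : δ ≤ 1 / 2) (h0 : ∀ s, s ≤ δ → k s = 0)
    (h1 : ∀ s, 1 - δ ≤ s → k s = 0)
    (hint : ∫ s in (0:ℝ)..1, profile κ n s * (s : ℂ) ^ n * k s = 0) :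
    ∃ h : ℝ → ℂ, ContDiff ℝ ∞ h ∧ (∀ s, 1 - δ ≤ s → h s = 0) ∧ ∀ s : ℝ, 0 ≤ s →
      4 * ((s : ℂ) * deriv (deriv h) s + (n + 1) * deriv h s) + (κ : ℂ) ^ 2 * h s = k s := by
  obtain ⟨r, hr, hP⟩ : ∃ r > 0, ∀ s, |s| < r → profile κ n s ≠ 0 := by
    obtain ⟨r, hr, h⟩ := Metric.eventually_nhds_iff.1
      ((contDiff_profile κ n).continuous.continuousAt.eventually_ne (profile_zero_ne_zero hκ n))
    exact ⟨r, hr, fun s hs => h (by simpa using hs)⟩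
  -- On the overlap `(ε, 2ε)` the source vanishes and the profile does not; the two descriptions of
  -- the solution are glued there.
  obtain ⟨ε, hε, hε1, hε2⟩ : ∃ ε > 0, 2 * ε ≤ δ ∧ 2 * ε ≤ r :=
    ⟨min δ r / 2, by positivity, by linarith [min_le_left δ r], by linarith [min_le_right δ r]⟩
  obtain ⟨y, z, hy, hz, h0'⟩ := exists_radial_system κ n hk.continuous hε (1 - δ) h1
  have hPd (s : ℝ) : HasDerivAt (profile κ n) (deriv (profile κ n) s) s :=
    (differentiable_profile κ n s).hasDerivAt
  have hc : Continuous fun s : ℝ => profile κ n s * (s : ℂ) ^ n * k s :=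
    ((contDiff_profile κ n).continuous.mul (by fun_prop)).mul hk.continuous
  have hw (t : ℝ) (ht : t ∈ Set.Ioo ε (2 * ε)) :
      z t * profile κ n t = y t * deriv (profile κ n) t := by
    refine wronskian_radial_system hk.continuous hε hy hz ht.1.le (by linarith [ht.2])
      (h0' _ le_rfl) ?_
    have i1 : ∫ s in (0:ℝ)..t, profile κ n s * (s : ℂ) ^ n * k s = 0 := by
      refine intervalIntegral.integral_zero_ae (Filter.Eventually.of_forall fun s hs => ?_)
      rw [Set.uIoc_of_le (hε.le.trans ht.1.le)] at hs
      rw [h0 s (by linarith [hs.2, ht.2]), mul_zero]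
    have i2 : ∫ s in (1 - δ)..1, profile κ n s * (s : ℂ) ^ n * k s = 0 := by
      refine intervalIntegral.integral_zero_ae (Filter.Eventually.of_forall fun s hs => ?_)
      rw [Set.uIoc_of_le (by linarith)] at hs
      rw [h1 s hs.1.le, mul_zero]
    rw [← intervalIntegral.integral_add_adjacent_intervals (b := t) (hc.intervalIntegrable _ _)
      (hc.intervalIntegrable _ _), i1, zero_add,
      ← intervalIntegral.integral_add_adjacent_intervals (b := 1 - δ) (hc.intervalIntegrable _ _)
      (hc.intervalIntegrable _ _), i2, add_zero] at hint
    exact hint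
  have hP' (t : ℝ) (ht : t ∈ Set.Ioo ε (2 * ε)) : profile κ n t ≠ 0 :=
    hP t (by rw [abs_of_pos (hε.trans ht.1)]; linarith [ht.2])
  have hq (t : ℝ) (ht : t ∈ Set.Ioo ε (2 * ε)) : HasDerivAt (fun t => y t / profile κ n t) 0 t := by
    refine ((hy t).div (hPd t) (hP' t ht)).congr_deriv ?_
    rw [hw t ht, sub_self, zero_div]
  have hm : 3 * ε / 2 ∈ Set.Ioo ε (2 * ε) := ⟨by linarith, by linarith⟩
  -- The vanishing Wronskian makes `y / profile` constant, which excludes the singular solution and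
  -- allows a smooth continuation through `0`.
  obtain ⟨c, hcy⟩ : ∃ c : ℂ, ∀ t ∈ Set.Ioo ε (2 * ε), y t = c * profile κ n t := by
    refine ⟨y (3 * ε / 2) / profile κ n (3 * ε / 2), fun t ht => ?_⟩
    refine (div_eq_iff (hP' t ht)).1 ?_
    exact isOpen_Ioo.is_const_of_deriv_eq_zero isPreconnected_Ioo
      (fun t ht => (hq t ht).differentiableAt.differentiableWithinAt)
      (fun t ht => (hq t ht).deriv) ht hm
  let h : ℝ → ℂ := fun s => if s ≤ 3 * ε / 2 then c * profile κ n s else y s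
  have hl (s : ℝ) (hs : s < 2 * ε) : h s = c * profile κ n s := by
    by_cases h2 : s ≤ 3 * ε / 2
    · simp [h, h2]
    · simp [h, h2, hcy s ⟨by linarith, hs⟩]
  have hy' (s : ℝ) (hs : ε < s) : h s = y s := by
    by_cases h2 : s ≤ 3 * ε / 2
    · simp [h, h2, hcy s ⟨hs, by linarith⟩]
    · simp [h, h2]
  have hl' (s : ℝ) (hs : s < 2 * ε) : h =ᶠ[nhds s] fun s => c * profile κ n s :=
    Filter.eventuallyEq_of_mem (Iio_mem_nhds hs) hl
  have hr' (s : ℝ) (hs : ε < s) : h =ᶠ[nhds s] y :=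
    Filter.eventuallyEq_of_mem (Ioi_mem_nhds hs) hy'
  refine ⟨h, contDiff_iff_contDiffAt.2 fun s => ?_, fun s hs => ?_, fun s hs => ?_⟩
  · rcases lt_or_ge s (2 * ε) with h2 | h2
    · exact (contDiff_const.mul (contDiff_profile κ n)).contDiffAt.congr_of_eventuallyEq (hl' s h2)
    · exact ((contDiffOn_radial_system hk hε hy hz).contDiffAt
        (Ioi_mem_nhds (by linarith))).congr_of_eventuallyEq (hr' s (by linarith))
  · rw [hy' s (by linarith), (h0' s hs).1]
  · rcases lt_or_ge s (2 * ε) with h2 | h2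
    · have e := (hl' s h2).deriv
      have e' : (deriv fun s => c * profile κ n s) = fun s => c * deriv (profile κ n) s :=
        funext fun s => deriv_const_mul_field c
      rw [e.deriv_eq, e', (hl' s h2).deriv_eq, e', deriv_const_mul_field, hl s h2,
        h0 s (by linarith)]
      linear_combination c * profile_equation κ n s
    · have hs' : ε < s := by linarith
      have e : deriv h =ᶠ[nhds s] z := (hr' s hs').deriv.trans
        (Filter.Eventually.of_forall fun t => (hy t).deriv)
      have hs0 : (s : ℂ) ≠ 0 := by exact_mod_cast (hε.trans hs').ne'
      rw [e.deriv_eq, e.eq_of_nhds, hy' s hs', (hz s hs'.le).deriv]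
      push_cast
      field_simp
      ring

/-! ### Angular modes of distributional Helmholtz solutions -/

/-- `u ∈ L²(B₁)` and `Δu + κ²u = 0` in the sense of distributions. -/
def IsDistributionalSolution (κ : ℝ) (u : Plane → ℂ) : Prop :=
  MemLp u 2 diskMeasure ∧ ∀ ψ : Plane → ℂ, IsTestFunction ψ →
    ∫ x, u x * (wirtP (wirtM ψ) x + (κ : ℂ) ^ 2 * ψ x) ∂diskMeasure = 0

theorem IsTestFunction.conj {ψ : Plane → ℂ} (h : IsTestFunction ψ) :
    IsTestFunction fun x => (starRingEnd ℂ) (ψ x) := by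
  have hs : tsupport (fun x => (starRingEnd ℂ) (ψ x)) = tsupport ψ := by
    simp [tsupport, Function.support]
  refine ⟨contDiff_conj.comp h.1, ?_, hs ▸ h.2.2⟩
  rw [HasCompactSupport, hs]
  exact h.2.1

theorem IsDistributionalSolution.conj {κ : ℝ} {u : Plane → ℂ} (h : IsDistributionalSolution κ u) :
    IsDistributionalSolution κ fun x => (starRingEnd ℂ) (u x) := by
  refine ⟨(Complex.conjCLE : ℂ →L[ℝ] ℂ).comp_memLp' h.1, fun ψ hψ => ?_⟩
  have h1 := congrArg (starRingEnd ℂ) (h.2 _ hψ.conj)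
  rw [← integral_conj, map_zero] at h1
  refine Eq.trans (integral_congr_ae (Filter.Eventually.of_forall fun x => ?_)) h1
  have e1 : wirtM (fun x => (starRingEnd ℂ) (ψ x)) = fun x => (starRingEnd ℂ) (wirtP ψ x) :=
    funext fun x => wirtM_conj (hψ.1.differentiable (by simp)) x
  have e2 := wirtP_conj (f := wirtP ψ) ((contDiff_wirtP hψ.1).differentiable (by simp)) x
  rw [e1, e2, wirtM_wirtP hψ.1]
  simp

/-- The function `k(|x|²) zⁿ` equals `(Δ + κ²)` of the test function `h(|x|²) zⁿ`, where `h` solves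
the radial equation, so `u` annihilates it. -/
theorem IsDistributionalSolution.integral_radial_eq_zero {κ : ℝ} (hκ : 0 < κ) {u : Plane → ℂ}
    (hu : IsDistributionalSolution κ u) (n : ℕ) {k : ℝ → ℂ} (hk : ContDiff ℝ ∞ k)
    {δ : ℝ} (hδ : 0 < δ) (hδ' : δ ≤ 1 / 2) (h0 : ∀ s, s ≤ δ → k s = 0)
    (h1 : ∀ s, 1 - δ ≤ s → k s = 0)
    (hint : ∫ s in (0:ℝ)..1, profile κ n s * (s : ℂ) ^ n * k s = 0) :
    ∫ x, u x * (k (‖x‖ ^ 2) * toComplex x ^ n) ∂diskMeasure = 0 := by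
  obtain ⟨h, hh, hh1, hode⟩ := exists_radial_solution hκ n hk hδ hδ' h0 h1 hint
  have ht := isTestFunction_of_radial hh hδ hh1 (contDiff_toComplex.pow n)
  refine Eq.trans (integral_congr_ae (Filter.Eventually.of_forall fun x => ?_)) (hu.2 _ ht)
  have hd : Differentiable ℝ (deriv h) := (contDiff_deriv hh).differentiable (by simp)
  have e1 : wirtP (fun y => h (‖y‖ ^ 2) * toComplex y ^ n) =
      fun y => (2 * deriv h (‖y‖ ^ 2)) * toComplex y ^ (n + 1) :=
    funext fun y => wirtP_radial_mul_pow (hh.differentiable (by simp)) n y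
  have e2 := wirtM_radial_mul_pow (k := fun s => 2 * deriv h s) (hd.const_mul 2) n x
  beta_reduce
  -- Raising before lowering keeps all powers of `z` nonnegative, so the order `n = 0` needs no
  -- separate treatment.
  rw [← wirtM_wirtP ht.1, e1, e2, deriv_const_mul_field, ← hode (‖x‖ ^ 2) (by positivity)]
  push_cast
  ring

/-- Smooth cutoffs exhausting `(0, 1)`. -/
def cutoff (m : ℕ) : ContDiffBump (1 / 2 : ℝ) where
  -- The offset `8` gives `2/(m + 8) ≤ 1/4`, so the inner radius is positive already at `m = 0`.
  rIn := 1 / 2 - 2 / (m + 8)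
  rOut := 1 / 2 - 1 / (m + 8)
  rIn_pos := by
    rw [sub_pos, div_lt_div_iff₀ (by positivity) (by norm_num)]
    linarith [(m.cast_nonneg : (0 : ℝ) ≤ m)]
  rIn_lt_rOut := by
    have : (1 : ℝ) / (m + 8) < 2 / (m + 8) := by gcongr; norm_num
    linarith

theorem cutoff_eq_zero (m : ℕ) {s : ℝ} (hs : s ≤ 1 / (m + 8) ∨ 1 - 1 / (m + 8) ≤ s) :
    cutoff m s = 0 := by
  refine (cutoff m).zero_of_le_dist ?_
  change 1 / 2 - 1 / ((m : ℝ) + 8) ≤ |s - 1 / 2|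
  rcases hs with h | h
  · exact le_trans (by linarith) (neg_le_abs _)
  · exact le_trans (by linarith) (le_abs_self _)

theorem tendsto_cutoff {s : ℝ} (h0 : 0 < s) (h1 : s < 1) :
    Filter.Tendsto (fun m => cutoff m s) Filter.atTop (nhds 1) := by
  have hl : Filter.Tendsto (fun m : ℕ => (2 : ℝ) / (m + 8)) Filter.atTop (nhds 0) :=
    Filter.Tendsto.const_div_atTop
      (Filter.tendsto_atTop_add_const_right _ _ tendsto_natCast_atTop_atTop) _
  refine tendsto_const_nhds.congr' ?_
  filter_upwards [hl.eventually_lt_const (lt_min h0 (sub_pos.2 h1))] with m hm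
  refine ((cutoff m).one_of_mem_closedBall ?_).symm
  have := lt_min_iff.1 hm
  rw [Metric.mem_closedBall, Real.dist_eq]
  change |s - 1 / 2| ≤ 1 / 2 - 2 / ((m : ℝ) + 8)
  rw [abs_le]
  constructor <;> linarith

theorem ae_disk_norm_sq : ∀ᵐ x ∂diskMeasure, 0 < ‖x‖ ^ 2 ∧ ‖x‖ ^ 2 < 1 := by
  have h1 : ∀ᵐ x ∂diskMeasure, x ∈ unitDisk :=
    ae_restrict_mem (s := unitDisk) Metric.isOpen_ball.measurableSet
  have h2 : ∀ᵐ x ∂diskMeasure, x ≠ (0 : Plane) :=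
    ae_restrict_of_ae (Measure.ae_ne volume 0)
  filter_upwards [h1, h2] with x hx hx0
  have : ‖x‖ < 1 := mem_ball_zero_iff.1 hx
  have := norm_pos_iff.2 hx0
  exact ⟨by positivity, by nlinarith⟩

/-- On sources `k` supported away from `0` and `1`, the pairing with `u` vanishes wherever the
pairing with the profile does, so the two functionals are proportional. Cutoffs and dominated
convergence remove the support condition; `u ∈ L²` is all this requires. -/
theorem IsDistributionalSolution.exists_radial_coeff {κ : ℝ} (hκ : 0 < κ) {u : Plane → ℂ}
    (hu : IsDistributionalSolution κ u) (n : ℕ) :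
    ∃ c : ℂ, ∀ k : ℝ → ℂ, ContDiff ℝ ∞ k →
      ∫ x, u x * (k (‖x‖ ^ 2) * toComplex x ^ n) ∂diskMeasure =
        c * ∫ s in (0:ℝ)..1, profile κ n s * (s : ℂ) ^ n * k s := by
  have hz := (contDiff_toComplex.pow n).continuous
  have hP := (contDiff_profile κ n).continuous
  have iu {k : ℝ → ℂ} (hk : Continuous k) :
      Integrable (fun x => u x * (k (‖x‖ ^ 2) * toComplex x ^ n)) diskMeasure :=
    hu.1.integrable_mul (memLp_disk (by fun_prop))
  have im {k : ℝ → ℂ} (hk : Continuous k) : IntervalIntegrable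
      (fun s : ℝ => profile κ n s * (s : ℂ) ^ n * k s) volume 0 1 :=
    Continuous.intervalIntegrable (by fun_prop) _ _
  obtain ⟨c, hc⟩ : ∃ c : ℂ, ∀ k : ℝ → ℂ, ContDiff ℝ ∞ k → ∀ δ > 0, δ ≤ 1 / 2 →
      (∀ s, s ≤ δ → k s = 0) → (∀ s, 1 - δ ≤ s → k s = 0) →
      ∫ x, u x * (k (‖x‖ ^ 2) * toComplex x ^ n) ∂diskMeasure =
        c * ∫ s in (0:ℝ)..1, profile κ n s * (s : ℂ) ^ n * k s := by
    by_cases h : ∃ k : ℝ → ℂ, ContDiff ℝ ∞ k ∧ (∃ δ > 0, δ ≤ 1 / 2 ∧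
      (∀ s, s ≤ δ → k s = 0) ∧ ∀ s, 1 - δ ≤ s → k s = 0) ∧
      ∫ s in (0:ℝ)..1, profile κ n s * (s : ℂ) ^ n * k s ≠ 0
    · obtain ⟨k₀, hk₀, ⟨δ₀, hδ₀, hδ₀', h00, h01⟩, hne⟩ := h
      set M₀ := ∫ s in (0:ℝ)..1, profile κ n s * (s : ℂ) ^ n * k₀ s with hM₀
      refine ⟨(∫ x, u x * (k₀ (‖x‖ ^ 2) * toComplex x ^ n) ∂diskMeasure) / M₀,
        fun k hk δ hδ hδ' h0 h1 => ?_⟩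
      set M := ∫ s in (0:ℝ)..1, profile κ n s * (s : ℂ) ^ n * k s with hM
      -- This combination is orthogonal to the profile by the choice of its coefficients.
      have key := hu.integral_radial_eq_zero hκ n (k := fun s => M₀ * k s - M * k₀ s)
        (δ := min δ δ₀) ((contDiff_const.mul hk).sub (contDiff_const.mul hk₀)) (lt_min hδ hδ₀)
        ((min_le_left _ _).trans hδ')
        (fun s hs => by
          simp [h0 s (hs.trans (min_le_left _ _)), h00 s (hs.trans (min_le_right _ _))])
        (fun s hs => by
          simp [h1 s (by linarith [min_le_left δ δ₀]), h01 s (by linarith [min_le_right δ δ₀])])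
        (by
          have e : (fun s : ℝ => profile κ n s * (s : ℂ) ^ n * (M₀ * k s - M * k₀ s)) =
              fun s : ℝ => M₀ * (profile κ n s * (s : ℂ) ^ n * k s) -
                M * (profile κ n s * (s : ℂ) ^ n * k₀ s) := by
            funext s
            ring
          rw [e, intervalIntegral.integral_sub ((im hk.continuous).const_mul _)
            ((im hk₀.continuous).const_mul _), intervalIntegral.integral_const_mul,
            intervalIntegral.integral_const_mul, ← hM, ← hM₀]
          ring)
      have e : (fun x => u x * ((M₀ * k (‖x‖ ^ 2) - M * k₀ (‖x‖ ^ 2)) * toComplex x ^ n)) =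
          fun x => M₀ * (u x * (k (‖x‖ ^ 2) * toComplex x ^ n)) -
            M * (u x * (k₀ (‖x‖ ^ 2) * toComplex x ^ n)) := by
        funext x
        ring
      rw [e, integral_sub ((iu hk.continuous).const_mul _) ((iu hk₀.continuous).const_mul _),
        integral_const_mul, integral_const_mul] at key
      rw [div_mul_eq_mul_div, eq_div_iff hne]
      linear_combination key
    · push Not at h
      refine ⟨0, fun k hk δ hδ hδ' h0 h1 => ?_⟩
      rw [zero_mul]
      exact hu.integral_radial_eq_zero hκ n hk hδ hδ' h0 h1 (h k hk ⟨δ, hδ, hδ', h0, h1⟩)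
  refine ⟨c, fun k hk => ?_⟩
  have hkc := hk.continuous
  have hχ (m : ℕ) : ContDiff ℝ ∞ fun s => (cutoff m s : ℂ) * k s :=
    (Complex.ofRealCLM.contDiff.comp (cutoff m).contDiff).mul hk
  have hn (m : ℕ) (s : ℝ) : ‖(cutoff m s : ℂ)‖ ≤ 1 := by
    rw [Complex.norm_real, Real.norm_of_nonneg (cutoff m).nonneg]
    exact (cutoff m).le_one
  have heq (m : ℕ) := hc _ (hχ m) (1 / (m + 8)) (by positivity)
    (by
      rw [div_le_div_iff₀ (by positivity) (by norm_num)]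
      linarith [(m.cast_nonneg : (0 : ℝ) ≤ m)])
    (fun s hs => by simp [cutoff_eq_zero m (Or.inl hs)])
    (fun s hs => by simp [cutoff_eq_zero m (Or.inr hs)])
  have lim {s : ℝ} (hs : 0 < s ∧ s < 1) :
      Filter.Tendsto (fun m => (cutoff m s : ℂ)) Filter.atTop (nhds 1) := by
    have := (Complex.continuous_ofReal.tendsto 1).comp (tendsto_cutoff hs.1 hs.2)
    rwa [Complex.ofReal_one] at this
  have l1 : Filter.Tendsto (fun m => ∫ x, u x *
      ((cutoff m (‖x‖ ^ 2) : ℂ) * k (‖x‖ ^ 2) * toComplex x ^ n) ∂diskMeasure) Filter.atTop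
      (nhds (∫ x, u x * (k (‖x‖ ^ 2) * toComplex x ^ n) ∂diskMeasure)) := by
    refine tendsto_integral_of_dominated_convergence _
      (fun m => (iu (hχ m).continuous).aestronglyMeasurable) (iu hkc).norm (fun m => ?_) ?_
    · refine Filter.Eventually.of_forall fun x => ?_
      rw [show u x * ((cutoff m (‖x‖ ^ 2) : ℂ) * k (‖x‖ ^ 2) * toComplex x ^ n) =
        (cutoff m (‖x‖ ^ 2) : ℂ) * (u x * (k (‖x‖ ^ 2) * toComplex x ^ n)) by ring, norm_mul]
      exact mul_le_of_le_one_left (norm_nonneg _) (hn m _)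
    · filter_upwards [ae_disk_norm_sq] with x hx
      have := ((lim hx).mul_const (k (‖x‖ ^ 2))).mul_const (toComplex x ^ n)
      simpa using this.const_mul (u x)
  have l2 : Filter.Tendsto (fun m => ∫ s in (0:ℝ)..1, profile κ n s * (s : ℂ) ^ n *
      ((cutoff m s : ℂ) * k s)) Filter.atTop
      (nhds (∫ s in (0:ℝ)..1, profile κ n s * (s : ℂ) ^ n * k s)) := by
    refine intervalIntegral.tendsto_integral_filter_of_dominated_convergence
      (fun s => ‖profile κ n s * (s : ℂ) ^ n * k s‖)
      (Filter.Eventually.of_forall fun m => ?_) (Filter.Eventually.of_forall fun m => ?_)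
      (im hkc).norm ?_
    · exact ((hP.mul (by fun_prop)).mul (hχ m).continuous).aestronglyMeasurable
    · refine Filter.Eventually.of_forall fun s _ => ?_
      rw [show profile κ n s * (s : ℂ) ^ n * ((cutoff m s : ℂ) * k s) =
        (cutoff m s : ℂ) * (profile κ n s * (s : ℂ) ^ n * k s) by ring, norm_mul]
      exact mul_le_of_le_one_left (norm_nonneg _) (hn m _)
    · filter_upwards [Measure.ae_ne volume (1 : ℝ)] with s hs1 hs
      rw [Set.uIoc_of_le zero_le_one] at hs
      have := (lim ⟨hs.1, lt_of_le_of_ne hs.2 hs1⟩).mul_const (k s)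
      simpa using this.const_mul (profile κ n s * (s : ℂ) ^ n)
  exact tendsto_nhds_unique (l1.congr heq) (l2.const_mul c)

/-- The `p`-th angular mode of a distributional solution is a multiple of the circular wave. -/
theorem IsDistributionalSolution.exists_coeff {κ : ℝ} (hκ : 0 < κ) {u : Plane → ℂ}
    (hu : IsDistributionalSolution κ u) (p : ℤ) :
    ∃ c : ℂ, ∀ ψ : Plane → ℂ, IsMode (-p) ψ →
      ∫ x, u x * ψ x ∂diskMeasure = c * ∫ x, circularWave κ p x * ψ x ∂diskMeasure := by
  have key (n : ℕ) {u : Plane → ℂ} (hu : IsDistributionalSolution κ u) :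
      ∃ c : ℂ, ∀ ψ : Plane → ℂ, IsMode n ψ →
      ∫ x, u x * ψ x ∂diskMeasure =
        c * ∫ x, circularWave κ (-(n : ℤ)) x * ψ x ∂diskMeasure := by
    obtain ⟨c, hc⟩ := hu.exists_radial_coeff hκ n
    have hπ : (Real.pi : ℂ) ≠ 0 := by exact_mod_cast Real.pi_ne_zero
    -- The sign comes from the wave of order `-n`, and the `π` from passing from the disk integral
    -- to the integral in `s = r²`.
    refine ⟨c * (-1) ^ n / Real.pi, ?_⟩
    rintro _ ⟨k, hk, rfl⟩
    have hP := (contDiff_profile κ n).continuous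
    have hkc := hk.continuous
    have e : ∫ x, circularWave κ (-(n : ℤ)) x * (k (‖x‖ ^ 2) * modeMon n x) ∂diskMeasure =
        (-1) ^ n * (Real.pi * ∫ s in (0:ℝ)..1, profile κ n s * (s : ℂ) ^ n * k s) := by
      rw [← integral_disk_radial (by fun_prop), ← integral_const_mul]
      refine integral_congr_ae (Filter.Eventually.of_forall fun x => ?_)
      simp only [modeMon_natCast, circularWave_neg_natCast, ← toComplex_mul_conj]
      ring
    have e2 : ((-1 : ℂ) ^ n) * (-1) ^ n = 1 := by
      rw [← mul_pow]
      simp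
    simp only [e]
    simp only [modeMon_natCast]
    rw [hc k hk]
    field_simp
    linear_combination (-c * ∫ s in (0:ℝ)..1, profile κ n s * (s : ℂ) ^ n * k s) * e2
  obtain ⟨n, rfl | rfl⟩ := p.eq_nat_or_neg
  -- A nonnegative order is tested with modes of nonpositive frequency; conjugating `u` returns to
  -- powers of `z`.
  · obtain ⟨c, hc⟩ := key n hu.conj
    refine ⟨(starRingEnd ℂ) c * (-1) ^ n, fun ψ hψ => ?_⟩
    have h := congrArg (starRingEnd ℂ) (hc _ (by simpa using hψ.conj))
    rw [map_mul, ← integral_conj, ← integral_conj] at h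
    simp only [map_mul, Complex.conj_conj] at h
    rw [h, mul_assoc, ← integral_const_mul ((-1 : ℂ) ^ n)]
    refine congrArg _ (integral_congr_ae (Filter.Eventually.of_forall fun x => ?_))
    simp [circularWave_neg, mul_assoc]
  · obtain ⟨c, hc⟩ := key n hu
    exact ⟨c, fun ψ hψ => hc ψ (by simpa using hψ)⟩

/-! ### Density of the modes -/

/-- Common factors of `z` and `z̄` combine into powers of `|z|²`. Every monomial in
Stone–Weierstrass is therefore a mode. -/
theorem isMode_mul_pow (m n : ℕ) : IsMode ((m : ℤ) - n)
    fun x => toComplex x ^ m * (starRingEnd ℂ) (toComplex x) ^ n := by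
  have key (m d : ℕ) : IsMode (d : ℤ)
      fun x => toComplex x ^ (m + d) * (starRingEnd ℂ) (toComplex x) ^ m := by
    refine ⟨fun s => (s : ℂ) ^ m, Complex.ofRealCLM.contDiff.pow m, funext fun x => ?_⟩
    beta_reduce
    rw [modeMon_natCast, ← toComplex_mul_conj, mul_pow, pow_add]
    ring
  rcases le_total n m with h | h
  · obtain ⟨d, rfl⟩ := Nat.exists_eq_add_of_le h
    convert key n d using 1
    push_cast
    ring
  · obtain ⟨d, rfl⟩ := Nat.exists_eq_add_of_le h
    convert (key m d).conj using 1
    · push_cast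
      ring
    · funext x
      simp [mul_comm]

/-- The radial retraction of the plane onto the closed unit disk. -/
def diskRetraction : C(Plane, Metric.closedBall (0 : Plane) 1) where
  toFun x := ⟨(max 1 ‖x‖)⁻¹ • x, by
    rw [mem_closedBall_zero_iff, norm_smul, norm_inv, Real.norm_of_nonneg (by positivity),
      inv_mul_le_iff₀ (by positivity), mul_one]
    exact le_max_right _ _⟩
  continuous_toFun := by
    refine Continuous.subtype_mk (Continuous.smul (Continuous.inv₀
      (continuous_const.max continuous_norm) fun x => ?_)
      continuous_id) _
    positivity

theorem diskRetraction_of_mem {x : Plane} (hx : x ∈ unitDisk) : (diskRetraction x : Plane) = x := by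
  have : ‖x‖ < 1 := mem_ball_zero_iff.1 hx
  change (max 1 ‖x‖)⁻¹ • x = x
  rw [max_eq_left this.le, inv_one, one_smul]

/-- The functional `F ↦ ∫ u F` on the continuous functions on the closed disk. -/
def diskFunctional (u : Plane → ℂ) (hu : MemLp u 2 diskMeasure) :
    C(Metric.closedBall (0 : Plane) 1, ℂ) →L[ℂ] ℂ :=
  have hi (F : C(Metric.closedBall (0 : Plane) 1, ℂ)) :
      Integrable (fun x => u x * F (diskRetraction x)) diskMeasure :=
    hu.integrable_mul (memLp_disk (F.continuous.comp diskRetraction.continuous))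
  LinearMap.mkContinuous
    { toFun := fun F => ∫ x, u x * F (diskRetraction x) ∂diskMeasure
      map_add' := fun F G => by
        rw [← integral_add (hi F) (hi G)]
        simp [mul_add]
      map_smul' := fun c F => by
        rw [RingHom.id_apply, smul_eq_mul, ← integral_const_mul]
        simp [mul_left_comm] }
    (∫ x, ‖u x‖ ∂diskMeasure) (fun F => by
      refine (norm_integral_le_of_norm_le
        (((hu.integrable (by norm_num)).norm).mul_const ‖F‖)
        (Filter.Eventually.of_forall fun x => ?_)).trans_eq (integral_mul_const _ _)
      rw [norm_mul]
      exact mul_le_mul_of_nonneg_left (F.norm_coe_le_norm _) (norm_nonneg _))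

theorem diskFunctional_apply (u : Plane → ℂ) (hu : MemLp u 2 diskMeasure)
    (F : C(Metric.closedBall (0 : Plane) 1, ℂ)) {f : Plane → ℂ}
    (hF : ∀ x : Metric.closedBall (0 : Plane) 1, F x = f x) :
    diskFunctional u hu F = ∫ x, u x * f x ∂diskMeasure := by
  refine integral_congr_ae ?_
  filter_upwards [ae_restrict_mem (s := unitDisk) Metric.isOpen_ball.measurableSet] with x hx
  rw [hF, diskRetraction_of_mem hx]

/-- An `L²` function on the disk that annihilates all modes vanishes. -/
theorem ae_eq_zero_of_forall_mode {u : Plane → ℂ} (hu : MemLp u 2 diskMeasure)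
    (h : ∀ (p : ℤ) (ψ : Plane → ℂ), IsMode p ψ → ∫ x, u x * ψ x ∂diskMeasure = 0) :
    u =ᵐ[diskMeasure] 0 := by
  let Z : C(Metric.closedBall (0 : Plane) 1, ℂ) :=
    ⟨fun x => toComplex x, contDiff_toComplex.continuous.comp continuous_subtype_val⟩
  have hsep : (StarAlgebra.adjoin ℂ {Z}).SeparatesPoints := by
    intro x y hxy
    refine ⟨Z, ⟨Z, StarAlgebra.self_mem_adjoin_singleton ℂ Z, rfl⟩, fun hZ => hxy ?_⟩
    have hZ' : toComplex (x : Plane) = toComplex (y : Plane) := hZ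
    have h0 := congrArg Complex.re hZ'
    have h1 := congrArg Complex.im hZ'
    simp [toComplex] at h0 h1
    ext j
    fin_cases j
    · exact h0
    · exact h1
  -- The coordinate `z` alone separates points, so polynomials in `z` and `z̄` are uniformly dense
  -- on the closed disk.
  have htop := ContinuousMap.starSubalgebra_topologicalClosure_eq_top_of_separatesPoints _ hsep
  have hle : ∀ F ∈ StarAlgebra.adjoin ℂ {Z}, diskFunctional u hu F = 0 := by
    intro F hF
    have hF' : F ∈ Submodule.span ℂ (Submonoid.closure ({Z} ∪ star {Z}) :
        Set C(Metric.closedBall (0 : Plane) 1, ℂ)) :=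
      (StarAlgebra.adjoin_eq_span (R := ℂ) {Z}).le hF
    refine LinearMap.mem_ker.1 ((Submodule.span_le
      (p := LinearMap.ker (diskFunctional u hu).toLinearMap)).2 ?_ hF')
    intro G hG
    rw [Set.star_singleton, Set.singleton_union, SetLike.mem_coe, Submonoid.mem_closure_pair] at hG
    obtain ⟨m, n, rfl⟩ := hG
    exact (diskFunctional_apply u hu _ (f := fun x => toComplex x ^ m *
      (starRingEnd ℂ) (toComplex x) ^ n) fun x => rfl).trans (h _ _ (isMode_mul_pow m n))
  refine ae_eq_zero_of_forall_test hu fun ψ hψ => ?_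
  let F : C(Metric.closedBall (0 : Plane) 1, ℂ) :=
    ⟨fun x => ψ x, hψ.continuous.comp continuous_subtype_val⟩
  rw [← diskFunctional_apply u hu F fun x => rfl]
  have hF : F ∈ closure (StarAlgebra.adjoin ℂ {Z} : Set C(Metric.closedBall (0 : Plane) 1, ℂ)) := by
    rw [← StarSubalgebra.topologicalClosure_coe, htop]
    trivial
  exact closure_minimal (t := {F | diskFunctional u hu F = 0}) hle
    (isClosed_eq (diskFunctional u hu).continuous continuous_const) hF

/-! ### Modes of weak derivatives -/

theorem integrable_mul_of_memLp {u v : Plane → ℂ} (hu : MemLp u 2 diskMeasure)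
    (hv : MemLp v 2 diskMeasure) : Integrable (fun x => u x * v x) diskMeasure :=
  hu.integrable_mul hv

/-- A radial cutoff times the conjugate wave pairs with the wave to a positive integral. Compact
support is needed because weak derivatives can be moved only onto test functions. -/
theorem exists_test_mode {κ : ℝ} (hκ : 0 < κ) (p : ℤ) :
    ∃ ψ : Plane → ℂ, IsTestFunction ψ ∧ IsMode (-p) ψ ∧
      ∫ x, circularWave κ p x * ψ x ∂diskMeasure ≠ 0 := by
  let χ : ContDiffBump (0 : ℝ) := ⟨1 / 4, 1 / 2, by norm_num, by norm_num⟩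
  have hχ : ContDiff ℝ ∞ fun s => (χ s : ℂ) := Complex.ofRealCLM.contDiff.comp χ.contDiff
  have hm := (isMode_circularWave κ p).conj
  refine ⟨_, isTestFunction_of_radial hχ one_half_pos (fun s hs => ?_) hm.contDiff,
    hm.radial_mul hχ, ?_⟩
  · rw [χ.zero_of_le_dist, Complex.ofReal_zero]
    rw [dist_zero_right, Real.norm_eq_abs]
    change 1 / 2 ≤ |s|
    exact le_trans (by linarith) (le_abs_self s)
  · obtain ⟨x, hx, hx'⟩ := exists_circularWave_ne_zero hκ p one_half_pos
    have hc := continuous_circularWave κ p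
    have hpos := integral_disk_pos (f := fun x => χ (‖x‖ ^ 2) * ‖circularWave κ p x‖ ^ 2)
      ((χ.continuous.comp (by fun_prop)).mul (by fun_prop))
      (fun x => mul_nonneg χ.nonneg (by positivity)) (x := x)
      (by rw [unitDisk, mem_ball_zero_iff]; linarith)
      (by
        rw [χ.one_of_mem_closedBall]
        · simpa using hx'
        · rw [mem_closedBall_zero_iff, Real.norm_of_nonneg (by positivity)]
          change ‖x‖ ^ 2 ≤ 1 / 4
          nlinarith [norm_nonneg x])
    have e : ∫ x, circularWave κ p x * ((χ (‖x‖ ^ 2) : ℂ) *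
        (starRingEnd ℂ) (circularWave κ p x)) ∂diskMeasure =
        ((∫ x, χ (‖x‖ ^ 2) * ‖circularWave κ p x‖ ^ 2 ∂diskMeasure : ℝ) : ℂ) := by
      rw [← integral_complex_ofReal]
      refine integral_congr_ae (Filter.Eventually.of_forall fun x => ?_)
      beta_reduce
      rw [mul_left_comm, Complex.mul_conj, Complex.normSq_eq_norm_sq]
      push_cast
      rfl
    rw [e]
    exact_mod_cast hpos.ne'

theorem H1.integral_mul_wirt {κ : ℝ} (U : H1 κ) {ψ : Plane → ℂ} (h : IsTestFunction ψ) :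
    ∫ x, H1.toFun U x * wirtP ψ x ∂diskMeasure =
      -(κ * ∫ x, raiseL (U : L2Pair) x * ψ x ∂diskMeasure) ∧
    ∫ x, H1.toFun U x * wirtM ψ x ∂diskMeasure =
      -(κ * ∫ x, lowerL (U : L2Pair) x * ψ x ∂diskMeasure) := by
  have hi (j : Fin 2) : Integrable (fun x => H1.toFun U x * partialDeriv j ψ x) diskMeasure :=
    (Lp.memLp (U : L2Pair).fst).integrable_mul (h.memLp_partialDeriv j)
  have hw (j : Fin 2) : ∫ x, H1.toFun U x * partialDeriv j ψ x ∂diskMeasure =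
      -(κ * pairing _ h.memLp (sndL j (U : L2Pair))) := by
    rw [← (mem_H1_iff κ (U : L2Pair)).1 U.2 ψ h j, pairing_apply]
    rfl
  have hr : pairing _ h.memLp (raiseL (U : L2Pair)) = pairing _ h.memLp (sndL 0 (U : L2Pair)) +
      Complex.I * pairing _ h.memLp (sndL 1 (U : L2Pair)) := by
    rw [← smul_eq_mul, ← map_smul, ← map_add]
    rfl
  have hl : pairing _ h.memLp (lowerL (U : L2Pair)) = pairing _ h.memLp (sndL 0 (U : L2Pair)) -
      Complex.I * pairing _ h.memLp (sndL 1 (U : L2Pair)) := by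
    rw [← smul_eq_mul, ← map_smul, ← map_sub]
    rfl
  rw [← pairing_apply _ h.memLp, ← pairing_apply _ h.memLp, hr, hl]
  constructor
  · have e : (fun x => H1.toFun U x * wirtP ψ x) = fun x => H1.toFun U x * partialDeriv 0 ψ x +
        Complex.I * (H1.toFun U x * partialDeriv 1 ψ x) := by
      funext x
      rw [wirtP]
      ring
    rw [e, integral_add (hi 0) ((hi 1).const_mul _), integral_const_mul, hw, hw]
    ring
  · have e : (fun x => H1.toFun U x * wirtM ψ x) = fun x => H1.toFun U x * partialDeriv 0 ψ x -
        Complex.I * (H1.toFun U x * partialDeriv 1 ψ x) := by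
      funext x
      rw [wirtM]
      ring
    rw [e, integral_sub (hi 0) ((hi 1).const_mul _), integral_const_mul, hw, hw]
    ring

/-- The definition of the weak gradient is applied to the test function `∂_j ψ`, moving the
remaining derivative onto `ψ`. -/
theorem isDistributionalSolution_toFun {κ : ℝ} (U : H1 κ)
    (hU : ∀ ψ (h : IsTestFunction ψ), helmholtzL κ h (U : L2Pair) = 0) :
    IsDistributionalSolution κ (H1.toFun U) := by
  have hm : MemLp (H1.toFun U) 2 diskMeasure := Lp.memLp (U : L2Pair).fst
  refine ⟨hm, fun ψ h => ?_⟩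
  have hU' := hU ψ h
  have hp (j : Fin 2) : IsTestFunction (partialDeriv j ψ) :=
    ⟨contDiff_partialDeriv h.1 j, hasCompactSupport_partialDeriv h.2.1 j,
      (closure_minimal (fun x hx => by
        by_contra hn
        exact hx (by simp [partialDeriv, fderiv_of_notMem_tsupport ℝ hn]))
        (isClosed_tsupport _)).trans h.2.2⟩
  have hw (j : Fin 2) := (mem_H1_iff κ (U : L2Pair)).1 U.2 _ (hp j) j
  have hi (j : Fin 2) : Integrable (fun x => H1.toFun U x *
      partialDeriv j (partialDeriv j ψ) x) diskMeasure :=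
    hm.integrable_mul ((hp j).memLp_partialDeriv j)
  have e : (fun x => H1.toFun U x * (wirtP (wirtM ψ) x + (κ : ℂ) ^ 2 * ψ x)) = fun x =>
      H1.toFun U x * partialDeriv 0 (partialDeriv 0 ψ) x +
      H1.toFun U x * partialDeriv 1 (partialDeriv 1 ψ) x +
      (κ : ℂ) ^ 2 * (H1.toFun U x * ψ x) := by
    funext x
    rw [wirtP_wirtM h.1]
    ring
  have hs : helmholtzL κ h (U : L2Pair) =
      κ * pairing _ (h.memLp_partialDeriv 0) (sndL 0 (U : L2Pair)) +
      κ * pairing _ (h.memLp_partialDeriv 1) (sndL 1 (U : L2Pair)) -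
      (κ : ℂ) ^ 2 * pairing _ h.memLp (fstL (U : L2Pair)) := by
    rw [helmholtzL, Fin.sum_univ_two]
    rfl
  rw [hs] at hU'
  have hw0 := hw 0
  have hw1 := hw 1
  rw [pairing_apply _ ((hp _).memLp_partialDeriv _)] at hw0 hw1
  rw [pairing_apply _ h.memLp] at hU'
  have hf : (fstL (U : L2Pair) : Plane → ℂ) = H1.toFun U := rfl
  rw [hf] at hU' hw0 hw1
  rw [e, integral_add (by exact (hi 0).add (hi 1)) ((integrable_mul_of_memLp hm h.memLp).const_mul _),
    integral_add (hi 0) (hi 1), integral_const_mul]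
  linear_combination hw0 + hw1 - hU'

/-- If `-κ v` is the weak derivative of a distributional solution along a first-order operator
commuting with the Laplacian, then `v` is a distributional solution. -/
theorem IsDistributionalSolution.of_weak_derivative {κ : ℝ} (hκ : 0 < κ) {u v : Plane → ℂ}
    (hu : IsDistributionalSolution κ u) (hv : MemLp v 2 diskMeasure)
    {D : (Plane → ℂ) → Plane → ℂ} (hD : ∀ ψ, IsTestFunction ψ → IsTestFunction (D ψ))
    (hc : ∀ ψ, IsTestFunction ψ → D (wirtP (wirtM ψ)) = wirtP (wirtM (D ψ)))
    (h : ∀ ψ, IsTestFunction ψ → ∫ x, u x * D ψ x ∂diskMeasure =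
      -(κ * ∫ x, v x * ψ x ∂diskMeasure)) :
    IsDistributionalSolution κ v := by
  refine ⟨hv, fun ψ hψ => ?_⟩
  have hk : (κ : ℂ) ≠ 0 := by exact_mod_cast hκ.ne'
  have hL := hψ.wirt.2.wirt.1
  have hL' := (hD ψ hψ).wirt.2.wirt.1
  -- Testing `u` with `Dψ`, and commuting `D` past the Laplacian, yields `-κ` times the equation for
  -- `v` tested with `ψ`.
  have h1 := h _ hψ
  have h2 := h _ hL
  rw [hc ψ hψ] at h2
  have h3 := hu.2 _ (hD ψ hψ)
  simp only [mul_add, mul_left_comm _ ((κ : ℂ) ^ 2)] at h3 ⊢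
  rw [integral_add (integrable_mul_of_memLp hu.1 hL'.memLp)
    ((integrable_mul_of_memLp hu.1 (hD ψ hψ).memLp).const_mul _), integral_const_mul, h1, h2] at h3
  rw [integral_add (integrable_mul_of_memLp hv hL.memLp) ((integrable_mul_of_memLp hv hψ.memLp).const_mul _),
    integral_const_mul]
  refine mul_left_cancel₀ hk ?_
  linear_combination -h3

/-- Mode `p` of `u` is `c` times the wave, so its derivative is `c` times the derivative `σ b̃_q` of
the wave. One test mode that pairs nontrivially with `b̃_q` fixes the coefficient. -/
theorem mode_coeff_weak_derivative {κ : ℝ} (hκ : 0 < κ) {u v w : Plane → ℂ} {p q : ℤ} {c d : ℂ}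
    {D : (Plane → ℂ) → Plane → ℂ} (hD : ∀ ψ, IsMode (-q) ψ → IsMode (-p) (D ψ))
    (hc : ∀ ψ, IsMode (-p) ψ → ∫ x, u x * ψ x ∂diskMeasure =
      c * ∫ x, circularWave κ p x * ψ x ∂diskMeasure)
    (hd : ∀ ψ, IsMode (-q) ψ → ∫ x, v x * ψ x ∂diskMeasure =
      d * ∫ x, circularWave κ q x * ψ x ∂diskMeasure)
    (h : ∀ ψ, IsTestFunction ψ → ∫ x, u x * D ψ x ∂diskMeasure =
      -(κ * ∫ x, v x * ψ x ∂diskMeasure)) {σ : ℂ} (hw : ∀ x, w x = σ * circularWave κ q x)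
    (h' : ∀ ψ, IsTestFunction ψ → ∫ x, circularWave κ p x * D ψ x ∂diskMeasure =
      -(κ * ∫ x, w x * ψ x ∂diskMeasure)) : d = c * σ := by
  obtain ⟨ψ, hψ, hm, hne⟩ := exists_test_mode hκ q
  have hk : (κ : ℂ) ≠ 0 := by exact_mod_cast hκ.ne'
  have h1 := h ψ hψ
  have h2 := h' ψ hψ
  simp only [hw, mul_assoc] at h2
  rw [integral_const_mul] at h2
  rw [hc _ (hD ψ hm), hd ψ hm, h2] at h1
  refine mul_right_cancel₀ hne (mul_left_cancel₀ hk ?_)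
  linear_combination h1

/-! ### Completeness of the circular waves -/

/-- The function and its lowered and raised gradients are all distributional solutions, and the
ladder relations force their coefficients at orders `p`, `p - 1`, `p + 1` to be `c`, `c`, `-c`. The
`H¹` product over the whole disk is thus computed without boundary terms. -/
theorem exists_inner_bTilde_coeff {κ : ℝ} (hκ : 0 < κ) (U : H1 κ)
    (hU : ∀ ψ (h : IsTestFunction ψ), helmholtzL κ h (U : L2Pair) = 0) (p : ℤ) :
    ∃ c : ℂ, (∀ ψ : Plane → ℂ, IsMode (-p) ψ → ∫ x, H1.toFun U x * ψ x ∂diskMeasure =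
        c * ∫ x, circularWave κ p x * ψ x ∂diskMeasure) ∧
      inner ℂ (bTilde hκ p) U = c * ((waveNormSq κ p +
        (waveNormSq κ (p - 1) + waveNormSq κ (p + 1)) / 2 : ℝ) : ℂ) := by
  have hu := isDistributionalSolution_toFun U hU
  have hl : IsDistributionalSolution κ (lowerL (U : L2Pair)) :=
    hu.of_weak_derivative hκ (Lp.memLp _) (D := wirtM) (fun ψ h => h.wirt.2)
      (fun ψ h => funext fun x => wirtM_wirtP (contDiff_wirtM h.1) x)
      fun ψ h => (H1.integral_mul_wirt U h).2
  have hr : IsDistributionalSolution κ (raiseL (U : L2Pair)) :=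
    hu.of_weak_derivative hκ (Lp.memLp _) (D := wirtP) (fun ψ h => h.wirt.1)
      (fun ψ h => congrArg wirtP (funext fun x => (wirtM_wirtP h.1 x).symm))
      fun ψ h => (H1.integral_mul_wirt U h).1
  obtain ⟨c, hc⟩ := hu.exists_coeff hκ p
  obtain ⟨d, hd⟩ := hl.exists_coeff hκ (p - 1)
  obtain ⟨e, he⟩ := hr.exists_coeff hκ (p + 1)
  have hb (χ : Plane → ℂ) : ∫ x, circularWave κ p x * χ x ∂diskMeasure =
      ∫ x, H1.toFun (bTilde hκ p) x * χ x ∂diskMeasure := by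
    refine integral_congr_ae ?_
    filter_upwards [bTilde_fst_ae hκ p] with x hx
    rw [H1.toFun, hx]
  have hdc : d = c * 1 := by
    refine mode_coeff_weak_derivative hκ (D := wirtM) (w := circularWave κ (p - 1))
      (fun ψ h => ?_) hc hd (fun ψ h => (H1.integral_mul_wirt U h).2)
      (fun x => (one_mul _).symm) fun ψ h => ?_
    · convert h.wirt.2 using 1
      ring
    · rw [hb, (H1.integral_mul_wirt (bTilde hκ p) h).2]
      congr 2
      refine integral_congr_ae ?_
      filter_upwards [lowerL_bTilde hκ p] with x hx
      rw [hx]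
  have hec : e = c * -1 := by
    refine mode_coeff_weak_derivative hκ (D := wirtP) (w := fun x => -circularWave κ (p + 1) x)
      (fun ψ h => ?_) hc he (fun ψ h => (H1.integral_mul_wirt U h).1)
      (fun x => (neg_one_mul _).symm) fun ψ h => ?_
    · convert h.wirt.1 using 1
      ring
    · rw [hb, (H1.integral_mul_wirt (bTilde hκ p) h).1]
      congr 2
      refine integral_congr_ae ?_
      filter_upwards [raiseL_bTilde hκ p] with x hx
      rw [hx]
  have hn (q : ℤ) : ∫ x, circularWave κ q x * (starRingEnd ℂ) (circularWave κ q x) ∂diskMeasure =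
      waveNormSq κ q := by
    rw [integral_wave_mul_conj, if_pos rfl]
  refine ⟨c, hc, ?_⟩
  have h0 := hc _ (isMode_circularWave κ p).conj
  have h1 := hd _ (isMode_circularWave κ (p - 1)).conj
  have h2 := he _ (isMode_circularWave κ (p + 1)).conj
  rw [hn] at h0 h1 h2
  have hf : (fstL (U : L2Pair) : Plane → ℂ) = H1.toFun U := rfl
  rw [inner_bTilde, pairing_apply, pairing_apply, pairing_apply, hf, h0, h1, h2, hdc, hec]
  push_cast
  ring

/-- A weak solution of the Helmholtz equation orthogonal to all circular waves vanishes. -/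
theorem eq_zero_of_inner_bTilde {κ : ℝ} (hκ : 0 < κ) (U : H1 κ)
    (hU : ∀ ψ (h : IsTestFunction ψ), helmholtzL κ h (U : L2Pair) = 0)
    (h : ∀ p, inner ℂ (bTilde hκ p) U = 0) : U = 0 := by
  refine H1.ext_of_toFun hκ ?_
  have h1 : H1.toFun U =ᵐ[diskMeasure] 0 := by
    refine ae_eq_zero_of_forall_mode (Lp.memLp (U : L2Pair).fst) fun p ψ hψ => ?_
    obtain ⟨c, hc, hi⟩ := exists_inner_bTilde_coeff hκ U hU (-p)
    -- The bracket is the squared norm of the wave, hence positive, so the mode coefficient itself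
    -- vanishes.
    rw [h, eq_comm, mul_eq_zero, Complex.ofReal_eq_zero] at hi
    have := waveNormSq_pos hκ (-p)
    have := waveNormSq_pos hκ (-p - 1)
    have := waveNormSq_pos hκ (-p + 1)
    rw [hc ψ (by simpa using hψ), hi.resolve_right (by positivity), zero_mul]
  exact h1.trans (Lp.coeFn_zero ℂ 2 diskMeasure).symm

/-- The projection onto `ℬ` solves the equation, hence so does the remainder. The latter is
orthogonal to all waves and must vanish. -/
theorem mem_spaceB {κ : ℝ} (hκ : 0 < κ) (U : H1 κ)
    (hU : ∀ ψ (h : IsTestFunction ψ), helmholtzL κ h (U : L2Pair) = 0) : U ∈ spaceB hκ := by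
  have hcl : IsClosed (spaceB hκ : Set (H1 κ)) := Submodule.isClosed_topologicalClosure _
  have : CompleteSpace (spaceB hκ) := hcl.completeSpace_coe
  obtain ⟨V, hV, W, hW, rfl⟩ := Submodule.exists_add_mem_mem_orthogonal (K := spaceB hκ) U
  have hW0 : W = 0 := by
    refine eq_zero_of_inner_bTilde hκ W (fun ψ h => ?_) fun p => ?_
    · have h1 : helmholtzL κ h (V : L2Pair) + helmholtzL κ h (W : L2Pair) = 0 :=
        (map_add (helmholtzL κ h) (V : L2Pair) (W : L2Pair)).symm.trans (hU ψ h)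
      have h2 := helmholtzL_spaceB hκ ⟨V, hV⟩ h
      exact (zero_add _).symm.trans ((congrArg (· + _) h2.symm).trans h1)
    · have hb := (b hκ p).2
      have h1 := (Submodule.mem_orthogonal _ _).1 hW _ hb
      have h2 : (starRingEnd ℂ) (beta hκ p : ℂ) * inner ℂ (bTilde hκ p) W = 0 :=
        (inner_smul_left (𝕜 := ℂ) (bTilde hκ p) W (beta hκ p : ℂ)).symm.trans h1
      refine (mul_eq_zero.1 h2).resolve_left ?_
      rw [Complex.conj_ofReal, Complex.ofReal_eq_zero]
      exact (inv_pos.2 (norm_bTilde_pos hκ p)).ne'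
  rw [hW0, add_zero]
  exact hV

/-- Every weak solution of the Helmholtz equation in `H¹(B₁)` lies in `ℬ`. -/
theorem IsHelmholtzSolution.exists_spaceB {κ : ℝ} (hκ : 0 < κ) {u : Plane → ℂ}
    (hu : IsHelmholtzSolution κ u) :
    ∃ U : spaceB hκ, H1.toFun (U : H1 κ) =ᵐ[diskMeasure] u := by
  obtain ⟨hm, g, hg, hw, hs⟩ := hu
  have hk : (κ : ℂ) ≠ 0 := by exact_mod_cast hκ.ne'
  let V : L2Pair := WithLp.toLp 2 (hm.toLp u, (hg.const_smul (κ : ℂ)⁻¹).toLp _)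
  have h1 : (V.fst : Plane → ℂ) =ᵐ[diskMeasure] u := hm.coeFn_toLp
  have h2 : ∀ᵐ x ∂diskMeasure, (κ : ℂ) • V.snd x = g x := by
    filter_upwards [(hg.const_smul (κ : ℂ)⁻¹).coeFn_toLp] with x hx
    have : V.snd x = (κ : ℂ)⁻¹ • g x := hx
    rw [this, smul_inv_smul₀ hk]
  have hV : V ∈ H1 κ := by
    intro ψ hψ j
    refine Eq.trans (integral_congr_ae ?_) ((hw ψ hψ j).trans
      (congrArg Neg.neg (integral_congr_ae ?_)))
    · filter_upwards [h1] with x hx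
      rw [hx]
    · filter_upwards [h2] with x hx
      rw [hx]
  have hU : ∀ ψ (h : IsTestFunction ψ), helmholtzL κ h V = 0 := by
    intro ψ hψ
    rw [helmholtzL_apply, ← hs ψ hψ]
    congr 1
    · refine integral_congr_ae ?_
      filter_upwards [h2] with x hx
      rw [hx]
    · congr 1
      refine integral_congr_ae ?_
      filter_upwards [h1] with x hx
      rw [hx]
  exact ⟨⟨⟨V, hV⟩, mem_spaceB hκ ⟨V, hV⟩ hU⟩, h1⟩

end Herglotz

end

theorem theorem5p1 (κ : ℝ) (hκ : 0 < κ) :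
    Orthonormal ℂ (Herglotz.a hκ) ∧ Orthonormal ℂ (Herglotz.b hκ) ∧
    0 < Herglotz.tauMinus hκ ∧ BddAbove (Set.range fun p : ℤ => ‖Herglotz.tau hκ p‖) ∧
    (∀ v : Herglotz.spaceA hκ, ∀ x ∈ Herglotz.unitDisk,
      IntegrableOn (Herglotz.herglotzIntegrand κ (v : Herglotz.L2Cylinder κ) x)
        Herglotz.cylinder) ∧
    (∃ T : Herglotz.spaceA hκ ≃L[ℂ] Herglotz.spaceB hκ,
      (∀ v : Herglotz.spaceA hκ,
        Herglotz.H1.toFun (T v : Herglotz.H1 κ) =ᵐ[Herglotz.diskMeasure]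
          Herglotz.herglotzTransform κ (v : Herglotz.L2Cylinder κ)) ∧
      (∀ v : Herglotz.spaceA hκ,
        HasSum (fun p : ℤ =>
          (Herglotz.tau hκ p * inner ℂ (Herglotz.a hκ p) v) • Herglotz.b hκ p) (T v)) ∧
      (∀ p : ℤ, T (Herglotz.a hκ p) = Herglotz.tau hκ p • Herglotz.b hκ p) ∧
      (∀ v : Herglotz.spaceA hκ,
        Herglotz.tauMinus hκ * ‖v‖ ≤ ‖T v‖ ∧ ‖T v‖ ≤ Herglotz.tauPlus hκ * ‖v‖)) ∧
    (∀ v : Herglotz.spaceA hκ,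
      Herglotz.IsHelmholtzSolution κ
        (Herglotz.herglotzTransform κ (v : Herglotz.L2Cylinder κ))) ∧
    (∀ u : Herglotz.Plane → ℂ, Herglotz.IsHelmholtzSolution κ u →
      ∃! v : Herglotz.spaceA hκ,
        u =ᵐ[Herglotz.diskMeasure]
          Herglotz.herglotzTransform κ (v : Herglotz.L2Cylinder κ)) := by
  obtain ⟨T, hT, hsum, hTa, hb⟩ := Herglotz.exists_herglotz_equiv hκ
  refine ⟨Herglotz.orthonormal_a hκ, Herglotz.orthonormal_b hκ, Herglotz.tauMinus_pos hκ,
    Herglotz.bddAbove_tau hκ, fun v x hx => Herglotz.integrableOn_herglotzIntegrand hκ _ hx,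
    ⟨T, hT, hsum, hTa, hb⟩,
    fun v => Herglotz.isHelmholtzSolution_iff (T v : Herglotz.H1 κ)
      (fun ψ h => Herglotz.helmholtzL_spaceB hκ (T v) h) (hT v), fun u hu => ?_⟩
  obtain ⟨U, hU⟩ := hu.exists_spaceB hκ
  refine ⟨T.symm U, ?_, fun v hv => ?_⟩
  · have h := hT (T.symm U)
    rw [T.apply_symm_apply] at h
    exact hU.symm.trans h
  -- Almost everywhere equality of the functions forces equality in `H¹`, after which injectivity of
  -- `T` gives uniqueness.
  · have h : (T v : Herglotz.H1 κ) = (U : Herglotz.H1 κ) :=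
      Herglotz.H1.ext_of_toFun hκ (((hT v).trans hv.symm).trans hU.symm)
    rw [← Subtype.ext h, T.symm_apply_apply]
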